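/- Let $n$ and $m$ be integers with $1\le m\le n-1$. There is $\varepsilon>0$, depending only on $n$ and $m$, such that for every real number $H$ with $0<H<\varepsilon$ the unit sphere $S^{n+1}(1)\subset\mathbb R^{n+2}$ contains a compact connected smooth embedded hypersurface $M$ (without boundary) with the following properties. (1) $M$ is rotational: there is a smooth curve $s\mapsto(y_1(s),y_2(s),y_3(s))$, $s\in\mathbb R$, in $S^2(1)\cap\{y_1>0\}$, parametrized by arc length, such that $$M=\{(y_1(s)\varphi,\;y_2(s),\;y_3(s)) : s\in\mathbb R,\ \varphi\in S^{n-1}(1)\subset\mathbb R^n\}.$$ (2) $M$ has constant $m$-th mean curvature $H_m=H$: for a suitable smooth unit normal field $N$ of $M$ in $S^{n+1}(1)$, the eigenvalues $\lambda_1,\dots,\lambda_n$ of the shape operator $v\mapsto-dN(v)$ satisfy at every point of $M$ $$\binom nm H=\sum_{1\le i_1<\dots<i_m\le n}\lambda_{i_1}\cdots\lambda_{i_m}.$$ (3) $M$ is nontrivial: with its induced Riemannian metric, $M$ is isometric neither to a round $n$-sphere $S^{n+1}(1)\cap\{x_{n+2}=c\}$, $-1<c<1$, nor to a Clifford hypersurface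 $S^l(a)\times S^{n-l}(b)\subset S^{n+1}(1)$, $1\le l\le n-1$, $a,b>0$, $a^2+b^2=1$. -/

import Mathlib

open scoped ContDiff RealInnerProductSpace

namespace SphereHypersurface

/-- The Euclidean space `ℝⁿ⁺²`, whose unit sphere is `Sⁿ⁺¹(1)`. -/
abbrev Ambient (n : ℕ) : Type := EuclideanSpace ℝ (Fin (n + 2))

/-- The unit sphere `Sⁿ⁺¹(1)`. -/
def unitSphere (n : ℕ) : Set (Ambient n) := Metric.sphere 0 1

/-- `M` is a smooth embedded hypersurface of `Sⁿ⁺¹(1)` (without boundary): near each of its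
points it is the zero set, in the sphere, of a smooth function whose differential does not vanish
on the tangent space `x^⊥` of the sphere. -/
def IsEmbeddedHypersurface (n : ℕ) (M : Set (Ambient n)) : Prop :=
  M ⊆ unitSphere n ∧
    ∀ p ∈ M, ∃ (U : Set (Ambient n)) (f : Ambient n → ℝ),
      IsOpen U ∧ p ∈ U ∧ ContDiffOn ℝ ∞ f U ∧
      (∀ x ∈ M ∩ U, ∃ v : Ambient n, ⟪x, v⟫ = 0 ∧ fderiv ℝ f x v ≠ 0) ∧
      M ∩ U = {x | x ∈ unitSphere n ∧ x ∈ U ∧ f x = 0}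

/-- The tangent space of `M` at `p`, spanned by the velocities at `p` of the smooth curves in `M`
through `p`. -/
def tangentSpace {n : ℕ} (M : Set (Ambient n)) (p : Ambient n) : Submodule ℝ (Ambient n) :=
  Submodule.span ℝ {v | ∃ γ : ℝ → Ambient n,
    ContDiff ℝ ∞ γ ∧ (∀ t, γ t ∈ M) ∧ γ 0 = p ∧ deriv γ 0 = v}

/-- `N` is (an extension to a neighbourhood of `M` of) a smooth unit normal field of `M` in the
sphere: it is tangent to the sphere and orthogonal to `M`. -/
def IsUnitNormal {n : ℕ} (M : Set (Ambient n)) (N : Ambient n → Ambient n) : Prop :=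
  (∃ V : Set (Ambient n), IsOpen V ∧ M ⊆ V ∧ ContDiffOn ℝ ∞ N V) ∧
    ∀ p ∈ M, ‖N p‖ = 1 ∧ ⟪N p, p⟫ = 0 ∧ ∀ v ∈ tangentSpace M p, ⟪N p, v⟫ = 0

/-- `k 0, …, k (n-1)` are the principal curvatures of `M` at `p` with respect to `N`, listed with
multiplicity: the shape operator `v ↦ -dN_p v` of `T_p M` is diagonal, with these eigenvalues, in
some orthonormal basis of `T_p M`. -/
def ArePrincipalCurvatures {n : ℕ} (M : Set (Ambient n)) (N : Ambient n → Ambient n)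
    (p : Ambient n) (k : Fin n → ℝ) : Prop :=
  ∃ e : OrthonormalBasis (Fin n) ℝ (tangentSpace M p),
    ∀ i, fderiv ℝ N p (e i : Ambient n) = -(k i • (e i : Ambient n))

/-- `M` has constant `m`-th mean curvature `H` with respect to `N`: at each point,
`C(n,m) H` is the `m`-th elementary symmetric function of the principal curvatures. -/
def HasConstantMeanCurvature {n : ℕ} (m : ℕ) (M : Set (Ambient n)) (N : Ambient n → Ambient n)
    (H : ℝ) : Prop :=
  ∀ p ∈ M, ∃ k : Fin n → ℝ, ArePrincipalCurvatures M N p k ∧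
    (n.choose m : ℝ) * H =
      ∑ t ∈ Finset.powersetCard m (Finset.univ : Finset (Fin n)), ∏ i ∈ t, k i

/-- `M` is the rotational hypersurface
`{(y₁(s) φ, y₂(s), y₃(s)) : s ∈ ℝ, φ ∈ Sⁿ⁻¹(1)}` generated by the smooth curve `(y₁, y₂, y₃)`,
parametrized by arc length, in the open half sphere `y₁ > 0` of `S²(1)`. -/
def IsRotational {n : ℕ} (M : Set (Ambient n)) : Prop :=
  ∃ y₁ y₂ y₃ : ℝ → ℝ, ContDiff ℝ ∞ y₁ ∧ ContDiff ℝ ∞ y₂ ∧ ContDiff ℝ ∞ y₃ ∧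
    (∀ s, 0 < y₁ s) ∧
    (∀ s, y₁ s ^ 2 + y₂ s ^ 2 + y₃ s ^ 2 = 1) ∧
    (∀ s, deriv y₁ s ^ 2 + deriv y₂ s ^ 2 + deriv y₃ s ^ 2 = 1) ∧
    M = {x | ∃ (s : ℝ) (φ : EuclideanSpace ℝ (Fin n)), ‖φ‖ = 1 ∧
      (∀ i : Fin n, x (Fin.castAdd 2 i) = y₁ s * φ i) ∧
      x (Fin.natAdd n 0) = y₂ s ∧ x (Fin.natAdd n 1) = y₃ s}

/-- `M` and `M'` are isometric as Riemannian manifolds with the induced metrics: there is a smooth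
bijection from `M` onto `M'` whose differential preserves the lengths of tangent vectors. (Its
inverse is then smooth, by the inverse function theorem.) -/
def AreIsometric {n : ℕ} (M M' : Set (Ambient n)) : Prop :=
  ∃ (φ : Ambient n → Ambient n) (V : Set (Ambient n)),
    IsOpen V ∧ M ⊆ V ∧ ContDiffOn ℝ ∞ φ V ∧ Set.BijOn φ M M' ∧
    ∀ p ∈ M, ∀ v ∈ tangentSpace M p, ‖fderiv ℝ φ p v‖ = ‖v‖

/-- The round `n`-sphere cut out of `Sⁿ⁺¹(1)` by the hyperplane where the last coordinate is `c`;
for `-1 < c < 1` these are, up to rotation, all the round hyperspheres of `Sⁿ⁺¹(1)`. -/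
def roundSphere (n : ℕ) (c : ℝ) : Set (Ambient n) :=
  {x | x ∈ unitSphere n ∧ x (Fin.last (n + 1)) = c}

/-- The Clifford hypersurface `Sˡ(a) × Sⁿ⁻ˡ(b)` of `Sⁿ⁺¹(1)`, with `a² + b² = 1`: the first `l + 1`
coordinates lie on the sphere of radius `a`, the other `n - l + 1` on the sphere of radius `b`. -/
def cliffordHypersurface (n l : ℕ) (a b : ℝ) : Set (Ambient n) :=
  {x | ∑ i with i.val ≤ l, x i ^ 2 = a ^ 2 ∧ ∑ i with l < i.val, x i ^ 2 = b ^ 2}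

/-- `M` is nontrivial: it is isometric neither to a round sphere nor to a Clifford hypersurface of
`Sⁿ⁺¹(1)`. -/
def IsNontrivial {n : ℕ} (M : Set (Ambient n)) : Prop :=
  (∀ c : ℝ, -1 < c → c < 1 → ¬ AreIsometric M (roundSphere n c)) ∧
    ∀ (l : ℕ) (a b : ℝ), 1 ≤ l → l ≤ n - 1 → 0 < a → 0 < b → a ^ 2 + b ^ 2 = 1 →
      ¬ AreIsometric M (cliffordHypersurface n l a b)

end SphereHypersurface

/-! The profile curve is sought as `(w, cos θ, sin θ) / √(1 + w²)`, the projection to the sphere of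
a graph over the unit circle. Great circles are then the solutions of `w'' + w = 0`, so that
prescribing the curvature of the profile is a second order equation for `w`. Let `λ` be the
principal curvature along the orbits (multiplicity `n - 1`) and `μ` the one along the profile. The
condition `H_m = H` becomes `(n - m) λ^m + m λ^(m-1) μ = n H`; solved for `μ`, it is an autonomous
equation `w'' = G (w, w'²)`. It has the first integral `Q = y₁^n (λ^m - H)`
(`isConfining_profileEquation`). The sets `Q ≥ c > 0` are bounded and stay away from `w = 0`, so
solutions with `Q > 0` exist for all time. A `2π`-periodic solution closes up to a compact
hypersurface, which is embedded because it is a graph over the angle.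

It remains to find a nonconstant `2π`-periodic solution. The equation is reversible, so a solution
that starts with `w' = 0` at a neck and has `w' = 0` again at `π / 2` is symmetric about both times
and has period `π` (`IsSolution.periodic`). Such a solution is found by shooting from necks of width
`a` (`exists_symmetric_solution`), between two extremes. Near the equilibrium `b` the oscillation
has squared frequency about `2 + n H b^(m-2)`, which is less than `4` for small `H`; by Sturm
comparison `w` still increases at `π / 2` (`fderiv_profileEquation`, `pos_near_equilibrium`). For
very thin necks the hypersurface resembles a chain of umbilic spheres of curvature `H^(1/m) > 0`.
These are smaller than great spheres, their angular radius is less than `π / 2`, and `w` stops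
increasing before `π / 2` (`exists_thin_neck`). In between, the minimum of `w'` over a fixed
interval `[τ, π / 2]` passes through `0`, and by uniqueness this zero can only be attained at `π /
2`.

Nontriviality is a matter of intrinsic curvature. The induced metric is the warped product of `e
dt²` with `y₁²` times the metric of the unit sphere, and at a neck `y₁²` has a nondegenerate
minimum, so a plane spanned by the profile and an orbit direction has negative sectional curvature
(`warped_product_waist`). Round spheres and Clifford hypersurfaces have nonnegative curvature
(`curvature_nonneg_of_blocks`). Both facts are read off from Gauss's equation in `ℝⁿ⁺²`, whose
curvature term is expressed by the metric alone and so is unchanged by an isometry. -/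

namespace SphereHypersurface

open Set Filter Topology NNReal

/-! ### Integral curves of vector fields -/

/-- A bounded Lipschitz autonomous vector field has global integral curves. -/
theorem exists_global_solution {E : Type*} [NormedAddCommGroup E] [NormedSpace ℝ E]
    [CompleteSpace E] {v : E → E} {K L : ℝ≥0} (hv : LipschitzWith K v) (hL : ∀ x, ‖v x‖ ≤ L)
    (x₀ : E) : ∃ y : ℝ → E, y 0 = x₀ ∧ ∀ t, HasDerivAt y (v (y t)) t := by
  have hk : ∀ k : ℕ, ∃ α : ℝ → E, α 0 = x₀ ∧ ∀ t ∈ Ioo (-((k : ℝ) + 1)) ((k : ℝ) + 1),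
      HasDerivAt α (v (α t)) t := by
    intro k
    have h0 : (0 : ℝ) ∈ Icc (-((k : ℝ) + 1)) ((k : ℝ) + 1) := by
      constructor <;> linarith [(Nat.cast_nonneg k : (0 : ℝ) ≤ k)]
    have hp : IsPicardLindelof (fun _ => v) ⟨0, h0⟩ x₀ (L * ((k : ℝ≥0) + 1)) 0 L K := by
      refine ⟨fun t _ => hv.lipschitzOnWith, fun x _ => continuousOn_const,
        fun t _ x _ => hL x, ?_⟩
      simp
    obtain ⟨α, h1, h2⟩ := hp.exists_eq_forall_mem_Icc_hasDerivWithinAt₀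
    exact ⟨α, h1, fun t ht => (h2 t (Ioo_subset_Icc_self ht)).hasDerivAt (Icc_mem_nhds ht.1 ht.2)⟩
  choose α h1 h2 using hk
  have huniq : ∀ j k : ℕ, j ≤ k → EqOn (α j) (α k) (Ioo (-((j : ℝ) + 1)) ((j : ℝ) + 1)) := by
    intro j k hjk
    have hjk' : (j : ℝ) ≤ k := by exact_mod_cast hjk
    have hj0 : (0 : ℝ) ≤ j := Nat.cast_nonneg j
    refine ODE_solution_unique_of_mem_Ioo (v := fun _ => v) (s := fun _ => univ) (K := K) (t₀ := 0)
      (fun t _ => hv.lipschitzOnWith) ⟨by linarith, by linarith⟩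
      (fun t ht => ⟨h2 j t ht, mem_univ _⟩)
      (fun t ht => ⟨h2 k t ⟨by linarith [ht.1], by linarith [ht.2]⟩, mem_univ _⟩) ?_
    rw [h1, h1]
  -- The `k`-th solution lives on `|t| < k + 1`, so `t` is interior to the domain of index `⌈|t|⌉`;
  -- uniqueness makes the choices at neighbouring times agree.
  refine ⟨fun t => α ⌈|t|⌉₊ t, by simp [h1], fun t => ?_⟩
  set k := ⌈|t|⌉₊ with hk
  have htk : t ∈ Ioo (-((k : ℝ) + 1)) ((k : ℝ) + 1) := by
    have := Nat.le_ceil |t|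
    rw [← hk] at this
    have h3 := abs_le.1 this
    constructor <;> linarith [h3.1, h3.2]
  refine (h2 k t htk).congr_of_eventuallyEq ?_
  filter_upwards [Ioo_mem_nhds htk.1 htk.2] with s hs
  have hs' : s ∈ Ioo (-((⌈|s|⌉₊ : ℝ) + 1)) ((⌈|s|⌉₊ : ℝ) + 1) := by
    have h3 := abs_le.1 (Nat.le_ceil |s|)
    constructor <;> linarith [h3.1, h3.2]
  rcases le_total ⌈|s|⌉₊ k with h | h
  · exact huniq _ _ h hs'
  · exact (huniq _ _ h hs).symm

/-- Integral curves of a smooth vector field are smooth. -/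
theorem contDiff_of_hasDerivAt {E : Type*} [NormedAddCommGroup E] [NormedSpace ℝ E]
    {v : E → E} {y : ℝ → E} {U : Set E} (hU : IsOpen U) (hv : ContDiffOn ℝ ∞ v U)
    (hy : ∀ t, HasDerivAt y (v (y t)) t) (hyU : ∀ t, y t ∈ U) : ContDiff ℝ ∞ y := by
  have hd : deriv y = v ∘ y := funext fun t => (hy t).deriv
  have hdiff : Differentiable ℝ y := fun t => (hy t).differentiableAt
  rw [contDiff_infty]
  intro k
  induction k with
  | zero => exact contDiff_zero.2 hdiff.continuous
  | succ k ih =>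
    have : ((k + 1 : ℕ) : WithTop ℕ∞) = (k : WithTop ℕ∞) + 1 := by push_cast; rfl
    rw [this, contDiff_succ_iff_deriv]
    refine ⟨hdiff, by simp, ?_⟩
    rw [hd, contDiff_iff_contDiffAt]
    intro t
    have h1 : ContDiffAt ℝ k v (y t) :=
      ((hv.contDiffAt (hU.mem_nhds (hyU t))).of_le (by exact_mod_cast le_top))
    exact h1.comp t ih.contDiffAt

theorem lipschitzWith_clamp (a b : ℝ) : LipschitzWith 1 (fun x : ℝ => max a (min b x)) := by
  refine LipschitzWith.const_max (LipschitzWith.const_min LipschitzWith.id b) a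

/-- The solution of a Lipschitz equation depends continuously on the initial value. -/
theorem dist_solution_le {E : Type*} [NormedAddCommGroup E] [NormedSpace ℝ E]
    {v : E → E} {K : ℝ≥0} (hv : LipschitzWith K v) {y z : ℝ → E}
    (hy : ∀ t, HasDerivAt y (v (y t)) t) (hz : ∀ t, HasDerivAt z (v (z t)) t) {T t : ℝ}
    (h0 : 0 ≤ t) (hT : t ≤ T) : dist (y t) (z t) ≤ dist (y 0) (z 0) * Real.exp (K * T) := by
  have := dist_le_of_trajectories_ODE (v := fun _ => v) (K := K) (f := y) (g := z) (a := 0) (b := T)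
    (fun _ => hv) (fun t _ => (hy t).continuousAt.continuousWithinAt)
    (fun t _ => (hy t).hasDerivWithinAt)
    (fun t _ => (hz t).continuousAt.continuousWithinAt)
    (fun t _ => (hz t).hasDerivWithinAt) le_rfl t ⟨h0, hT⟩
  refine this.trans ?_
  have : (K : ℝ) * (t - 0) ≤ K * T := mul_le_mul_of_nonneg_left (by linarith) K.2
  gcongr

/-! ### Second order equations with a confining first integral -/

/-- `w` is a positive solution of `w'' = G (w, w' ^ 2)`, with `p = w'`. -/
def IsSolution (G : ℝ × ℝ → ℝ) (w p : ℝ → ℝ) : Prop :=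
  ∀ t, HasDerivAt w (p t) t ∧ HasDerivAt p (G (w t, p t ^ 2)) t ∧ 0 < w t

/-- `Q` is a first integral of `w'' = G (w, w' ^ 2)` in the half plane `w > 0`, with superlevel
sets `Q ≥ c > 0` that are bounded away from the boundary. -/
structure IsConfining (G Q : ℝ × ℝ → ℝ) : Prop where
  smooth : ContDiffOn ℝ ∞ G {x | 0 < x.1 ∧ -1 < x.2}
  cont : ContinuousOn Q {x | 0 < x.1}
  conserved : ∀ (w p : ℝ → ℝ) (t : ℝ), HasDerivAt w (p t) t →
    HasDerivAt p (G (w t, p t ^ 2)) t → 0 < w t → HasDerivAt (fun s => Q (w s, p s)) 0 t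
  bounded : ∀ c : ℝ, 0 < c → ∃ α β B : ℝ, 0 < α ∧ 0 ≤ B ∧ ∀ w p : ℝ, 0 < w → c ≤ Q (w, p) →
    α ≤ w ∧ w ≤ β ∧ |p| ≤ B

/-- The vector field of the first order system of `w'' = G (w, w' ^ 2)`. -/
def phaseField (G : ℝ × ℝ → ℝ) (x : ℝ × ℝ) : ℝ × ℝ := (x.2, G (x.1, x.2 ^ 2))

theorem contDiffOn_phaseField {G Q : ℝ × ℝ → ℝ} (h : IsConfining G Q) :
    ContDiffOn ℝ ∞ (phaseField G) {x | 0 < x.1} := by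
  refine contDiff_snd.contDiffOn.prodMk ?_
  refine h.smooth.comp (contDiff_fst.prodMk (contDiff_snd.pow 2)).contDiffOn ?_
  intro x hx
  exact ⟨hx, by have := sq_nonneg x.2; show (-1 : ℝ) < x.2 ^ 2; linarith⟩

/-- Near a superlevel set of the first integral, the field extends to a bounded Lipschitz field. -/
theorem exists_lipschitz_extension {G Q : ℝ × ℝ → ℝ} (h : IsConfining G Q) {c : ℝ} (hc : 0 < c) :
    ∃ (V : ℝ × ℝ → ℝ × ℝ) (K L : ℝ≥0) (R : Set (ℝ × ℝ)), LipschitzWith K V ∧ (∀ x, ‖V x‖ ≤ L) ∧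
      IsOpen R ∧ (∀ x : ℝ × ℝ, 0 < x.1 → c ≤ Q x → x ∈ R) ∧ closure R ⊆ {x | 0 < x.1} ∧
      EqOn V (phaseField G) R := by
  obtain ⟨α, β, B, hα, hB, hbd⟩ := h.bounded c hc
  set β' := max β α + 1 with hβ'
  have hαβ : α / 2 < β' := by have := le_max_right β α; linarith
  -- `C` is a 1-Lipschitz retraction onto a compact rectangle, and the extension is the field
  -- composed with `C`. The margins `α / 2` and `1` place the superlevel set in the interior of the
  -- rectangle; `max β α` is needed because `α ≤ β` can fail when that set is empty.
  let C : ℝ × ℝ → ℝ × ℝ := fun x => (max (α / 2) (min β' x.1), max (-(B + 1)) (min (B + 1) x.2))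
  have hC : LipschitzWith 1 C := by
    have h1 := (lipschitzWith_clamp (α / 2) β').comp (LipschitzWith.prod_fst (α := ℝ) (β := ℝ))
    have h2 := (lipschitzWith_clamp (-(B + 1)) (B + 1)).comp
      (LipschitzWith.prod_snd (α := ℝ) (β := ℝ))
    have h3 := h1.prodMk h2
    rw [one_mul, max_self] at h3
    exact h3
  let Kr : Set (ℝ × ℝ) := Icc (α / 2) β' ×ˢ Icc (-(B + 1)) (B + 1)
  have hKc : IsCompact Kr := isCompact_Icc.prod isCompact_Icc
  have hKconv : Convex ℝ Kr := (convex_Icc _ _).prod (convex_Icc _ _)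
  have hKpos : Kr ⊆ {x | 0 < x.1} := fun x hx => by
    have := hx.1.1
    show 0 < x.1
    linarith
  have hCK : ∀ x, C x ∈ Kr := fun x =>
    ⟨⟨le_max_left _ _, max_le hαβ.le (min_le_left _ _)⟩,
      ⟨le_max_left _ _, max_le (by linarith) (min_le_left _ _)⟩⟩
  have hopen : IsOpen {x : ℝ × ℝ | 0 < x.1} := isOpen_lt continuous_const continuous_fst
  have hsm := contDiffOn_phaseField h
  obtain ⟨K, hK⟩ : ∃ K, LipschitzOnWith K (phaseField G) Kr :=
    (ContDiffOn.mono (hsm.of_le (by exact_mod_cast le_top)) hKpos).exists_lipschitzOnWith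
      (n := 1) (by norm_num) hKconv hKc
  obtain ⟨L, hL⟩ := hKc.exists_bound_of_continuousOn (hsm.continuousOn.mono hKpos)
  refine ⟨phaseField G ∘ C, K * 1, L.toNNReal, Ioo (α / 2) β' ×ˢ Ioo (-(B + 1)) (B + 1), ?_, ?_,
    isOpen_Ioo.prod isOpen_Ioo, ?_, ?_, ?_⟩
  · have := hK.comp (hC.lipschitzOnWith (s := univ)) (fun x _ => hCK x)
    exact lipschitzOnWith_univ.1 this
  · intro x
    exact (hL _ (hCK x)).trans (Real.le_coe_toNNReal L)
  · intro x hx hQ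
    obtain ⟨h1, h2, h3⟩ := hbd x.1 x.2 hx hQ
    have h4 := abs_le.1 h3
    have h5 := le_max_left β α
    exact ⟨⟨by linarith, by linarith⟩, ⟨by linarith, by linarith⟩⟩
  · refine (closure_minimal ?_ hKc.isClosed).trans hKpos
    exact prod_mono Ioo_subset_Icc_self Ioo_subset_Icc_self
  · intro x hx
    have : C x = x := by
      refine Prod.ext ?_ ?_
      · show max (α / 2) (min β' x.1) = x.1
        rw [min_eq_right hx.1.2.le, max_eq_right hx.1.1.le]
      · show max (-(B + 1)) (min (B + 1) x.2) = x.2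
        rw [min_eq_right hx.2.2.le, max_eq_right hx.2.1.le]
    simp [this]

theorem IsSolution.hasDerivAt {G : ℝ × ℝ → ℝ} {w p : ℝ → ℝ} (h : IsSolution G w p) (t : ℝ) :
    HasDerivAt (fun t => (w t, p t)) (phaseField G (w t, p t)) t :=
  (h t).1.prodMk (h t).2.1

theorem IsSolution.conserved {G Q : ℝ × ℝ → ℝ} {w p : ℝ → ℝ} (h : IsConfining G Q)
    (hs : IsSolution G w p) (t : ℝ) : Q (w t, p t) = Q (w 0, p 0) := by
  have hd := fun t => h.conserved w p t (hs t).1 (hs t).2.1 (hs t).2.2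
  exact is_const_of_deriv_eq_zero (f := fun t => Q (w t, p t)) (fun t => (hd t).differentiableAt)
    (fun t => (hd t).deriv) t 0

theorem IsSolution.contDiff {G Q : ℝ × ℝ → ℝ} {w p : ℝ → ℝ} (h : IsConfining G Q)
    (hs : IsSolution G w p) : ContDiff ℝ ∞ w ∧ ContDiff ℝ ∞ p := by
  have := contDiff_of_hasDerivAt (isOpen_lt continuous_const continuous_fst)
    (contDiffOn_phaseField h) hs.hasDerivAt (fun t => (hs t).2.2)
  exact ⟨contDiff_fst.comp this, contDiff_snd.comp this⟩

/-- An integral curve of the extended field that starts in the superlevel set remains there. -/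
theorem isSolution_of_extension {G Q : ℝ × ℝ → ℝ} (h : IsConfining G Q) {c : ℝ}
    {V : ℝ × ℝ → ℝ × ℝ} {R : Set (ℝ × ℝ)} (hR : IsOpen R)
    (hQR : ∀ x : ℝ × ℝ, 0 < x.1 → c ≤ Q x → x ∈ R) (hcl : closure R ⊆ {x | 0 < x.1})
    (hV : EqOn V (phaseField G) R) {y : ℝ → ℝ × ℝ} (hy : ∀ t, HasDerivAt y (V (y t)) t)
    (h0 : 0 < (y 0).1) (hQ0 : c ≤ Q (y 0)) :
    IsSolution G (fun t => (y t).1) (fun t => (y t).2) ∧ ∀ t, y t ∈ R := by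
  have hyc : Continuous y := continuous_iff_continuousAt.2 fun t => (hy t).continuousAt
  have hin : ∀ t, y t ∈ R → HasDerivAt (fun t => (y t).1) (y t).2 t ∧
      HasDerivAt (fun t => (y t).2) (G ((y t).1, (y t).2 ^ 2)) t ∧ 0 < (y t).1 := by
    intro t ht
    have h1 := hy t
    rw [hV ht] at h1
    have h2 := (hasFDerivAt_fst (p := y t)).comp_hasDerivAt t h1
    have h3 := (hasFDerivAt_snd (p := y t)).comp_hasDerivAt t h1
    exact ⟨h2, h3, hcl (subset_closure ht)⟩
  let T : Set ℝ := {t | y t ∈ R ∧ Q (y t) = Q (y 0)}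
  -- `T` is closed because limit points of `R` still lie in the half plane, where `Q` is continuous,
  -- and the bound `c ≤ Q` puts them back into `R`. It is open because `Q` is conserved as long as
  -- the curve is in `R`.
  have hT1 : T = {t | t ∈ y ⁻¹' closure R ∧ Q (y t) ∈ ({Q (y 0)} : Set ℝ)} := by
    ext t
    constructor
    · exact fun ht => ⟨subset_closure ht.1, ht.2⟩
    · intro ht
      have h2 : Q (y t) = Q (y 0) := ht.2
      exact ⟨hQR _ (hcl ht.1) (by rw [h2]; exact hQ0), h2⟩
  have hclosed : IsClosed T := by
    rw [hT1]
    have hc1 : ContinuousOn (fun t => Q (y t)) (y ⁻¹' closure R) :=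
      h.cont.comp hyc.continuousOn (fun t ht => hcl ht)
    exact hc1.preimage_isClosed_of_isClosed (isClosed_closure.preimage hyc) isClosed_singleton
  have hopen : IsOpen T := by
    rw [isOpen_iff_mem_nhds]
    intro t ht
    have h1 : y ⁻¹' R ∈ 𝓝 t := (hR.preimage hyc).mem_nhds ht.1
    obtain ⟨ε, hε, hball⟩ := Metric.mem_nhds_iff.1 h1
    filter_upwards [Metric.ball_mem_nhds t hε] with s hs
    refine ⟨hball hs, ?_⟩
    rw [← ht.2]
    have hd : ∀ s ∈ Metric.ball t ε, HasDerivAt (fun s => Q (y s)) 0 s := fun s hs => by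
      obtain ⟨h1, h2, h3⟩ := hin s (hball hs)
      exact h.conserved _ _ s h1 h2 h3
    exact Metric.isOpen_ball.is_const_of_deriv_eq_zero
      (convex_ball t ε).isPreconnected
      (fun s hs => (hd s hs).differentiableAt.differentiableWithinAt)
      (fun s hs => (hd s hs).deriv) hs (Metric.mem_ball_self hε)
  have huniv : T = univ := IsClopen.eq_univ ⟨hclosed, hopen⟩ ⟨0, hQR _ h0 hQ0, rfl⟩
  have hall : ∀ t, y t ∈ R := fun t => (huniv ▸ mem_univ t : t ∈ T).1
  exact ⟨fun t => hin t (hall t), hall⟩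

/-- Both curves stay in a superlevel set of `Q`, where the field agrees with a globally Lipschitz
one; by conservation, positivity of `Q` at the single time `t₀` is enough. -/
theorem IsSolution.unique {G Q : ℝ × ℝ → ℝ} (h : IsConfining G Q) {w p w' p' : ℝ → ℝ}
    (hs : IsSolution G w p) (hs' : IsSolution G w' p') {t₀ : ℝ} (hw : w t₀ = w' t₀)
    (hp : p t₀ = p' t₀) (hQ : 0 < Q (w t₀, p t₀)) : w = w' ∧ p = p' := by
  obtain ⟨V, K, L, R, hVK, -, -, hQR, -, hV⟩ := exists_lipschitz_extension h hQ
  have hm : ∀ t, (w t, p t) ∈ R := fun t => hQR _ (hs t).2.2 (by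
    rw [hs.conserved h t, hs.conserved h t₀])
  have hm' : ∀ t, (w' t, p' t) ∈ R := fun t => hQR _ (hs' t).2.2 (by
    rw [hs'.conserved h t, hw, hp, hs'.conserved h t₀])
  have heq := ODE_solution_unique_univ (v := fun _ => V) (s := fun _ => univ) (K := K) (t₀ := t₀)
    (f := fun t => (w t, p t)) (g := fun t => (w' t, p' t)) (fun t => hVK.lipschitzOnWith)
    (fun t => ⟨by rw [hV (hm t)]; exact hs.hasDerivAt t, mem_univ _⟩)
    (fun t => ⟨by rw [hV (hm' t)]; exact hs'.hasDerivAt t, mem_univ _⟩) (by simp [hw, hp])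
  exact ⟨funext fun t => congrArg Prod.fst (congrFun heq t),
    funext fun t => congrArg Prod.snd (congrFun heq t)⟩

/-- The equation is reversible, since `G` sees the velocity only through its square. -/
theorem IsSolution.reflect {G : ℝ × ℝ → ℝ} {w p : ℝ → ℝ} (hs : IsSolution G w p) (b : ℝ) :
    IsSolution G (fun t => w (b - t)) (fun t => -p (b - t)) := by
  intro t
  have hb : HasDerivAt (fun t => b - t) (-1) t := by simpa using (hasDerivAt_id t).const_sub b
  refine ⟨?_, ?_, (hs (b - t)).2.2⟩
  · have := (hs (b - t)).1.comp t hb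
    rwa [mul_neg_one] at this
  · have := ((hs (b - t)).2.1.comp t hb).neg
    rw [mul_neg_one, neg_neg, ← neg_sq] at this
    exact this

/-- A solution with horizontal tangents at `0` and at `π / 2` is `2 * π`-periodic. -/
theorem IsSolution.periodic {G Q : ℝ × ℝ → ℝ} (h : IsConfining G Q) {w p : ℝ → ℝ}
    (hs : IsSolution G w p) (hQ : 0 < Q (w 0, p 0)) (h0 : p 0 = 0) (h1 : p (Real.pi / 2) = 0) :
    ∀ t, w (t + 2 * Real.pi) = w t := by
  -- The reflections about `0` and about `π / 2` compose to the translation by `π`, which is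
  -- therefore already a period.
  have e1 : ∀ t, w t = w (0 - t) := fun t => congrFun
    (hs.unique h (hs.reflect 0) (t₀ := 0) (by simp) (by simp [h0]) hQ).1 t
  have e2 : ∀ t, w t = w (Real.pi - t) := fun t => congrFun
    (hs.unique h (hs.reflect Real.pi) (t₀ := Real.pi / 2) (by congr 1; ring)
      (by rw [show Real.pi - Real.pi / 2 = Real.pi / 2 by ring, h1]; simp)
      (by rw [hs.conserved h]; exact hQ)).1 t
  have e3 : ∀ t, w (t + Real.pi) = w t := fun t => by
    rw [e2 (t + Real.pi), e1 t]; congr 1; ring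
  intro t
  rw [two_mul, ← add_assoc, e3, e3]

/-! ### Sturm comparison and shooting -/

/-- Sturm comparison: a solution of `p'' = -q p` with `p(0) = 0 < p'(0)` and `q < 4` is positive
on `(0, π / 2]`. -/
theorem pos_of_sturm {p p' q : ℝ → ℝ} (h1 : ∀ t, HasDerivAt p (p' t) t)
    (h2 : ∀ t, HasDerivAt p' (-(q t * p t)) t) (h0 : p 0 = 0) (h0' : 0 < p' 0)
    (hq : ∀ t ∈ Icc 0 (Real.pi / 2), q t < 4) : ∀ t ∈ Ioc 0 (Real.pi / 2), 0 < p t := by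
  have hpi := Real.pi_pos
  have hpc : Continuous p := continuous_iff_continuousAt.2 fun t => (h1 t).continuousAt
  have hpc' : Continuous p' := continuous_iff_continuousAt.2 fun t => (h2 t).continuousAt
  by_contra! hcon
  obtain ⟨s, hs, hps⟩ := hcon
  obtain ⟨ε, hε, hball⟩ := Metric.mem_nhds_iff.1 ((isOpen_lt continuous_const hpc').mem_nhds h0')
  have hnear : ∀ t ∈ Ioo 0 ε, 0 < p t := by
    have hmono : StrictMonoOn p (Ico 0 ε) := by
      refine strictMonoOn_of_deriv_pos (convex_Ico 0 ε) hpc.continuousOn ?_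
      intro t ht
      rw [interior_Ico] at ht
      rw [(h1 t).deriv]
      exact hball (by rw [Metric.mem_ball, Real.dist_eq, sub_zero, abs_of_pos ht.1]; exact ht.2)
    intro t ht
    have := hmono ⟨le_rfl, hε⟩ ⟨ht.1.le, ht.2⟩ ht.1
    rwa [h0] at this
  -- The nonpositive times, kept away from the trivial zero at `0`, form a compact set; its least
  -- element `τ` is the first positive zero of `p`.
  let Z : Set ℝ := Icc (ε / 2) (Real.pi / 2) ∩ {t | p t ≤ 0}
  have hZ : IsCompact Z := isCompact_Icc.inter_right (isClosed_le hpc continuous_const)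
  have hZs : s ∈ Z := by
    refine ⟨⟨?_, hs.2⟩, hps⟩
    by_contra! h
    exact absurd (hnear s ⟨hs.1, by linarith⟩) (not_lt.2 hps)
  obtain ⟨τ, hτZ, hτ⟩ := hZ.exists_isLeast ⟨s, hZs⟩
  have hτ0 : 0 < τ := by have := hτZ.1.1; linarith
  have hτ2 : τ ≤ Real.pi / 2 := hτZ.1.2
  have hpos : ∀ t ∈ Ioo 0 τ, 0 < p t := by
    intro t ht
    by_contra! h
    rcases lt_or_ge t ε with h3 | h3
    · exact absurd (hnear t ⟨ht.1, h3⟩) (not_lt.2 h)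
    · exact absurd (hτ ⟨⟨by linarith, by linarith [ht.2]⟩, h⟩) (not_le.2 ht.2)
  have hpτ : p τ = 0 := by
    refine le_antisymm hτZ.2 ?_
    refine ge_of_tendsto (x := 𝓝[<] τ) (hpc.continuousAt.continuousWithinAt) ?_
    filter_upwards [Ioo_mem_nhdsLT hτ0] with t ht
    exact (hpos t ht).le
  have hpτ' : p' τ ≤ 0 := by
    have := (hasDerivAt_iff_tendsto_slope_left_right.1 (h1 τ)).1
    refine le_of_tendsto this ?_
    filter_upwards [Ioo_mem_nhdsLT hτ0] with t ht
    rw [slope_def_field, hpτ]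
    have h3 := hpos t ht
    exact div_nonpos_of_nonneg_of_nonpos (by linarith) (by linarith [ht.2])
  -- The Wronskian of `p` with `sin 2t`, the solution of `y'' = -4y` whose first positive zero is `π
  -- / 2`. It starts at `0` and increases strictly up to `τ ≤ π / 2`, but at `τ` it equals `p'(τ)
  -- sin 2τ ≤ 0`.
  let W : ℝ → ℝ := fun t => p' t * Real.sin (2 * t) - 2 * p t * Real.cos (2 * t)
  have hW : ∀ t, HasDerivAt W ((4 - q t) * p t * Real.sin (2 * t)) t := by
    intro t
    have h2t : HasDerivAt (fun t : ℝ => 2 * t) 2 t := by simpa using (hasDerivAt_id t).const_mul 2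
    have := ((h2 t).mul h2t.sin).sub (((h1 t).const_mul 2).mul h2t.cos)
    refine this.congr_deriv ?_
    ring
  have hWc : Continuous W := continuous_iff_continuousAt.2 fun t => (hW t).continuousAt
  have hWm : StrictMonoOn W (Icc 0 τ) := by
    refine strictMonoOn_of_deriv_pos (convex_Icc 0 τ) hWc.continuousOn ?_
    intro t ht
    rw [interior_Icc] at ht
    rw [(hW t).deriv]
    have := hq t ⟨ht.1.le, by linarith [ht.2]⟩
    have h3 := hpos t ht
    have h4 : 0 < Real.sin (2 * t) := Real.sin_pos_of_pos_of_lt_pi (by linarith [ht.1])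
      (by linarith [ht.2])
    have h5 : 0 < 4 - q t := by linarith
    positivity
  have := hWm ⟨le_rfl, hτ0.le⟩ ⟨hτ0.le, le_rfl⟩ hτ0
  have h4 : 0 ≤ Real.sin (2 * τ) := Real.sin_nonneg_of_nonneg_of_le_pi (by linarith)
    (by linarith)
  simp only [W, h0, hpτ] at this
  simp at this
  nlinarith

/-- The solutions that start near a centre of the oscillation with `w' = 0` increase for at least
a quarter turn. -/
theorem pos_near_equilibrium {G Q : ℝ × ℝ → ℝ} (h : IsConfining G Q) {b : ℝ} (hb : 0 < b)
    (hstab : -4 < fderiv ℝ G (b, 0) (1, 0)) (hG : G (b, 0) = 0) :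
    ∃ ρ > 0, ∀ w p : ℝ → ℝ, IsSolution G w p → p 0 = 0 → 0 < G (w 0, 0) →
      (∀ t ∈ Icc 0 (Real.pi / 2), dist (w t, p t) (b, 0) < ρ) →
      ∀ t ∈ Ioc 0 (Real.pi / 2), 0 < p t := by
  have hU : IsOpen {x : ℝ × ℝ | 0 < x.1 ∧ -1 < x.2} :=
    (isOpen_lt continuous_const continuous_fst).inter (isOpen_lt continuous_const continuous_snd)
  -- Differentiating `p' = G (w, p²)` along a solution gives `p'' = -q p` with this `q`. At the
  -- equilibrium it is minus the derivative of `G` in `w`, hence less than `4`, and by continuity it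
  -- remains so nearby.
  let q : ℝ × ℝ → ℝ := fun x => -(fderiv ℝ G (x.1, x.2 ^ 2) (1, 0) +
    2 * G (x.1, x.2 ^ 2) * fderiv ℝ G (x.1, x.2 ^ 2) (0, 1))
  have hqb : q (b, 0) < 4 := by
    simp only [q]
    norm_num [hG]
    linarith
  have hmem : ((b, 0) : ℝ × ℝ) ∈ {x : ℝ × ℝ | 0 < x.1 ∧ -1 < x.2} := ⟨hb, by norm_num⟩
  have hGd := h.smooth.contDiffAt (hU.mem_nhds hmem)
  have hsq : ContinuousAt (fun x : ℝ × ℝ => (x.1, x.2 ^ 2)) ((b, 0) : ℝ × ℝ) := by fun_prop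
  have hval : ((((b, 0) : ℝ × ℝ).1, ((b, 0) : ℝ × ℝ).2 ^ 2) : ℝ × ℝ) = (b, 0) := by simp
  have hc1 : ContinuousAt (fun x : ℝ × ℝ => G (x.1, x.2 ^ 2)) ((b, 0) : ℝ × ℝ) :=
    ContinuousAt.comp (g := G) (by rw [hval]; exact hGd.continuousAt) hsq
  have hc2 : ContinuousAt (fun x : ℝ × ℝ => fderiv ℝ G (x.1, x.2 ^ 2)) ((b, 0) : ℝ × ℝ) :=
    ContinuousAt.comp (g := fderiv ℝ G) (by
      rw [hval]; exact (hGd.fderiv_right (m := 0) (by simp)).continuousAt) hsq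
  have hqc : ContinuousAt q (b, 0) := by
    refine ContinuousAt.neg (ContinuousAt.add ?_ ?_)
    · exact hc2.clm_apply continuousAt_const
    · exact (continuousAt_const.mul hc1).mul (hc2.clm_apply continuousAt_const)
  obtain ⟨ρ, hρ, hball⟩ := Metric.mem_nhds_iff.1 (hqc.eventually (eventually_lt_nhds hqb))
  refine ⟨ρ, hρ, fun w p hs hp0 hw0 hdist => ?_⟩
  refine pos_of_sturm (p' := fun t => G (w t, p t ^ 2)) (q := fun t => q (w t, p t))
    (fun t => (hs t).2.1) ?_ hp0 (by simpa [hp0] using hw0)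
    (fun t ht => hball (hdist t ht))
  intro t
  have hm : (w t, p t ^ 2) ∈ {x : ℝ × ℝ | 0 < x.1 ∧ -1 < x.2} :=
    ⟨(hs t).2.2, by have := sq_nonneg (p t); show (-1 : ℝ) < p t ^ 2; linarith⟩
  have hd : HasFDerivAt G (fderiv ℝ G (w t, p t ^ 2)) (w t, p t ^ 2) :=
    ((h.smooth.contDiffAt (hU.mem_nhds hm)).differentiableAt (by simp)).hasFDerivAt
  have h1 : HasDerivAt (fun t => (w t, p t ^ 2)) (p t, 2 * p t * G (w t, p t ^ 2)) t := by
    have := (hs t).1.prodMk ((hs t).2.1.pow 2)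
    simpa using this
  have h2 := hd.comp_hasDerivAt t h1
  refine h2.congr_deriv ?_
  have : ((p t, 2 * p t * G (w t, p t ^ 2)) : ℝ × ℝ) =
      p t • ((1, 0) : ℝ × ℝ) + (2 * p t * G (w t, p t ^ 2)) • ((0, 1) : ℝ × ℝ) := by simp
  rw [this, map_add, map_smul, map_smul]
  simp only [q, smul_eq_mul]
  ring

/-- The initial slopes along a compact family of initial values are uniformly positive. -/
theorem uniform_pos_of_lipschitz {V : ℝ × ℝ → ℝ × ℝ} {K L : ℝ≥0} (hV : LipschitzWith K V)
    (hL : ∀ x, ‖V x‖ ≤ L) {c : ℝ} (hc : 0 < c) {y : ℝ → ℝ × ℝ}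
    (hy : ∀ t, HasDerivAt y (V (y t)) t) (h0 : (y 0).2 = 0) (hcV : c ≤ (V (y 0)).2) :
    ∀ t ∈ Ioc 0 (c / (2 * (K * L + 1))), 0 < (y t).2 := by
  have hyc : Continuous y := continuous_iff_continuousAt.2 fun t => (hy t).continuousAt
  have hKL : 0 < 2 * ((K : ℝ) * L + 1) := by positivity
  have hb : ∀ t, 0 ≤ t → ‖y t - y 0‖ ≤ L * t := by
    intro t ht
    have := (convex_Icc 0 t).norm_image_sub_le_of_norm_hasDerivWithin_le (f := y)
      (f' := fun t => V (y t)) (C := L) (fun s _ => (hy s).hasDerivWithinAt) (fun s _ => hL _)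
      (left_mem_Icc.2 ht) (right_mem_Icc.2 ht)
    simpa [abs_of_nonneg ht] using this
  have hd : ∀ t, HasDerivAt (fun t => (y t).2) (V (y t)).2 t := fun t =>
    (hasFDerivAt_snd (p := y t)).comp_hasDerivAt t (hy t)
  have hpos : ∀ t ∈ Icc 0 (c / (2 * (K * L + 1))), 0 < (V (y t)).2 := by
    intro t ht
    have h1 : |(V (y t)).2 - (V (y 0)).2| ≤ K * (L * t) := by
      have h2 := hV.dist_le_mul (y t) (y 0)
      rw [dist_eq_norm, dist_eq_norm] at h2
      exact (norm_snd_le (V (y t) - V (y 0))).trans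
        (h2.trans (mul_le_mul_of_nonneg_left (hb t ht.1) K.2))
    -- On this time interval the initial slope `c` has lost at most `K L t ≤ c / 2`; the `+ 1` in
    -- the bound only keeps the denominator positive.
    have h3 := (le_div_iff₀ hKL).1 ht.2
    have h4 := (abs_le.1 h1).1
    have h5 : 0 ≤ t := ht.1
    nlinarith
  intro t ht
  have hmono : StrictMonoOn (fun t => (y t).2) (Icc 0 (c / (2 * (K * L + 1)))) := by
    refine strictMonoOn_of_deriv_pos (convex_Icc _ _) (by fun_prop) fun s hs => ?_
    rw [(hd s).deriv]
    exact hpos s (interior_subset hs)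
  have := hmono ⟨le_rfl, by positivity⟩ ⟨ht.1.le, ht.2⟩ ht.1
  simpa [h0] using this

/-- Shooting: between the initial values near the equilibrium, whose solutions still increase after
a quarter turn, and one whose solution does not, there is a solution with a horizontal tangent at
`π / 2`. -/
theorem exists_symmetric_solution {G Q : ℝ × ℝ → ℝ} (h : IsConfining G Q) {a₀ b : ℝ}
    (ha₀ : 0 < a₀) (hab : a₀ < b) (hG : G (b, 0) = 0) (hGpos : ∀ a ∈ Ico a₀ b, 0 < G (a, 0))
    (hQ : ∀ a ∈ Icc a₀ b, 0 < Q (a, 0)) (hstab : -4 < fderiv ℝ G (b, 0) (1, 0))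
    (hneck : ∀ w p : ℝ → ℝ, IsSolution G w p → w 0 = a₀ → p 0 = 0 →
      ∃ t ∈ Ioc 0 (Real.pi / 2), p t ≤ 0) :
    ∃ w p : ℝ → ℝ, IsSolution G w p ∧ p 0 = 0 ∧ 0 < G (w 0, 0) ∧
      ∀ t, w (t + 2 * Real.pi) = w t := by
  have hpi := Real.pi_pos
  -- A common positive lower bound `c` of `Q` along the segment of initial values allows one
  -- Lipschitz extension to serve all of them.
  have hcontQ : ContinuousOn (fun a : ℝ => Q (a, 0)) (Icc a₀ b) :=
    h.cont.comp (by fun_prop) fun a ha => (ha₀.trans_le ha.1 : (0 : ℝ) < a)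
  obtain ⟨ac, hac, hmin⟩ := isCompact_Icc.exists_isMinOn (nonempty_Icc.2 hab.le) hcontQ
  set c := Q (ac, 0) with hcdef
  have hc : 0 < c := hQ ac hac
  obtain ⟨V, K, L, R, hVK, hVL, hR, hQR, hcl, hV⟩ := exists_lipschitz_extension h hc
  choose y hy0 hy using fun a : ℝ => exists_global_solution hVK hVL (a, 0)
  have hyc : ∀ a, Continuous (y a) := fun a =>
    continuous_iff_continuousAt.2 fun t => (hy a t).continuousAt
  have hsol : ∀ a ∈ Icc a₀ b, IsSolution G (fun t => (y a t).1) (fun t => (y a t).2) ∧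
      ∀ t, y a t ∈ R := fun a ha =>
    isSolution_of_extension h hR hQR hcl hV (hy a) (by rw [hy0]; exact ha₀.trans_le ha.1)
      (by rw [hy0]; exact hmin ha)
  have hV0 : ∀ a ∈ Icc a₀ b, V (a, 0) = (0, G (a, 0)) := fun a ha => by
    have := (hsol a ha).2 0
    rw [hy0] at this
    rw [hV this]
    simp [phaseField]
  have hbmem : b ∈ Icc a₀ b := ⟨hab.le, le_rfl⟩
  obtain ⟨ρ, hρ, hnear⟩ := pos_near_equilibrium h (ha₀.trans hab) hstab hG
  -- an initial value near the equilibrium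
  obtain ⟨b₁, hb₁, hb₁pos⟩ : ∃ b₁ ∈ Ioo a₀ b, ∀ t ∈ Ioc 0 (Real.pi / 2), 0 < (y b₁ t).2 := by
    -- `E` is the Gronwall factor over `[0, π / 2]`: a solution that starts within `ρ / E` of the
    -- constant solution `b` stays within `ρ` of it.
    set E := Real.exp (K * (Real.pi / 2)) with hE
    have hEpos : 0 < E := Real.exp_pos _
    obtain ⟨b₁, hlo, hhi⟩ : ∃ b₁, max a₀ (b - ρ / E) < b₁ ∧ b₁ < b :=
      exists_between (max_lt hab (by have : 0 < ρ / E := by positivity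
                                     linarith))
    have hb₁ : b₁ ∈ Ioo a₀ b := ⟨(le_max_left _ _).trans_lt hlo, hhi⟩
    refine ⟨b₁, hb₁, ?_⟩
    have hs := (hsol b₁ ⟨hb₁.1.le, hb₁.2.le⟩).1
    refine hnear _ _ hs (by simp [hy0]) (by simpa [hy0] using hGpos b₁ ⟨hb₁.1.le, hb₁.2⟩) ?_
    intro t ht
    have hconst : ∀ t : ℝ, HasDerivAt (fun _ : ℝ => ((b, 0) : ℝ × ℝ)) (V (b, 0)) t := by
      intro t
      rw [hV0 b hbmem, hG]
      exact hasDerivAt_const t _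
    refine (dist_solution_le hVK (hy b₁) hconst ht.1 ht.2).trans_lt ?_
    rw [hy0]
    have : dist ((b₁, 0) : ℝ × ℝ) (b, 0) = b - b₁ := by
      rw [Prod.dist_eq]
      simp only [dist_self]
      rw [max_eq_left dist_nonneg, Real.dist_eq, abs_sub_comm, abs_of_pos (by linarith)]
    rw [this]
    have h1 : b - b₁ < ρ / E := by linarith [(le_max_right a₀ (b - ρ / E)).trans_lt hlo]
    exact (lt_div_iff₀ hEpos).1 h1
  -- uniform positivity for small times
  obtain ⟨τ, hτ, hτ2, hτpos⟩ : ∃ τ > 0, τ < Real.pi / 2 ∧ ∀ a ∈ Icc a₀ b₁, ∀ t ∈ Ioc 0 τ,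
      0 < (y a t).2 := by
    have hcontG : ContinuousOn (fun a : ℝ => G (a, 0)) (Icc a₀ b₁) :=
      h.smooth.continuousOn.comp (by fun_prop) fun a ha =>
        ⟨(ha₀.trans_le ha.1 : (0 : ℝ) < a), by show (-1 : ℝ) < 0; norm_num⟩
    obtain ⟨am, ham, hmin'⟩ := isCompact_Icc.exists_isMinOn (nonempty_Icc.2 hb₁.1.le) hcontG
    have hm : 0 < G (am, 0) := hGpos am ⟨ham.1, ham.2.trans_lt hb₁.2⟩
    refine ⟨min (G (am, 0) / (2 * (K * L + 1))) (Real.pi / 4), by positivity,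
      (min_le_right _ _).trans_lt (by linarith), fun a ha t ht => ?_⟩
    refine uniform_pos_of_lipschitz hVK hVL hm (hy a) (by simp [hy0]) ?_ t
      ⟨ht.1, ht.2.trans (min_le_left _ _)⟩
    rw [hy0, hV0 a ⟨ha.1, ha.2.trans hb₁.2.le⟩]
    exact hmin' ha
  -- the minimum of the slope over `[τ, π / 2]` depends continuously on the initial value
  let cl : ℝ → ℝ := fun t => max 0 (min (Real.pi / 2) t)
  have hcl_eq : ∀ t ∈ Icc τ (Real.pi / 2), cl t = t := fun t ht => by
    simp only [cl]
    rw [min_eq_right ht.2, max_eq_right (hτ.le.trans ht.1)]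
  let f : ℝ → ℝ → ℝ := fun a t => (y a (cl t)).2
  have hf : Continuous ↿f := by
    refine continuous_snd.comp (?_ : Continuous ↿(fun a t => y a (cl t)))
    -- Clamping the time to `[0, π / 2]` makes the Lipschitz constant in the initial value
    -- independent of the time.
    refine continuous_prod_of_continuous_lipschitzWith _ (Real.exp (K * (Real.pi / 2))).toNNReal
      (fun a => (hyc a).comp (by fun_prop)) fun t => ?_
    refine LipschitzWith.of_dist_le_mul fun a a' => ?_
    have := dist_solution_le hVK (hy a) (hy a') (t := cl t) (T := Real.pi / 2) (le_max_left _ _)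
      (max_le (by positivity) (min_le_left _ _))
    rw [hy0, hy0] at this
    rw [Real.coe_toNNReal _ (Real.exp_pos _).le, mul_comm]
    refine this.trans (le_of_eq ?_)
    congr 1
    rw [Prod.dist_eq]
    simp
  let m : ℝ → ℝ := fun a => sInf (f a '' Icc τ (Real.pi / 2))
  have hm : Continuous m := isCompact_Icc.continuous_sInf hf
  have hfa : ∀ a, Continuous (f a) := fun a => by
    have : Continuous (fun t : ℝ => (a, t)) := by fun_prop
    exact hf.comp this
  have hmle : ∀ a, ∀ t ∈ Icc τ (Real.pi / 2), m a ≤ f a t := fun a t ht =>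
    csInf_le (isCompact_Icc.image (hfa a)).bddBelow (mem_image_of_mem _ ht)
  have hmatt : ∀ a, ∃ t ∈ Icc τ (Real.pi / 2), m a = f a t := fun a => by
    obtain ⟨t, ht, h1⟩ := (isCompact_Icc.image (hfa a)).sInf_mem
      ((nonempty_Icc.2 hτ2.le).image (f a))
    exact ⟨t, ht, h1.symm⟩
  have hma : m a₀ ≤ 0 := by
    have ha₀mem : a₀ ∈ Icc a₀ b := ⟨le_rfl, hab.le⟩
    obtain ⟨t, ht, hpt⟩ := hneck _ _ (hsol a₀ ha₀mem).1 (by simp [hy0]) (by simp [hy0])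
    have htτ : t ∈ Icc τ (Real.pi / 2) := by
      refine ⟨?_, ht.2⟩
      by_contra! h2
      exact absurd (hτpos a₀ ⟨le_rfl, hb₁.1.le⟩ t ⟨ht.1, h2.le⟩) (not_lt.2 hpt)
    refine (hmle a₀ t htτ).trans ?_
    simp only [f, hcl_eq t htτ]
    exact hpt
  have hmb : 0 < m b₁ := by
    obtain ⟨t, ht, h1⟩ := hmatt b₁
    rw [h1]
    simp only [f, hcl_eq t ht]
    exact hb₁pos t ⟨hτ.trans_le ht.1, ht.2⟩
  -- For this `a` the slope is nonnegative on `[τ, π / 2]` and vanishes at some `θ`. If `θ < π / 2`,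
  -- then `θ` is an interior minimum of `p`, so `p'(θ) = 0` and `(w θ, 0)` is an equilibrium. By
  -- uniqueness `w` would be constant, contrary to `G (a, 0) > 0`.
  obtain ⟨a, ha, hma0⟩ := intermediate_value_Icc hb₁.1.le hm.continuousOn ⟨hma, hmb.le⟩
  have ha' : a ∈ Icc a₀ b := ⟨ha.1, ha.2.trans hb₁.2.le⟩
  have hs := (hsol a ha').1
  have hGa : 0 < G (a, 0) := hGpos a ⟨ha.1, ha.2.trans_lt hb₁.2⟩
  obtain ⟨θ, hθ, hθ0⟩ := hmatt a
  have hpθ : (y a θ).2 = 0 := by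
    have := hθ0.symm.trans hma0
    simpa only [f, hcl_eq θ hθ] using this
  have hQ0 : 0 < Q ((y a 0).1, (y a 0).2) := by rw [hy0]; exact hQ a ha'
  refine ⟨_, _, hs, by simp [hy0], by simpa [hy0] using hGa,
    hs.periodic h hQ0 (by simp [hy0]) ?_⟩
  rcases hθ.2.eq_or_lt with h1 | h1
  · rw [← h1]; exact hpθ
  exfalso
  have hτθ : τ < θ := by
    refine lt_of_le_of_ne hθ.1 fun h2 => ?_
    have := hτpos a ha θ ⟨hτ.trans_le hθ.1, h2.symm.le⟩
    rw [hpθ] at this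
    exact lt_irrefl _ this
  have hloc : IsLocalMin (fun t => (y a t).2) θ := by
    filter_upwards [Ioo_mem_nhds hτθ h1] with t ht
    have := hmle a t ⟨ht.1.le, ht.2.le⟩
    rw [hma0] at this
    simp only [f, hcl_eq t ⟨ht.1.le, ht.2.le⟩] at this
    simpa only [hpθ] using this
  have hG0 : G ((y a θ).1, 0) = 0 := by
    have := hloc.hasDerivAt_eq_zero (hs θ).2.1
    simpa [hpθ] using this
  have hconst : IsSolution G (fun _ => (y a θ).1) (fun _ => 0) := by
    intro t
    refine ⟨hasDerivAt_const _ _, ?_, (hs θ).2.2⟩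
    simp only [ne_eq, OfNat.ofNat_ne_zero, not_false_eq_true, zero_pow, hG0]
    exact hasDerivAt_const _ _
  have hu := hs.unique h hconst (t₀ := θ) rfl hpθ (by rw [hs.conserved h]; exact hQ0)
  have := congrFun hu.1 0
  simp only [hy0] at this
  rw [← this] at hG0
  exact hGa.ne' hG0

/-! ### The profile equation and its equilibrium -/

/-- The principal curvature, along the rotation orbits, of the hypersurface generated by
`(w, cos θ, sin θ) / √(1 + w²)`, where `r = w' ^ 2`. -/
noncomputable def orbitCurvature (w r : ℝ) : ℝ := √(1 + w ^ 2) / (w * √(1 + w ^ 2 + r))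

/-- The principal curvature in the direction of the profile curve that makes the `m`-th mean
curvature equal to `H`. -/
noncomputable def profileCurvature (n m : ℕ) (H w r : ℝ) : ℝ :=
  -(orbitCurvature w r / m) * ((n - m) - n * H * (orbitCurvature w r)⁻¹ ^ m)

/-- The right hand side of the equation `w'' = G (w, w' ^ 2)` for the profile curve. -/
noncomputable def profileEquation (n m : ℕ) (H : ℝ) (x : ℝ × ℝ) : ℝ :=
  -x.1 - profileCurvature n m H x.1 x.2 * √(1 + x.1 ^ 2 + x.2) ^ 3 / √(1 + x.1 ^ 2) ^ 3

/-- The first integral of the profile equation. -/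
noncomputable def profileIntegral (n m : ℕ) (H : ℝ) (x : ℝ × ℝ) : ℝ :=
  (x.1 / √(1 + x.1 ^ 2)) ^ (n - m) * (√(1 + x.1 ^ 2 + x.2 ^ 2))⁻¹ ^ m -
    H * (x.1 / √(1 + x.1 ^ 2)) ^ n

theorem sqrt_pos₁ (w : ℝ) : 0 < √(1 + w ^ 2) := Real.sqrt_pos.2 (by positivity)

theorem sqrt_pos₂ (w p : ℝ) : 0 < √(1 + w ^ 2 + p ^ 2) := Real.sqrt_pos.2 (by positivity)

theorem sq_sqrt₁ (w : ℝ) : √(1 + w ^ 2) ^ 2 = 1 + w ^ 2 := Real.sq_sqrt (by positivity)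

theorem sq_sqrt₂ (w p : ℝ) : √(1 + w ^ 2 + p ^ 2) ^ 2 = 1 + w ^ 2 + p ^ 2 :=
  Real.sq_sqrt (by positivity)

theorem orbitCurvature_pos {w : ℝ} (hw : 0 < w) (p : ℝ) : 0 < orbitCurvature w (p ^ 2) := by
  have := sqrt_pos₁ w
  have := sqrt_pos₂ w p
  unfold orbitCurvature
  positivity

/-- This is `H_m = H` with the binomial factors cleared: `C(n-1, m)` and `C(n-1, m-1)` are `(n - m)
/ n` and `m / n` times `C(n, m)`. -/
theorem profileCurvature_eq {n m : ℕ} (hm : 1 ≤ m) (H : ℝ) {w : ℝ} (hw : 0 < w) (p : ℝ) :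
    (n - m) * orbitCurvature w (p ^ 2) ^ m + m * orbitCurvature w (p ^ 2) ^ (m - 1) *
      profileCurvature n m H w (p ^ 2) = n * H := by
  obtain ⟨i, rfl⟩ : ∃ i, m = i + 1 := ⟨m - 1, by omega⟩
  have h := orbitCurvature_pos hw p
  have hm0 : ((i + 1 : ℕ) : ℝ) ≠ 0 := by positivity
  unfold profileCurvature
  set l := orbitCurvature w (p ^ 2)
  rw [inv_pow, Nat.add_sub_cancel]
  field_simp
  ring

section Derivatives

variable {w p : ℝ → ℝ} {w'' μ : ℝ} {t : ℝ}

theorem hasDerivAt_sqrt₁ (hw : HasDerivAt w (p t) t) :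
    HasDerivAt (fun t => √(1 + w t ^ 2)) (w t * p t / √(1 + w t ^ 2)) t := by
  have h1 := ((hw.fun_pow 2).const_add 1).sqrt (by positivity)
  refine h1.congr_deriv ?_
  have := sqrt_pos₁ (w t)
  simp only [Nat.cast_ofNat, Nat.add_one_sub_one, pow_one]
  field_simp

theorem hasDerivAt_inv_sqrt₁ (hw : HasDerivAt w (p t) t) :
    HasDerivAt (fun t => (√(1 + w t ^ 2))⁻¹) (-(w t * p t / √(1 + w t ^ 2) ^ 3)) t := by
  have h1 := (hasDerivAt_sqrt₁ hw).fun_inv (sqrt_pos₁ (w t)).ne'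
  refine h1.congr_deriv ?_
  have := sqrt_pos₁ (w t)
  field_simp

theorem hasDerivAt_y₁ (hw : HasDerivAt w (p t) t) :
    HasDerivAt (fun t => w t / √(1 + w t ^ 2)) (p t / √(1 + w t ^ 2) ^ 3) t := by
  have h1 := hw.fun_mul (hasDerivAt_inv_sqrt₁ hw)
  simp only [← div_eq_mul_inv] at h1
  refine h1.congr_deriv ?_
  have := sqrt_pos₁ (w t)
  have h2 := sq_sqrt₁ (w t)
  field_simp
  rw [h2]
  ring

theorem hasDerivAt_y₂ (hw : HasDerivAt w (p t) t) :
    HasDerivAt (fun t => Real.cos t / √(1 + w t ^ 2))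
      (-((1 + w t ^ 2) * Real.sin t + w t * p t * Real.cos t) / √(1 + w t ^ 2) ^ 3) t := by
  have h1 := (Real.hasDerivAt_cos t).fun_mul (hasDerivAt_inv_sqrt₁ hw)
  simp only [← div_eq_mul_inv] at h1
  refine h1.congr_deriv ?_
  have := sqrt_pos₁ (w t)
  have h2 := sq_sqrt₁ (w t)
  field_simp
  rw [h2]
  ring

theorem hasDerivAt_y₃ (hw : HasDerivAt w (p t) t) :
    HasDerivAt (fun t => Real.sin t / √(1 + w t ^ 2))
      (((1 + w t ^ 2) * Real.cos t - w t * p t * Real.sin t) / √(1 + w t ^ 2) ^ 3) t := by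
  have h1 := (Real.hasDerivAt_sin t).fun_mul (hasDerivAt_inv_sqrt₁ hw)
  simp only [← div_eq_mul_inv] at h1
  refine h1.congr_deriv ?_
  have := sqrt_pos₁ (w t)
  have h2 := sq_sqrt₁ (w t)
  field_simp
  rw [h2]
  ring

/-- With the two lemmas that follow, this is the Frenet equation `ν' = μ y'` for the profile curve
`y` in the sphere with normal `ν`; `hode` is exactly the condition that the geodesic curvature be
`μ`. -/
theorem hasDerivAt_ν₁ (hw : HasDerivAt w (p t) t) (hp : HasDerivAt p w'' t)
    (hode : w'' = -w t - μ * √(1 + w t ^ 2 + p t ^ 2) ^ 3 / √(1 + w t ^ 2) ^ 3) :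
    HasDerivAt (fun t => (√(1 + w t ^ 2 + p t ^ 2))⁻¹) (μ * (p t / √(1 + w t ^ 2) ^ 3)) t := by
  have h1 := ((((hw.fun_pow 2).const_add 1).fun_add (hp.fun_pow 2)).sqrt
    (by positivity)).fun_inv (sqrt_pos₂ (w t) (p t)).ne'
  refine h1.congr_deriv ?_
  have := sqrt_pos₁ (w t)
  have := sqrt_pos₂ (w t) (p t)
  rw [hode]
  simp only [Nat.cast_ofNat, Nat.add_one_sub_one, pow_one]
  field_simp
  ring

theorem hasDerivAt_ν₂ (hw : HasDerivAt w (p t) t) (hp : HasDerivAt p w'' t)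
    (hode : w'' = -w t - μ * √(1 + w t ^ 2 + p t ^ 2) ^ 3 / √(1 + w t ^ 2) ^ 3) :
    HasDerivAt (fun t => (p t * Real.sin t - w t * Real.cos t) / √(1 + w t ^ 2 + p t ^ 2))
      (μ * (-((1 + w t ^ 2) * Real.sin t + w t * p t * Real.cos t) / √(1 + w t ^ 2) ^ 3)) t := by
  have h1 := ((hp.fun_mul (Real.hasDerivAt_sin t)).fun_sub
    (hw.fun_mul (Real.hasDerivAt_cos t))).fun_mul (hasDerivAt_ν₁ hw hp hode)
  simp only [← div_eq_mul_inv] at h1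
  refine h1.congr_deriv ?_
  have := sqrt_pos₁ (w t)
  have := sqrt_pos₂ (w t) (p t)
  have h2 := sq_sqrt₂ (w t) (p t)
  rw [hode]
  field_simp
  linear_combination (-μ * √(1 + w t ^ 2 + p t ^ 2) * Real.sin t) * h2

theorem hasDerivAt_ν₃ (hw : HasDerivAt w (p t) t) (hp : HasDerivAt p w'' t)
    (hode : w'' = -w t - μ * √(1 + w t ^ 2 + p t ^ 2) ^ 3 / √(1 + w t ^ 2) ^ 3) :
    HasDerivAt (fun t => (-(w t * Real.sin t) - p t * Real.cos t) / √(1 + w t ^ 2 + p t ^ 2))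
      (μ * (((1 + w t ^ 2) * Real.cos t - w t * p t * Real.sin t) / √(1 + w t ^ 2) ^ 3)) t := by
  have h1 := ((hw.fun_mul (Real.hasDerivAt_sin t)).fun_neg.fun_sub
    (hp.fun_mul (Real.hasDerivAt_cos t))).fun_mul (hasDerivAt_ν₁ hw hp hode)
  simp only [← div_eq_mul_inv] at h1
  refine h1.congr_deriv ?_
  have := sqrt_pos₁ (w t)
  have := sqrt_pos₂ (w t) (p t)
  have h2 := sq_sqrt₂ (w t) (p t)
  rw [hode]
  field_simp
  linear_combination (μ * √(1 + w t ^ 2 + p t ^ 2) * Real.cos t) * h2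

end Derivatives

/-- The relation `ν₁ = y₁ λ`: along an orbit the first block of the point has radius `y₁` and that
of the normal has radius `ν₁`, and the ratio is the principal curvature. -/
theorem orbitCurvature_eq {w : ℝ} (hw : 0 < w) (p : ℝ) :
    (√(1 + w ^ 2 + p ^ 2))⁻¹ = w / √(1 + w ^ 2) * orbitCurvature w (p ^ 2) := by
  have := sqrt_pos₁ w
  have := sqrt_pos₂ w p
  unfold orbitCurvature
  field_simp

/-- The second variable stands for `w'²`. Admitting values down to `-1` keeps `1 + w² + r` positive
on an open set that contains `r = 0`, so that `G` can be differentiated at points of rest. -/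
theorem contDiffOn_profileEquation (n m : ℕ) (H : ℝ) :
    ContDiffOn ℝ ∞ (profileEquation n m H) {x | 0 < x.1 ∧ -1 < x.2} := by
  have h1 : ContDiffOn ℝ ∞ (fun x : ℝ × ℝ => √(1 + x.1 ^ 2)) {x | 0 < x.1 ∧ -1 < x.2} :=
    ContDiffOn.sqrt (by fun_prop) fun x _ => by positivity
  have hD : ∀ x ∈ {x : ℝ × ℝ | 0 < x.1 ∧ -1 < x.2}, 0 < 1 + x.1 ^ 2 + x.2 := fun x hx => by
    have := hx.2
    nlinarith [sq_nonneg x.1]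
  have h2 : ContDiffOn ℝ ∞ (fun x : ℝ × ℝ => √(1 + x.1 ^ 2 + x.2)) {x | 0 < x.1 ∧ -1 < x.2} :=
    ContDiffOn.sqrt (by fun_prop) fun x hx => (hD x hx).ne'
  have hl : ContDiffOn ℝ ∞ (fun x : ℝ × ℝ => orbitCurvature x.1 x.2) {x | 0 < x.1 ∧ -1 < x.2} := by
    refine h1.div (contDiff_fst.contDiffOn.mul h2) fun x hx => ?_
    exact (mul_pos hx.1 (Real.sqrt_pos.2 (hD x hx))).ne'
  have hl0 : ∀ x ∈ {x : ℝ × ℝ | 0 < x.1 ∧ -1 < x.2}, orbitCurvature x.1 x.2 ≠ 0 := fun x hx =>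
    (div_pos (sqrt_pos₁ _) (mul_pos hx.1 (Real.sqrt_pos.2 (hD x hx)))).ne'
  have hμ : ContDiffOn ℝ ∞ (fun x : ℝ × ℝ => profileCurvature n m H x.1 x.2)
      {x | 0 < x.1 ∧ -1 < x.2} :=
    (hl.div_const _).neg.mul (contDiffOn_const.sub (contDiffOn_const.mul ((hl.inv hl0).pow m)))
  exact contDiff_fst.contDiffOn.neg.sub ((hμ.mul (h2.pow 3)).div (h1.pow 3)
    fun x _ => (pow_pos (sqrt_pos₁ _) 3).ne')

/-- By `ν₁ = y₁ λ` and `ν₁' = μ y₁'`, the derivative of `y₁^(n-m) ν₁^m - H y₁^n` is `y₁' y₁^(n-1)`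
times `(n - m) λ^m + m λ^(m-1) μ - n H`, which is zero. For the bounds, `Q ≥ c` gives `c ≤ y₁^(n-m)
ν₁^m` because `H > 0`. Both factors are at most `1` and both exponents are positive, so `y₁ ≥ c` and
`ν₁ ≥ c`; these bound `w` below by `c` and `√(1 + w² + p²)` above by `1 / c`. -/
theorem isConfining_profileEquation {n m : ℕ} (hm : 1 ≤ m) (hmn : m < n) {H : ℝ} (hH : 0 < H) :
    IsConfining (profileEquation n m H) (profileIntegral n m H) where
  smooth := contDiffOn_profileEquation n m H
  cont := by
    have h1 : Continuous (fun x : ℝ × ℝ => x.1 / √(1 + x.1 ^ 2)) :=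
      continuous_fst.div (by fun_prop) fun x => (sqrt_pos₁ _).ne'
    have h2 : Continuous (fun x : ℝ × ℝ => (√(1 + x.1 ^ 2 + x.2 ^ 2))⁻¹) :=
      Continuous.inv₀ (by fun_prop) fun x => (sqrt_pos₂ _ _).ne'
    exact (((h1.pow _).mul (h2.pow _)).sub (continuous_const.mul (h1.pow _))).continuousOn
  conserved := by
    intro w p t hw hp hpos
    obtain ⟨i, rfl⟩ : ∃ i, m = i + 1 := ⟨m - 1, by omega⟩
    obtain ⟨j, rfl⟩ : ∃ j, n = i + 1 + (j + 1) := ⟨n - (i + 2), by omega⟩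
    have h1 := hasDerivAt_y₁ hw
    have h2 := hasDerivAt_ν₁ hw hp rfl
    have h3 := ((h1.fun_pow (j + 1)).fun_mul (h2.fun_pow (i + 1))).fun_sub
      ((h1.fun_pow (i + 1 + (j + 1))).const_mul H)
    have hsub : i + 1 + (j + 1) - (i + 1) = j + 1 := by omega
    unfold profileIntegral
    simp only [hsub]
    refine h3.congr_deriv ?_
    have hl := orbitCurvature_pos hpos (p t)
    have hs := sqrt_pos₁ (w t)
    simp only [orbitCurvature_eq hpos]
    unfold profileCurvature
    set l := orbitCurvature (w t) (p t ^ 2)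
    have hg : 0 < w t / √(1 + w t ^ 2) := by positivity
    set g := w t / √(1 + w t ^ 2)
    set q := p t / √(1 + w t ^ 2) ^ 3
    have e1 : j + 1 - 1 = j := rfl
    have e2 : i + 1 - 1 = i := rfl
    have e3 : i + 1 + (j + 1) - 1 = i + j + 1 := by omega
    have hi : (i : ℝ) + 1 ≠ 0 := by positivity
    rw [e1, e2, e3, inv_pow]
    push_cast
    field_simp
    ring
  bounded := by
    intro c hc
    refine ⟨c, 1 / c, 1 / c, hc, by positivity, fun w p hw hQ => ?_⟩
    have hs := sqrt_pos₁ w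
    have hD := sqrt_pos₂ w p
    set g := w / √(1 + w ^ 2) with hg
    set D := √(1 + w ^ 2 + p ^ 2) with hDdef
    have hs1 : 1 ≤ √(1 + w ^ 2) := Real.one_le_sqrt.2 (by nlinarith)
    have hD1 : 1 ≤ D := Real.one_le_sqrt.2 (by nlinarith [sq_nonneg p, sq_nonneg w])
    have hg0 : 0 < g := by positivity
    have hgw : g ≤ w := div_le_self hw.le hs1
    have hg1 : g ≤ 1 := by
      rw [hg, div_le_one hs]
      exact Real.le_sqrt_of_sq_le (by linarith)
    have hQ' : c ≤ g ^ (n - m) * D⁻¹ ^ m := by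
      have h1 : profileIntegral n m H (w, p) = g ^ (n - m) * D⁻¹ ^ m - H * g ^ n := rfl
      have h2 : 0 < H * g ^ n := by positivity
      linarith
    have hgp : g ^ (n - m) ≤ g := by
      calc g ^ (n - m) ≤ g ^ 1 := pow_le_pow_of_le_one hg0.le hg1 (by omega)
        _ = g := pow_one g
    have hDi : D⁻¹ ≤ 1 := inv_le_one_of_one_le₀ hD1
    have hDi0 : 0 < D⁻¹ := by positivity
    have hDp : D⁻¹ ^ m ≤ D⁻¹ := by
      calc D⁻¹ ^ m ≤ D⁻¹ ^ 1 := pow_le_pow_of_le_one hDi0.le hDi hm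
        _ = D⁻¹ := pow_one _
    have h1 : c ≤ g * D⁻¹ := hQ'.trans (mul_le_mul hgp hDp (by positivity) hg0.le)
    have h2 : c ≤ g := h1.trans (mul_le_of_le_one_right hg0.le hDi)
    have h3 : c ≤ D⁻¹ := h1.trans (mul_le_of_le_one_left hDi0.le hg1)
    have h4 : D ≤ 1 / c := by
      rw [one_div]
      exact (le_inv_comm₀ hc hD).1 h3
    refine ⟨h2.trans hgw, le_trans ?_ h4, le_trans ?_ h4⟩
    · exact Real.le_sqrt_of_sq_le (by nlinarith [sq_nonneg p])
    · exact Real.abs_le_sqrt (by nlinarith [sq_nonneg w])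

theorem profileEquation_zero {n m : ℕ} (hm : 1 ≤ m) (H : ℝ) {a : ℝ} (ha : 0 < a) :
    profileEquation n m H (a, 0) = ((n - m) - m * a ^ 2 - n * H * a ^ m) / (m * a) := by
  have hs := sqrt_pos₁ a
  have hm0 : (m : ℝ) ≠ 0 := by positivity
  have hl : orbitCurvature a 0 = a⁻¹ := by
    unfold orbitCurvature
    rw [add_zero]
    field_simp
  unfold profileEquation profileCurvature
  simp only [hl, add_zero, inv_inv]
  field_simp
  ring

theorem profileIntegral_zero {n m : ℕ} (hmn : m < n) (H : ℝ) {a : ℝ} :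
    profileIntegral n m H (a, 0) =
      (a / √(1 + a ^ 2)) ^ (n - m) * (√(1 + a ^ 2))⁻¹ ^ m * (1 - H * a ^ m) := by
  obtain ⟨j, rfl⟩ : ∃ j, n = m + j := ⟨n - m, by omega⟩
  have hs := sqrt_pos₁ a
  unfold profileIntegral
  simp only [Nat.add_sub_cancel_left, ne_eq, OfNat.ofNat_ne_zero, not_false_eq_true, zero_pow,
    add_zero]
  rw [pow_add, div_pow, div_pow, inv_pow]
  field_simp

/-- The constant solution of the profile equation, as the zero of `(n - m) - m w² - n H wᵐ`. -/
theorem exists_equilibrium {n m : ℕ} (hm : 1 ≤ m) (hmn : m < n) {H : ℝ} (hH : 0 < H)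
    (hsmall : n * H * √((n - m) / (m + 2)) ^ m < 2 * (n - m) / (m + 2)) :
    ∃ b : ℝ, 0 < b ∧ (n - m : ℝ) - m * b ^ 2 - n * H * b ^ m = 0 ∧
      (n - m : ℝ) / (m + 2) < b ^ 2 := by
  have hmn' : (0 : ℝ) < n - m := by
    rw [sub_pos]; exact_mod_cast hmn
  have hm0 : (0 : ℝ) < m := by positivity
  -- `b₂` is the equilibrium for `H = 0`, and `b₁` is the value beyond which an equilibrium has
  -- squared frequency less than `4`. The smallness of `H` says exactly that the equilibrium
  -- function is positive at `b₁`.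
  set b₁ := √((n - m : ℝ) / (m + 2)) with hb₁
  set b₂ := √((n - m : ℝ) / m) with hb₂
  have h1 : b₁ ^ 2 = (n - m) / (m + 2) := Real.sq_sqrt (by positivity)
  have h2 : b₂ ^ 2 = (n - m) / m := Real.sq_sqrt (by positivity)
  have hb₁0 : 0 < b₁ := Real.sqrt_pos.2 (by positivity)
  have hb₂0 : 0 < b₂ := Real.sqrt_pos.2 (by positivity)
  have hle : b₁ ≤ b₂ := Real.sqrt_le_sqrt (by gcongr; linarith)
  let E : ℝ → ℝ := fun b => (n - m) - m * b ^ 2 - n * H * b ^ m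
  have hE : Continuous E := by fun_prop
  have hE1 : 0 < E b₁ := by
    simp only [E, h1]
    have : (n - m : ℝ) - m * ((n - m) / (m + 2)) = 2 * (n - m) / (m + 2) := by
      field_simp
      ring
    rw [this]
    linarith
  have hE2 : E b₂ < 0 := by
    simp only [E, h2]
    have h3 : (m : ℝ) * ((n - m) / m) = n - m := by field_simp
    rw [h3, sub_self, zero_sub, neg_lt_zero]
    have : 0 < n := by omega
    positivity
  obtain ⟨b, hb, hb0⟩ := intermediate_value_Icc' hle hE.continuousOn ⟨hE2.le, hE1.le⟩
  refine ⟨b, hb₁0.trans_le hb.1, hb0, ?_⟩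
  rw [← h1]
  have hne : b₁ ≠ b := fun h => by rw [h, hb0] at hE1; exact lt_irrefl _ hE1
  exact pow_lt_pow_left₀ (lt_of_le_of_ne hb.1 hne) hb₁0.le two_ne_zero

/-- The numerator `(n - m) - m a² - n H a^m` is decreasing in `a > 0` and vanishes at `b`. -/
theorem profileEquation_zero_pos {n m : ℕ} (hm : 1 ≤ m) {H : ℝ} (hH : 0 < H) {a b : ℝ}
    (ha : 0 < a) (hab : a < b) (hb : (n - m : ℝ) - m * b ^ 2 - n * H * b ^ m = 0) :
    0 < profileEquation n m H (a, 0) := by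
  rw [profileEquation_zero hm H ha]
  have hm0 : (0 : ℝ) < m := by positivity
  refine div_pos ?_ (by positivity)
  have h1 : a ^ 2 < b ^ 2 := pow_lt_pow_left₀ hab ha.le two_ne_zero
  have h2 : n * H * a ^ m ≤ n * H * b ^ m := by gcongr
  nlinarith

/-- The derivative is `-(2 + n H b^(m-2))`. By the equilibrium relation, `n H b^(m-2) = (n - m) / b²
- m`, which is less than `2` exactly when `b² > (n - m) / (m + 2)`. -/
theorem fderiv_profileEquation {n m : ℕ} (hm : 1 ≤ m) (H : ℝ) {b : ℝ} (hb0 : 0 < b)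
    (hb : (n - m : ℝ) - m * b ^ 2 - n * H * b ^ m = 0) (hlow : (n - m : ℝ) / (m + 2) < b ^ 2) :
    -4 < fderiv ℝ (profileEquation n m H) (b, 0) (1, 0) := by
  have hm0 : (0 : ℝ) < m := by positivity
  have hU : IsOpen {x : ℝ × ℝ | 0 < x.1 ∧ -1 < x.2} :=
    (isOpen_lt continuous_const continuous_fst).inter (isOpen_lt continuous_const continuous_snd)
  have hmem : ((b, 0) : ℝ × ℝ) ∈ {x : ℝ × ℝ | 0 < x.1 ∧ -1 < x.2} := ⟨hb0, by norm_num⟩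
  have hd := (((contDiffOn_profileEquation n m H).contDiffAt (hU.mem_nhds hmem)).differentiableAt
    (by simp)).hasFDerivAt
  have h1 : HasDerivAt (fun a : ℝ => (a, (0 : ℝ))) (1, 0) b :=
    (hasDerivAt_id b).prodMk (hasDerivAt_const b 0)
  have h2 := hd.comp_hasDerivAt b h1
  have h3 : HasDerivAt (fun a : ℝ => ((n - m) - m * a ^ 2 - n * H * a ^ m) / (m * a))
      (-2 - n * H * b ^ m / b ^ 2) b := by
    have h4 := ((((hasDerivAt_pow 2 b).const_mul (m : ℝ)).const_sub (n - m : ℝ)).fun_sub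
      ((hasDerivAt_pow m b).const_mul (n * H))).fun_div ((hasDerivAt_id b).const_mul (m : ℝ))
      (by positivity)
    refine h4.congr_deriv ?_
    obtain ⟨i, rfl⟩ : ∃ i, m = i + 1 := ⟨m - 1, by omega⟩
    simp only [id, hb, Nat.add_sub_cancel]
    push_cast at hm0 ⊢
    field_simp
    ring
  have h5 : HasDerivAt (profileEquation n m H ∘ fun a : ℝ => (a, (0 : ℝ)))
      (-2 - n * H * b ^ m / b ^ 2) b := by
    refine h3.congr_of_eventuallyEq ?_
    filter_upwards [lt_mem_nhds hb0] with a ha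
    exact profileEquation_zero hm H ha
  rw [h2.unique h5]
  have h6 : n * H * b ^ m = (n - m) - m * b ^ 2 := by linarith
  have h7 : (n - m : ℝ) < b ^ 2 * (m + 2) := (div_lt_iff₀ (by positivity)).1 hlow
  have h8 : n * H * b ^ m / b ^ 2 < 2 := by
    rw [h6, div_lt_iff₀ (by positivity)]
    linarith
  linarith

/-! ### Thin necks -/

/-- In a neck, `(w ^ 2)'' / 2 = w' ^ 2 + w w''` is bounded below. -/
theorem neck_convexity {n m : ℕ} (hm : 1 ≤ m) (hmn : m < n) {H : ℝ} (hH : 0 < H)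
    (hsmall : (2 * n * H / (n - m)) ^ 2 * ((n + m) / (2 * m)) ^ m ≤ 1) {w p : ℝ} (hw : 0 < w)
    (hwb : w ^ 2 ≤ (n - m) / (8 * m)) (hle : H * (orbitCurvature w (p ^ 2))⁻¹ ^ m ≤ 1) :
    (n - m) / (4 * m) ≤ p ^ 2 + w * profileEquation n m H (w, p ^ 2) := by
  have hmn' : (0 : ℝ) < n - m := by
    rw [sub_pos]; exact_mod_cast hmn
  have hm0 : (0 : ℝ) < m := by positivity
  have hl := orbitCurvature_pos hw p
  have hs := sqrt_pos₁ w
  have hD := sqrt_pos₂ w p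
  have hs2 := sq_sqrt₁ w
  have hD2 := sq_sqrt₂ w p
  set τ := (orbitCurvature w (p ^ 2))⁻¹ with hτ
  have hτ0 : 0 < τ := by positivity
  have hτeq : τ = w * √(1 + w ^ 2 + p ^ 2) / √(1 + w ^ 2) := by
    rw [hτ]; unfold orbitCurvature; rw [inv_div]
  have hτ2 : τ ^ 2 * (1 + w ^ 2) = w ^ 2 * (1 + w ^ 2 + p ^ 2) := by
    rw [hτeq, div_pow, mul_pow, hs2, hD2]
    field_simp
  -- Here `p` is eliminated in favour of `τ = 1 / λ`.
  have hkey : p ^ 2 + w * profileEquation n m H (w, p ^ 2) =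
      τ ^ 2 - 1 - 2 * w ^ 2 + τ ^ 2 / w ^ 2 * (n / m) * (1 - H * τ ^ m) := by
    have hG : profileEquation n m H (w, p ^ 2) = -w + (√(1 + w ^ 2 + p ^ 2) ^ 2 /
        (m * w * √(1 + w ^ 2) ^ 2)) * ((n - m) - n * H * τ ^ m) := by
      unfold profileEquation profileCurvature
      simp only []
      rw [← hτ]
      unfold orbitCurvature
      field_simp
      ring
    have hp2 : p ^ 2 = τ ^ 2 * (1 + w ^ 2) / w ^ 2 - 1 - w ^ 2 := by
      rw [hτ2]; field_simp; ring
    have hfrac : √(1 + w ^ 2 + p ^ 2) ^ 2 / (m * w * √(1 + w ^ 2) ^ 2) = τ ^ 2 / (m * w ^ 3) := by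
      rw [hD2, hs2]
      rw [div_eq_div_iff (by positivity) (by positivity)]
      have : τ ^ 2 * (m * w * (1 + w ^ 2)) = m * w * (τ ^ 2 * (1 + w ^ 2)) := by ring
      rw [this, hτ2]
      ring
    rw [hG, hfrac, hp2]
    field_simp
    ring
  rw [hkey]
  have hratio : 1 ≤ τ ^ 2 / w ^ 2 := by
    rw [le_div_iff₀ (by positivity), one_mul]
    have : τ ^ 2 * (1 + w ^ 2) ≥ w ^ 2 * (1 + w ^ 2) := by
      rw [hτ2]
      nlinarith [mul_nonneg (sq_nonneg w) (sq_nonneg p)]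
    exact le_of_mul_le_mul_right this (by positivity)
  have hw8 : 2 * w ^ 2 ≤ (n - m) / (4 * m) := by
    calc 2 * w ^ 2 ≤ 2 * ((n - m) / (8 * m)) := by linarith
      _ = (n - m) / (4 * m) := by field_simp; norm_num
  have hnm : (n + m : ℝ) / (2 * m) = 1 + 2 * ((n - m) / (4 * m)) := by field_simp; ring
  have hn0 : (0 : ℝ) < n := by linarith
  -- The terms to beat are `-1 - 2w²`, and `(n + m) / (2m) = 1 + 2δ` with `δ = (n - m) / (4m)` and
  -- `2w² ≤ δ`. If `H τ^m` is small, the last term is at least `(n + m) / (2m)`, as `τ² ≥ w²`; if it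
  -- is not, the smallness of `H` forces `τ²` itself to be that large.
  rcases le_or_gt (H * τ ^ m) ((n - m) / (2 * n)) with h | h
  · have h1 : (n + m : ℝ) / (2 * m) ≤ τ ^ 2 / w ^ 2 * (n / m) * (1 - H * τ ^ m) := by
      calc (n + m : ℝ) / (2 * m) = 1 * (n / m) * (1 - (n - m) / (2 * n)) := by field_simp; ring
        _ ≤ τ ^ 2 / w ^ 2 * (n / m) * (1 - H * τ ^ m) := by
          apply mul_le_mul (by gcongr) (by linarith) _ (by positivity)
          rw [sub_nonneg, div_le_one (by positivity)]
          linarith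
    nlinarith [sq_nonneg τ]
  · have h1 : (n + m : ℝ) / (2 * m) ≤ τ ^ 2 := by
      by_contra! hcon
      have h2 : (τ ^ 2) ^ m < ((n + m : ℝ) / (2 * m)) ^ m :=
        pow_lt_pow_left₀ hcon (by positivity) (by omega)
      have h3 : (1 : ℝ) < 2 * n * H / (n - m) * τ ^ m := by
        rw [div_lt_iff₀ (by positivity)] at h
        rw [div_mul_eq_mul_div, lt_div_iff₀ hmn']
        linarith
      have h4 : (1 : ℝ) < (2 * n * H / (n - m)) ^ 2 * (τ ^ 2) ^ m := by
        calc (1 : ℝ) < (2 * n * H / (n - m) * τ ^ m) ^ 2 := one_lt_pow₀ h3 two_ne_zero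
          _ = (2 * n * H / (n - m)) ^ 2 * (τ ^ 2) ^ m := by rw [mul_pow, ← pow_mul, ← pow_mul,
              mul_comm m 2]
      have h5 : 0 < (2 * n * H / (n - m)) ^ 2 := by positivity
      have := mul_lt_mul_of_pos_left h2 h5
      linarith
    have h2 : 0 ≤ τ ^ 2 / w ^ 2 * (n / m) * (1 - H * τ ^ m) := by
      have : 0 ≤ 1 - H * τ ^ m := by linarith
      positivity
    linarith

/-- The first integral in the form `Q = y₁^n (λ^m - H)`: for small `C`, `λ` is close to `H^(1/m)`
wherever `y₁` is not small. -/
theorem orbitCurvature_pow_eq {n m : ℕ} (hmn : m < n) {H C : ℝ} {w p : ℝ} (hw : 0 < w)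
    (hQ : profileIntegral n m H (w, p) = C) :
    orbitCurvature w (p ^ 2) ^ m = H + C / (w / √(1 + w ^ 2)) ^ n := by
  obtain ⟨j, rfl⟩ : ∃ j, n = m + j := ⟨n - m, by omega⟩
  have hs := sqrt_pos₁ w
  unfold profileIntegral at hQ
  simp only [orbitCurvature_eq hw, Nat.add_sub_cancel_left] at hQ
  have hg : 0 < w / √(1 + w ^ 2) := by positivity
  set g := w / √(1 + w ^ 2)
  rw [← hQ, mul_pow, pow_add]
  field_simp
  ring

/-- A lower bound for the curvature of the profile curve away from the neck. -/
theorem half_le_profileCurvature {n m : ℕ} (hm : 1 ≤ m) (hmn : m < n) {l₀ e : ℝ} (hl₀ : 0 < l₀)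
    {w p : ℝ} (hw : 0 < w) (he0 : 0 ≤ e) (he : n * e ≤ m / 2 * l₀ ^ m)
    (hl : orbitCurvature w (p ^ 2) ^ m = l₀ ^ m + e) :
    l₀ / 2 ≤ profileCurvature n m (l₀ ^ m) w (p ^ 2) := by
  have hμ := profileCurvature_eq (n := n) hm (l₀ ^ m) hw p
  have hl0 := orbitCurvature_pos hw p
  set l := orbitCurvature w (p ^ 2)
  set μ := profileCurvature n m (l₀ ^ m) w (p ^ 2)
  obtain ⟨i, rfl⟩ : ∃ i, m = i + 1 := ⟨m - 1, by omega⟩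
  rw [Nat.add_sub_cancel, hl] at hμ
  have hll : l₀ ≤ l := by
    by_contra! h
    have := pow_lt_pow_left₀ h hl0.le (Nat.succ_ne_zero i)
    simp only [Nat.succ_eq_add_one] at this
    linarith
  have hli : l₀ ^ i ≤ l ^ i := pow_le_pow_left₀ hl₀.le hll i
  have hi : (0 : ℝ) < (i + 1 : ℕ) := by positivity
  have h1 : l ^ i * l₀ ≤ l₀ ^ (i + 1) + e := by
    rw [← hl, pow_succ]
    gcongr
  -- The curvature relation and `λ^(m-1) l₀ ≤ λ^m = l₀^m + e` give `m λ^(m-1) (l₀ - μ) ≤ n e`. If `μ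
  -- < l₀ / 2`, the left side exceeds `(m / 2) l₀^m`, since `λ ≥ l₀`.
  by_contra! hcon
  have h2 : l₀ ^ i * (l₀ / 2) < l ^ i * (l₀ - μ) := by
    have : 0 < l₀ - μ := by linarith
    have h3 : 0 < l₀ ^ i := by positivity
    nlinarith
  have h4 : (i + 1 : ℕ) * (l ^ i * (l₀ - μ)) ≤ n * e := by
    have : ((i + 1 : ℕ) : ℝ) * (l ^ i * l₀) ≤ (i + 1 : ℕ) * (l₀ ^ (i + 1) + e) := by gcongr
    nlinarith
  have h5 : ((i + 1 : ℕ) : ℝ) / 2 * l₀ ^ (i + 1) = (i + 1 : ℕ) * (l₀ ^ i * (l₀ / 2)) := by ring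
  have h6 := mul_lt_mul_of_pos_left h2 hi
  linarith

theorem div_sqrt_le_div_sqrt {x y : ℝ} (hx : 0 ≤ x) (hxy : x ≤ y) :
    x / √(1 + x ^ 2) ≤ y / √(1 + y ^ 2) := by
  have h1 := sqrt_pos₁ x
  have h2 := sqrt_pos₁ y
  have hy := hx.trans hxy
  rw [div_le_div_iff₀ h1 h2]
  refine le_of_sq_le_sq ?_ (by positivity)
  rw [mul_pow, mul_pow, sq_sqrt₁, sq_sqrt₁]
  have := pow_le_pow_left₀ hx hxy 2
  linarith

theorem sub_div_sqrt_le {w p s c : ℝ} (hw : 0 ≤ w) (hs : 0 ≤ s) (hc : 0 ≤ c) :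
    (p * s - w * c) / √(1 + w ^ 2 + p ^ 2) ≤ s := by
  rw [div_le_iff₀ (sqrt_pos₂ w p)]
  have h4 : p ≤ √(1 + w ^ 2 + p ^ 2) := Real.le_sqrt_of_sq_le (by linarith [sq_nonneg w])
  have h5 : 0 ≤ w * c := by positivity
  have h6 := mul_le_mul_of_nonneg_right h4 hs
  linarith

set_option maxHeartbeats 1000000 in
/-- A solution that starts from a thin enough neck does not increase for a whole quarter turn. -/
theorem exists_thin_neck {n m : ℕ} (hm : 1 ≤ m) (hmn : m < n) {H : ℝ} (hH : 0 < H)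
    (hsmall : (2 * n * H / (n - m)) ^ 2 * ((n + m) / (2 * m)) ^ m ≤ 1) {b : ℝ} (hb : 0 < b) :
    ∃ a, 0 < a ∧ a < b ∧ ∀ w p : ℝ → ℝ, IsSolution (profileEquation n m H) w p → w 0 = a → p 0 = 0 →
      ∃ t ∈ Ioc 0 (Real.pi / 2), p t ≤ 0 := by
  have hpi := Real.pi_pos
  have hmn' : (0 : ℝ) < n - m := by
    rw [sub_pos]; exact_mod_cast hmn
  have hm0 : (0 : ℝ) < m := by positivity
  have hn0 : (0 : ℝ) < n := by linarith
  obtain ⟨l₀, hl₀, rfl⟩ : ∃ l₀ : ℝ, 0 < l₀ ∧ l₀ ^ m = H :=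
    ⟨H ^ ((m : ℝ)⁻¹), by positivity, Real.rpow_inv_natCast_pow hH.le (by omega)⟩
  set δ : ℝ := (n - m) / (4 * m) with hδ
  have hδ0 : 0 < δ := by positivity
  have hconf := isConfining_profileEquation hm hmn hH
  -- the angle `T` within which the neck is left
  obtain ⟨T, hT0, hTpi, hT2, hTsin⟩ : ∃ T : ℝ, 0 < T ∧ T < Real.pi / 2 ∧ T ^ 2 ≤ 1 / 2 ∧
      Real.sin T < l₀ / 2 * (Real.cos T / √(1 + (l₀⁻¹) ^ 2)) := by
    have h1 : ∀ᶠ T : ℝ in 𝓝 0, Real.sin T < l₀ / 2 * (Real.cos T / √(1 + (l₀⁻¹) ^ 2)) := by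
      refine (Real.continuous_sin.continuousAt).eventually_lt (by fun_prop) ?_
      have := sqrt_pos₁ l₀⁻¹
      simp only [Real.sin_zero, Real.cos_zero]
      positivity
    have h2 : ∀ᶠ T : ℝ in 𝓝 0, T ^ 2 < 1 / 2 :=
      ContinuousAt.eventually_lt (by fun_prop) (by fun_prop) (by norm_num)
    have h3 : ∀ᶠ T : ℝ in 𝓝 0, T < Real.pi / 2 := gt_mem_nhds (by positivity)
    obtain ⟨T, ⟨⟨h4, h5⟩, h6⟩, h7⟩ := (((h1.and h2).and h3).filter_mono
      (nhdsWithin_le_nhds (s := Ioi 0))).and self_mem_nhdsWithin |>.exists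
    exact ⟨T, h7, h6, h5.le, h4⟩
  set η := √δ * T with hη
  have hη0 : 0 < η := by positivity
  have hη2 : η ^ 2 = δ * T ^ 2 := by rw [hη, mul_pow, Real.sq_sqrt hδ0.le]
  set gη := η / √(1 + η ^ 2) with hgη
  have hsη := sqrt_pos₁ η
  have hgη0 : 0 < gη := by positivity
  -- Besides `a < 1` and `a < b`, the bound `1 / l₀^m` makes the first integral `C` positive. The
  -- last bound, with `C ≤ a`, makes the error `C / y₁^n` small enough for
  -- `half_le_profileCurvature` once `w ≥ η`.
  obtain ⟨a, ha0, ha⟩ : ∃ a : ℝ, 0 < a ∧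
      a < min (min 1 b) (min (1 / l₀ ^ m) (m / (2 * n) * l₀ ^ m * gη ^ n)) :=
    exists_between (by positivity)
  simp only [lt_min_iff] at ha
  obtain ⟨⟨ha1, hab⟩, haH, hae⟩ := ha
  refine ⟨a, ha0, hab, fun w p hs hw0 hp0 => ?_⟩
  by_contra! hpos
  have hwpos : ∀ t, 0 < w t := fun t => (hs t).2.2
  -- the value of the first integral
  set C := profileIntegral n m (l₀ ^ m) (a, 0) with hC
  have hCcons : ∀ t, profileIntegral n m (l₀ ^ m) (w t, p t) = C := fun t => by
    rw [hs.conserved hconf t, hw0, hp0]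
  have hsa := sqrt_pos₁ a
  have hC0 : 0 < C := by
    rw [hC, profileIntegral_zero hmn]
    have : a ^ m ≤ a := by
      calc a ^ m ≤ a ^ 1 := pow_le_pow_of_le_one ha0.le ha1.le hm
        _ = a := pow_one a
    have h1 : l₀ ^ m * a ^ m < 1 := by
      calc l₀ ^ m * a ^ m ≤ l₀ ^ m * a := by gcongr
        _ < 1 := by rw [mul_comm]; exact (lt_div_iff₀ hH).1 haH
    have h2 : 0 < 1 - l₀ ^ m * a ^ m := by linarith
    positivity
  have hCa : C ≤ a := by
    have hs1 : 1 ≤ √(1 + a ^ 2) := Real.one_le_sqrt.2 (by nlinarith)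
    have h1 : a / √(1 + a ^ 2) ≤ a := div_le_self ha0.le hs1
    have h2 : (a / √(1 + a ^ 2)) ^ (n - m) ≤ a := by
      calc (a / √(1 + a ^ 2)) ^ (n - m) ≤ a ^ (n - m) := by gcongr
        _ ≤ a ^ 1 := pow_le_pow_of_le_one ha0.le ha1.le (by omega)
        _ = a := pow_one a
    have h3 : (√(1 + a ^ 2))⁻¹ ^ m ≤ 1 := pow_le_one₀ (by positivity) (inv_le_one_of_one_le₀ hs1)
    have h4 : 1 - l₀ ^ m * a ^ m ≤ 1 := by
      have : 0 < l₀ ^ m * a ^ m := by positivity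
      linarith
    rw [hC, profileIntegral_zero hmn]
    calc _ ≤ (a / √(1 + a ^ 2)) ^ (n - m) * (√(1 + a ^ 2))⁻¹ ^ m * 1 := by gcongr
      _ ≤ (a / √(1 + a ^ 2)) ^ (n - m) * 1 * 1 := by gcongr
      _ ≤ a := by simpa using h2
  have hlam : ∀ t, orbitCurvature (w t) (p t ^ 2) ^ m =
      l₀ ^ m + C / (w t / √(1 + w t ^ 2)) ^ n := fun t =>
    orbitCurvature_pow_eq hmn (hwpos t) (hCcons t)
  have hlam0 : ∀ t, l₀ < orbitCurvature (w t) (p t ^ 2) := by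
    intro t
    have hl := orbitCurvature_pos (hwpos t) (p t)
    have h1 := sqrt_pos₁ (w t)
    have h2 := hwpos t
    have : 0 < C / (w t / √(1 + w t ^ 2)) ^ n := by positivity
    exact lt_of_pow_lt_pow_left₀ m hl.le (by rw [hlam t]; linarith)
  -- Since `l₀ < λ ≤ 1 / w`.
  have hwb : ∀ t, w t < l₀⁻¹ := by
    intro t
    have h0 := hlam0 t
    have h1 := sqrt_pos₁ (w t)
    have h2 := sqrt_pos₂ (w t) (p t)
    have h3 : √(1 + w t ^ 2) ≤ √(1 + w t ^ 2 + p t ^ 2) :=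
      Real.sqrt_le_sqrt (by linarith [sq_nonneg (p t)])
    have h4 : orbitCurvature (w t) (p t ^ 2) ≤ (w t)⁻¹ := by
      unfold orbitCurvature
      rw [div_le_iff₀ (mul_pos (hwpos t) h2), ← mul_assoc, inv_mul_cancel₀ (hwpos t).ne', one_mul]
      exact h3
    rw [lt_inv_comm₀ (hwpos t) hl₀]
    exact h0.trans_le h4
  have hwc : Continuous w := continuous_iff_continuousAt.2 fun t => (hs t).1.continuousAt
  have hpc : Continuous p := continuous_iff_continuousAt.2 fun t => (hs t).2.1.continuousAt
  have hwm : StrictMonoOn w (Icc 0 (Real.pi / 2)) := by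
    refine strictMonoOn_of_deriv_pos (convex_Icc _ _) hwc.continuousOn fun t ht => ?_
    rw [interior_Icc] at ht
    rw [(hs t).1.deriv]
    exact hpos t ⟨ht.1, ht.2.le⟩
  -- the neck is left before the angle `T`
  have hwT : η ≤ w T := by
    by_contra! hlt
    have hδ8 : η ^ 2 ≤ (n - m) / (8 * m) := by
      rw [hη2]
      calc δ * T ^ 2 ≤ δ * (1 / 2) := by gcongr
        _ = (n - m) / (8 * m) := by rw [hδ]; field_simp; norm_num
    have hsmallw : ∀ t ∈ Icc 0 T, w t ^ 2 ≤ (n - m) / (8 * m) := fun t ht => by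
      have : w t ≤ w T := hwm.monotoneOn ⟨ht.1, ht.2.trans hTpi.le⟩ ⟨hT0.le, hTpi.le⟩ ht.2
      have h2 := hwpos t
      exact (pow_le_pow_left₀ h2.le (this.trans hlt.le) 2).trans hδ8
    -- As long as `w < η`, neck convexity gives `(w w')' ≥ δ`. Integrating twice yields `w(T)² ≥ a²
    -- + δ T² = a² + η²`, a contradiction.
    have h1 : MonotoneOn (fun t => w t * p t - δ * t) (Icc 0 T) := by
      have hd : ∀ t, HasDerivAt (fun t => w t * p t - δ * t)
          (p t ^ 2 + w t * profileEquation n m (l₀ ^ m) (w t, p t ^ 2) - δ) t := fun t => by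
        refine (((hs t).1.fun_mul (hs t).2.1).fun_sub ((hasDerivAt_id t).const_mul δ)).congr_deriv ?_
        ring
      refine monotoneOn_of_deriv_nonneg (convex_Icc _ _) (by fun_prop)
        (fun t _ => (hd t).differentiableAt.differentiableWithinAt) fun t ht => ?_
      rw [(hd t).deriv, sub_nonneg]
      refine neck_convexity hm hmn hH hsmall (hwpos t) (hsmallw t (interior_subset ht)) ?_
      rw [inv_pow, ← div_eq_mul_inv, div_le_one (pow_pos (orbitCurvature_pos (hwpos t) _) m)]
      exact pow_le_pow_left₀ hl₀.le (hlam0 t).le m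
    have h2 : MonotoneOn (fun t => w t ^ 2 - δ * t ^ 2) (Icc 0 T) := by
      have hd : ∀ t, HasDerivAt (fun t => w t ^ 2 - δ * t ^ 2) (2 * (w t * p t - δ * t)) t :=
        fun t => by
          refine (((hs t).1.fun_pow 2).fun_sub ((hasDerivAt_pow 2 t).const_mul δ)).congr_deriv ?_
          simp
          ring
      refine monotoneOn_of_deriv_nonneg (convex_Icc _ _) (by fun_prop)
        (fun t _ => (hd t).differentiableAt.differentiableWithinAt) fun t ht => ?_
      rw [(hd t).deriv]
      have ht' := interior_subset ht
      have := h1 ⟨le_rfl, hT0.le⟩ ht' ht'.1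
      simp only [hp0, mul_zero, sub_zero] at this
      linarith
    have h3 := h2 ⟨le_rfl, hT0.le⟩ ⟨hT0.le, le_rfl⟩ hT0.le
    simp only [hw0, ne_eq, OfNat.ofNat_ne_zero, not_false_eq_true, zero_pow, mul_zero,
      sub_zero] at h3
    have h4 : w T ^ 2 < η ^ 2 := pow_lt_pow_left₀ hlt (hwpos T).le two_ne_zero
    have h5 : 0 < a ^ 2 := by positivity
    linarith
  -- afterwards the curve bends down
  have hμ : ∀ t ∈ Icc T (Real.pi / 2), l₀ / 2 ≤ profileCurvature n m (l₀ ^ m) (w t) (p t ^ 2) := by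
    intro t ht
    have hwt : η ≤ w t := hwT.trans (hwm.monotoneOn ⟨hT0.le, hTpi.le⟩
      ⟨hT0.le.trans ht.1, ht.2⟩ ht.1)
    have hs1 := sqrt_pos₁ (w t)
    have hw := hwpos t
    have hg : gη ≤ w t / √(1 + w t ^ 2) :=
      div_sqrt_le_div_sqrt hη0.le hwt
    refine half_le_profileCurvature hm hmn hl₀ hw (by positivity) ?_ (hlam t)
    have h1 : C / (w t / √(1 + w t ^ 2)) ^ n ≤ a / gη ^ n := by gcongr
    have h2 : a / gη ^ n ≤ m / (2 * n) * l₀ ^ m := (div_le_iff₀ (by positivity)).2 hae.le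
    calc (n : ℝ) * (C / (w t / √(1 + w t ^ 2)) ^ n) ≤ n * (m / (2 * n) * l₀ ^ m) := by
          gcongr; exact h1.trans h2
      _ = m / 2 * l₀ ^ m := by field_simp
  -- `Φ = ν₂ - (l₀ / 2) y₂`, with derivative `(μ - l₀ / 2) y₂' ≤ 0` on `[T, π / 2]`. If `w`
  -- increased up to `π / 2`, then `Φ(π / 2) = ν₂ > 0`. But `Φ(T) < 0`: there `ν₂ ≤ sin T`, while
  -- `y₂` is at least `cos T / √(1 + l₀⁻²)`, and `T` was chosen to make the first term the smaller
  -- one.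
  let Φ : ℝ → ℝ := fun t => (p t * Real.sin t - w t * Real.cos t) / √(1 + w t ^ 2 + p t ^ 2) -
    l₀ / 2 * (Real.cos t / √(1 + w t ^ 2))
  have hΦd : ∀ t, HasDerivAt Φ ((profileCurvature n m (l₀ ^ m) (w t) (p t ^ 2) - l₀ / 2) *
      (-((1 + w t ^ 2) * Real.sin t + w t * p t * Real.cos t) / √(1 + w t ^ 2) ^ 3)) t := fun t => by
    refine ((hasDerivAt_ν₂ (hs t).1 (hs t).2.1 rfl).fun_sub
      ((hasDerivAt_y₂ (hs t).1).const_mul (l₀ / 2))).congr_deriv ?_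
    ring
  have hΦc : Continuous Φ := continuous_iff_continuousAt.2 fun t => (hΦd t).continuousAt
  have hΦ : AntitoneOn Φ (Icc T (Real.pi / 2)) := by
    refine antitoneOn_of_deriv_nonpos (convex_Icc _ _) hΦc.continuousOn
      (fun t _ => (hΦd t).differentiableAt.differentiableWithinAt) fun t ht => ?_
    have ht' := interior_subset ht
    rw [(hΦd t).deriv]
    have h1 := hμ t ht'
    have ht0 : 0 < t := hT0.trans_le ht'.1
    have h2 : 0 ≤ Real.sin t := Real.sin_nonneg_of_nonneg_of_le_pi ht0.le (by linarith [ht'.2])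
    have h3 : 0 ≤ Real.cos t := Real.cos_nonneg_of_mem_Icc ⟨by linarith, ht'.2⟩
    have h4 := hpos t ⟨ht0, ht'.2⟩
    have h5 := hwpos t
    have h6 := sqrt_pos₁ (w t)
    rw [neg_div, mul_neg, neg_nonpos]
    have h7 : 0 ≤ profileCurvature n m (l₀ ^ m) (w t) (p t ^ 2) - l₀ / 2 := by linarith
    positivity
  have hend := hΦ ⟨le_rfl, hTpi.le⟩ ⟨hTpi.le, le_rfl⟩ hTpi.le
  have hend1 : 0 < Φ (Real.pi / 2) := by
    simp only [Φ, Real.sin_pi_div_two, Real.cos_pi_div_two]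
    have h1 := hpos (Real.pi / 2) ⟨by positivity, le_rfl⟩
    have h2 := sqrt_pos₂ (w (Real.pi / 2)) (p (Real.pi / 2))
    simp only [mul_one, mul_zero, sub_zero, zero_div]
    positivity
  have hend2 : Φ T < 0 := by
    have h1 := hpos T ⟨hT0, hTpi.le⟩
    have h2 := hwpos T
    have hD := sqrt_pos₂ (w T) (p T)
    have hsT := sqrt_pos₁ (w T)
    have hsin : 0 < Real.sin T := Real.sin_pos_of_pos_of_lt_pi hT0 (by linarith)
    have hcos : 0 < Real.cos T := Real.cos_pos_of_mem_Ioo ⟨by linarith, hTpi⟩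
    have h3 : (p T * Real.sin T - w T * Real.cos T) / √(1 + w T ^ 2 + p T ^ 2) ≤ Real.sin T :=
      sub_div_sqrt_le h2.le hsin.le hcos.le
    have h4 : Real.cos T / √(1 + (l₀⁻¹) ^ 2) ≤ Real.cos T / √(1 + w T ^ 2) := by
      have := hwb T
      gcongr
    have h5 := mul_le_mul_of_nonneg_left h4 (by positivity : 0 ≤ l₀ / 2)
    exact sub_neg.2 ((h3.trans_lt hTsin).trans_le h5)
  exact absurd (hend1.trans_le hend) hend2.le.not_gt

/-! ### Periodic profiles for small `H` -/

/-- For small `H > 0` the profile equation has a periodic nonconstant solution. -/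
theorem exists_periodic_profile {n m : ℕ} (hm : 1 ≤ m) (hmn : m < n) :
    ∃ ε : ℝ, 0 < ε ∧ ∀ H : ℝ, 0 < H → H < ε → ∃ w p : ℝ → ℝ, ContDiff ℝ ∞ w ∧ ContDiff ℝ ∞ p ∧
      IsSolution (profileEquation n m H) w p ∧ p 0 = 0 ∧ 0 < profileEquation n m H (w 0, 0) ∧
      ∀ t, w (t + 2 * Real.pi) = w t := by
  have hmn' : (0 : ℝ) < n - m := by
    rw [sub_pos]; exact_mod_cast hmn
  have hm0 : (0 : ℝ) < m := by positivity
  -- The two smallness conditions, for the equilibrium and for thin necks, hold strictly at `H = 0`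
  -- and involve only `n`, `m` and `H`; this is the source of `ε`.
  have h1 : ∀ᶠ H : ℝ in 𝓝 0, n * H * √((n - m) / (m + 2)) ^ m < 2 * (n - m) / (m + 2) := by
    refine ContinuousAt.eventually_lt (by fun_prop) (by fun_prop) ?_
    simp only [mul_zero, zero_mul]
    positivity
  have h2 : ∀ᶠ H : ℝ in 𝓝 0, (2 * n * H / (n - m)) ^ 2 * ((n + m) / (2 * m)) ^ m < 1 := by
    refine ContinuousAt.eventually_lt (by fun_prop) (by fun_prop) ?_
    simp
  obtain ⟨ε, hε, hball⟩ := Metric.eventually_nhds_iff.1 (h1.and h2)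
  refine ⟨ε, hε, fun H hH hHε => ?_⟩
  obtain ⟨h3, h4⟩ := hball (y := H) (by rwa [Real.dist_eq, sub_zero, abs_of_pos hH])
  obtain ⟨b, hb0, hb, hblow⟩ := exists_equilibrium hm hmn hH h3
  obtain ⟨a, ha0, hab, hneck⟩ := exists_thin_neck hm hmn hH h4.le hb0
  have hconf := isConfining_profileEquation hm hmn hH
  have hQ : ∀ x ∈ Icc a b, 0 < profileIntegral n m H (x, 0) := by
    intro x hx
    have hx0 : 0 < x := ha0.trans_le hx.1
    rw [profileIntegral_zero hmn]
    have hs := sqrt_pos₁ x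
    have h5 : H * x ^ m ≤ H * b ^ m := by
      have := hx.2
      gcongr
    -- The equilibrium relation gives `n H b^m = (n - m) - m b² < n`, so `1 - H x^m` is positive up
    -- to `b`.
    have h6 : n * (H * b ^ m) < n := by
      have : 0 < m * b ^ 2 := by positivity
      linarith
    have h7 : H * b ^ m < 1 := by
      have hn0 : (0 : ℝ) < n := by linarith
      exact lt_of_mul_lt_mul_left (by linarith) hn0.le
    have h8 : 0 < 1 - H * x ^ m := by linarith
    positivity
  obtain ⟨w, p, hs, hp0, hG, hper⟩ := exists_symmetric_solution hconf ha0 hab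
    (by rw [profileEquation_zero hm H hb0, hb, zero_div])
    (fun x hx => profileEquation_zero_pos hm hH (ha0.trans_le hx.1) hx.2 hb) hQ
    (fderiv_profileEquation hm H hb0 hb hblow) hneck
  exact ⟨w, p, (hs.contDiff hconf).1, (hs.contDiff hconf).2, hs, hp0, hG, hper⟩

/-! ### Block coordinates and functions of the polar angle -/

section Coordinates

variable {n : ℕ}

/-- The point of `ℝⁿ⁺²` with first `n` coordinates `q.1` and last coordinates `q.2`. -/
noncomputable def assemble (n : ℕ) : (EuclideanSpace ℝ (Fin n) × ℝ × ℝ) →L[ℝ] Ambient n :=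
  LinearMap.toContinuousLinearMap
    { toFun := fun q => WithLp.toLp 2 (Fin.append q.1.ofLp ![q.2.1, q.2.2])
      map_add' := fun q q' => by
        ext i
        refine Fin.addCases (fun i => ?_) (fun i => ?_) i
        · simp
        · fin_cases i <;> simp
      map_smul' := fun c q => by
        ext i
        refine Fin.addCases (fun i => ?_) (fun i => ?_) i
        · simp
        · fin_cases i <;> simp }

/-- The first `n` coordinates. -/
noncomputable def head (n : ℕ) : Ambient n →L[ℝ] EuclideanSpace ℝ (Fin n) :=
  LinearMap.toContinuousLinearMap
    { toFun := fun x => WithLp.toLp 2 fun i => x (Fin.castAdd 2 i)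
      map_add' := fun x y => by ext i; simp
      map_smul' := fun c x => by ext i; simp }

/-- The last two coordinates, as a complex number. -/
noncomputable def tail (n : ℕ) : Ambient n →L[ℝ] ℂ :=
  LinearMap.toContinuousLinearMap
    { toFun := fun x => ⟨x (Fin.natAdd n 0), x (Fin.natAdd n 1)⟩
      map_add' := fun x y => by apply Complex.ext <;> simp
      map_smul' := fun c x => by apply Complex.ext <;> simp }

@[simp] theorem assemble_castAdd (q : EuclideanSpace ℝ (Fin n) × ℝ × ℝ) (i : Fin n) :
    assemble n q (Fin.castAdd 2 i) = q.1 i := by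
  simp [assemble]

@[simp] theorem assemble_natAdd_zero (q : EuclideanSpace ℝ (Fin n) × ℝ × ℝ) :
    assemble n q (Fin.natAdd n 0) = q.2.1 := by
  simp [assemble]

@[simp] theorem assemble_natAdd_one (q : EuclideanSpace ℝ (Fin n) × ℝ × ℝ) :
    assemble n q (Fin.natAdd n 1) = q.2.2 := by
  simp [assemble]

@[simp] theorem head_apply (x : Ambient n) (i : Fin n) : head n x i = x (Fin.castAdd 2 i) := by
  simp [head]

@[simp] theorem tail_re (x : Ambient n) : (tail n x).re = x (Fin.natAdd n 0) := by
  simp [tail]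

@[simp] theorem tail_im (x : Ambient n) : (tail n x).im = x (Fin.natAdd n 1) := by
  simp [tail]

@[simp] theorem head_assemble (q : EuclideanSpace ℝ (Fin n) × ℝ × ℝ) :
    head n (assemble n q) = q.1 := by
  ext i; simp

@[simp] theorem tail_assemble (q : EuclideanSpace ℝ (Fin n) × ℝ × ℝ) :
    tail n (assemble n q) = ⟨q.2.1, q.2.2⟩ := by
  apply Complex.ext <;> simp

theorem ambient_ext {x y : Ambient n} (h1 : head n x = head n y) (h2 : tail n x = tail n y) :
    x = y := by
  ext i
  refine Fin.addCases (fun i => ?_) (fun i => ?_) i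
  · have := congrArg (fun z : EuclideanSpace ℝ (Fin n) => z i) h1
    simpa using this
  · fin_cases i
    · simpa using congrArg Complex.re h2
    · simpa using congrArg Complex.im h2

theorem inner_eq (x y : Ambient n) : ⟪x, y⟫ = ⟪head n x, head n y⟫ +
    (tail n x).re * (tail n y).re + (tail n x).im * (tail n y).im := by
  simp only [PiLp.inner_apply, Fin.sum_univ_add, Fin.sum_univ_two, head_apply, tail_re, tail_im]
  simp only [RCLike.inner_apply, conj_trivial]
  ring

theorem inner_assemble (q q' : EuclideanSpace ℝ (Fin n) × ℝ × ℝ) :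
    ⟪assemble n q, assemble n q'⟫ = ⟪q.1, q'.1⟫ + q.2.1 * q'.2.1 + q.2.2 * q'.2.2 := by
  simp [inner_eq]

theorem norm_sq_eq (x : Ambient n) : ‖x‖ ^ 2 = ‖head n x‖ ^ 2 + ‖tail n x‖ ^ 2 := by
  rw [← real_inner_self_eq_norm_sq, inner_eq, real_inner_self_eq_norm_sq, Complex.sq_norm,
    Complex.normSq_apply]
  ring

end Coordinates

section Angle

variable {n : ℕ}

theorem eq_of_angle_eq {u : ℝ → ℝ} (hu : ∀ t, u (t + 2 * Real.pi) = u t) {a b : ℝ}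
    (h : (a : Real.Angle) = b) : u a = u b := by
  obtain ⟨k, hk⟩ := Real.Angle.angle_eq_iff_two_pi_dvd_sub.1 h
  have hper : Function.Periodic u (2 * Real.pi) := hu
  have : a = b + k • (2 * Real.pi) := by rw [zsmul_eq_mul]; linarith
  rw [this, hper.zsmul k]

/-- The function of the polar angle in the plane of the last two coordinates. -/
noncomputable def angleFun (n : ℕ) (u : ℝ → ℝ) (x : Ambient n) : ℝ := u (Complex.arg (tail n x))

theorem angleFun_eq {u : ℝ → ℝ} (hu : ∀ t, u (t + 2 * Real.pi) = u t) {x : Ambient n} {r θ : ℝ}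
    (hr : 0 < r) (hx : tail n x = r * (Real.cos θ + Real.sin θ * Complex.I)) :
    angleFun n u x = u θ := by
  refine eq_of_angle_eq hu ?_
  rw [hx]
  exact_mod_cast Complex.arg_mul_cos_add_sin_mul_I_coe_angle hr (θ : Real.Angle)

/-- A smooth local branch of the polar angle. -/
theorem exists_angle_branch {p : Ambient n} {r θ : ℝ} (hr : 0 < r)
    (hp : tail n p = r * (Real.cos θ + Real.sin θ * Complex.I)) :
    ∃ ℓ : Ambient n → ℝ, ContDiffAt ℝ ∞ ℓ p ∧ ℓ p = θ ∧ ∀ x, tail n x ≠ 0 →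
      tail n x = ‖tail n x‖ * (Real.cos (ℓ x) + Real.sin (ℓ x) * Complex.I) := by
  -- Rotating by `-θ` brings the tail of `p` to the positive real axis, where the logarithm is
  -- smooth. Away from `p` the resulting angle may jump, but by multiples of `2π`, so the polar
  -- identity holds everywhere.
  let c : ℂ := Complex.exp (-(θ * Complex.I))
  have hexp : Complex.exp (θ * Complex.I) = Real.cos θ + Real.sin θ * Complex.I := by
    rw [Complex.exp_mul_I]; simp
  have hpc : tail n p * c = r := by
    rw [hp, ← hexp, mul_assoc, ← Complex.exp_add, add_neg_cancel, Complex.exp_zero, mul_one]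
  refine ⟨fun x => θ + (Complex.log (tail n x * c)).im, ?_, ?_, ?_⟩
  · refine contDiffAt_const.add ?_
    have h1 : ContDiffAt ℝ ∞ (fun x => tail n x * c) p :=
      (tail n).contDiff.contDiffAt.mul contDiffAt_const
    have h2 : ContDiffAt ℝ ∞ Complex.log (tail n p * c) := by
      refine ContDiffAt.restrict_scalars ℝ (Complex.contDiffAt_log ?_)
      rw [hpc]
      exact Complex.ofReal_mem_slitPlane.2 hr
    exact Complex.imCLM.contDiff.contDiffAt.comp p (h2.comp p h1)
  · simp only [hpc, Complex.log_im, Complex.arg_ofReal_of_nonneg hr.le, add_zero]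
  · intro x hx
    have hc : ‖c‖ = 1 := by
      have := Complex.norm_exp_ofReal_mul_I (-θ)
      simpa [c] using this
    have h1 := Complex.norm_mul_exp_arg_mul_I (tail n x * c)
    rw [norm_mul, hc, mul_one] at h1
    simp only [Complex.log_im]
    have h2 : ∀ φ : ℝ, (Real.cos φ + Real.sin φ * Complex.I : ℂ) = Complex.exp (φ * Complex.I) :=
      fun φ => by rw [Complex.exp_mul_I]; simp
    rw [h2]
    push_cast
    rw [add_mul, Complex.exp_add, mul_left_comm, h1, mul_left_comm]
    simp only [c]
    rw [← Complex.exp_add, add_neg_cancel, Complex.exp_zero, mul_one]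

theorem tail_eq_polar (x : Ambient n) : tail n x = ‖tail n x‖ *
    (Real.cos (Complex.arg (tail n x)) + Real.sin (Complex.arg (tail n x)) * Complex.I) := by
  have := Complex.norm_mul_cos_add_sin_mul_I (tail n x)
  exact_mod_cast this.symm

/-- The cut of `arg` is harmless: a periodic `u` takes the same value on a smooth local branch of
the angle. -/
theorem contDiffAt_angleFun {u : ℝ → ℝ} (hu : ∀ t, u (t + 2 * Real.pi) = u t)
    (hus : ContDiff ℝ ∞ u) {x : Ambient n} (hx : tail n x ≠ 0) :
    ContDiffAt ℝ ∞ (angleFun n u) x := by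
  obtain ⟨ℓ, h1, -, h3⟩ := exists_angle_branch (norm_pos_iff.2 hx) (tail_eq_polar x)
  refine (hus.contDiffAt.comp x h1).congr_of_eventuallyEq ?_
  have hopen : IsOpen {y : Ambient n | tail n y ≠ 0} :=
    isOpen_ne_fun (tail n).continuous continuous_const
  filter_upwards [hopen.mem_nhds hx] with y hy
  exact angleFun_eq hu (norm_pos_iff.2 hy) (h3 y hy)

end Angle

/-! ### The rotational hypersurface: embedding, compactness, connectedness -/

/-- The data of a rotational hypersurface: a smooth periodic positive function `w` of the polar
angle, the profile curve being the projection of `(w, cos θ, sin θ)` to the sphere. -/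
structure IsProfile (w p : ℝ → ℝ) : Prop where
  smooth_w : ContDiff ℝ ∞ w
  smooth_p : ContDiff ℝ ∞ p
  hasDeriv : ∀ t, HasDerivAt w (p t) t
  pos : ∀ t, 0 < w t
  periodic : ∀ t, w (t + 2 * Real.pi) = w t

namespace IsProfile

/-- The profile curve in `ℝ × ℝ²`. -/
noncomputable def y₁ (w : ℝ → ℝ) (t : ℝ) : ℝ := w t / √(1 + w t ^ 2)
noncomputable def y₂ (w : ℝ → ℝ) (t : ℝ) : ℝ := Real.cos t / √(1 + w t ^ 2)
noncomputable def y₃ (w : ℝ → ℝ) (t : ℝ) : ℝ := Real.sin t / √(1 + w t ^ 2)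

/-- The velocity of the profile curve. -/
noncomputable def z₁ (w p : ℝ → ℝ) (t : ℝ) : ℝ := p t / √(1 + w t ^ 2) ^ 3
noncomputable def z₂ (w p : ℝ → ℝ) (t : ℝ) : ℝ :=
  -((1 + w t ^ 2) * Real.sin t + w t * p t * Real.cos t) / √(1 + w t ^ 2) ^ 3
noncomputable def z₃ (w p : ℝ → ℝ) (t : ℝ) : ℝ :=
  ((1 + w t ^ 2) * Real.cos t - w t * p t * Real.sin t) / √(1 + w t ^ 2) ^ 3

/-- The unit normal of the profile curve. -/
noncomputable def ν₁ (w p : ℝ → ℝ) (t : ℝ) : ℝ := (√(1 + w t ^ 2 + p t ^ 2))⁻¹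
noncomputable def ν₂ (w p : ℝ → ℝ) (t : ℝ) : ℝ :=
  (p t * Real.sin t - w t * Real.cos t) / √(1 + w t ^ 2 + p t ^ 2)
noncomputable def ν₃ (w p : ℝ → ℝ) (t : ℝ) : ℝ :=
  (-(w t * Real.sin t) - p t * Real.cos t) / √(1 + w t ^ 2 + p t ^ 2)

/-- The point of the hypersurface with profile parameter `t` and orbit parameter `z`. -/
noncomputable def point (n : ℕ) (w : ℝ → ℝ) (t : ℝ) (z : EuclideanSpace ℝ (Fin n)) : Ambient n :=
  assemble n (y₁ w t • z, y₂ w t, y₃ w t)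

/-- The rotational hypersurface with profile `w`. -/
def surface (n : ℕ) (w : ℝ → ℝ) : Set (Ambient n) :=
  {x | ∃ (t : ℝ) (z : EuclideanSpace ℝ (Fin n)), ‖z‖ = 1 ∧ x = point n w t z}

/-- The unit normal field. -/
noncomputable def normal (n : ℕ) (w p : ℝ → ℝ) (x : Ambient n) : Ambient n :=
  -assemble n ((angleFun n (ν₁ w p) x / ‖head n x‖) • head n x, angleFun n (ν₂ w p) x,
    angleFun n (ν₃ w p) x)

variable {n : ℕ} {w p : ℝ → ℝ} {t : ℝ} {z : EuclideanSpace ℝ (Fin n)}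

theorem y₁_pos (h : IsProfile w p) (t : ℝ) : 0 < y₁ w t := div_pos (h.pos t) (sqrt_pos₁ _)

theorem hasDerivAt_y₁ (h : IsProfile w p) (t : ℝ) : HasDerivAt (y₁ w) (z₁ w p t) t :=
  SphereHypersurface.hasDerivAt_y₁ (h.hasDeriv t)

theorem hasDerivAt_y₂ (h : IsProfile w p) (t : ℝ) : HasDerivAt (y₂ w) (z₂ w p t) t :=
  SphereHypersurface.hasDerivAt_y₂ (h.hasDeriv t)

theorem hasDerivAt_y₃ (h : IsProfile w p) (t : ℝ) : HasDerivAt (y₃ w) (z₃ w p t) t :=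
  SphereHypersurface.hasDerivAt_y₃ (h.hasDeriv t)

theorem periodic_p (h : IsProfile w p) (t : ℝ) : p (t + 2 * Real.pi) = p t := by
  have h1 := (h.hasDeriv (t + 2 * Real.pi)).comp_add_const t (2 * Real.pi)
  have h2 : (fun t => w (t + 2 * Real.pi)) = w := funext h.periodic
  rw [h2] at h1
  exact h1.unique (h.hasDeriv t)

theorem contDiff_sqrt₁ (h : IsProfile w p) : ContDiff ℝ ∞ fun t => √(1 + w t ^ 2) :=
  (contDiff_const.add (h.smooth_w.pow 2)).sqrt fun _ => by positivity

theorem contDiff_sqrt₂ (h : IsProfile w p) : ContDiff ℝ ∞ fun t => √(1 + w t ^ 2 + p t ^ 2) :=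
  ((contDiff_const.add (h.smooth_w.pow 2)).add (h.smooth_p.pow 2)).sqrt fun _ => by positivity

theorem contDiff_y₁ (h : IsProfile w p) : ContDiff ℝ ∞ (y₁ w) :=
  h.smooth_w.div h.contDiff_sqrt₁ fun _ => (sqrt_pos₁ _).ne'

theorem contDiff_y₂ (h : IsProfile w p) : ContDiff ℝ ∞ (y₂ w) :=
  Real.contDiff_cos.div h.contDiff_sqrt₁ fun _ => (sqrt_pos₁ _).ne'

theorem contDiff_y₃ (h : IsProfile w p) : ContDiff ℝ ∞ (y₃ w) :=
  Real.contDiff_sin.div h.contDiff_sqrt₁ fun _ => (sqrt_pos₁ _).ne'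

theorem contDiff_ν₁ (h : IsProfile w p) : ContDiff ℝ ∞ (ν₁ w p) :=
  h.contDiff_sqrt₂.inv fun _ => (sqrt_pos₂ _ _).ne'

theorem contDiff_ν₂ (h : IsProfile w p) : ContDiff ℝ ∞ (ν₂ w p) :=
  ((h.smooth_p.mul Real.contDiff_sin).sub (h.smooth_w.mul Real.contDiff_cos)).div h.contDiff_sqrt₂
    fun _ => (sqrt_pos₂ _ _).ne'

theorem contDiff_ν₃ (h : IsProfile w p) : ContDiff ℝ ∞ (ν₃ w p) :=
  ((h.smooth_w.mul Real.contDiff_sin).neg.sub (h.smooth_p.mul Real.contDiff_cos)).div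
    h.contDiff_sqrt₂ fun _ => (sqrt_pos₂ _ _).ne'

theorem periodic_ν₁ (h : IsProfile w p) (t : ℝ) : ν₁ w p (t + 2 * Real.pi) = ν₁ w p t := by
  simp only [ν₁, h.periodic, h.periodic_p]

theorem periodic_ν₂ (h : IsProfile w p) (t : ℝ) : ν₂ w p (t + 2 * Real.pi) = ν₂ w p t := by
  simp only [ν₂, h.periodic, h.periodic_p, Real.sin_add_two_pi, Real.cos_add_two_pi]

theorem periodic_ν₃ (h : IsProfile w p) (t : ℝ) : ν₃ w p (t + 2 * Real.pi) = ν₃ w p t := by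
  simp only [ν₃, h.periodic, h.periodic_p, Real.sin_add_two_pi, Real.cos_add_two_pi]

theorem y_sq (w : ℝ → ℝ) (t : ℝ) : y₁ w t ^ 2 + y₂ w t ^ 2 + y₃ w t ^ 2 = 1 := by
  simp only [y₁, y₂, y₃, div_pow, sq_sqrt₁]
  rw [← add_div, ← add_div, add_assoc, Real.cos_sq_add_sin_sq, add_comm, div_self (by positivity)]

theorem ν_sq (w p : ℝ → ℝ) (t : ℝ) : ν₁ w p t ^ 2 + ν₂ w p t ^ 2 + ν₃ w p t ^ 2 = 1 := by
  simp only [ν₁, ν₂, ν₃, div_pow, inv_pow, sq_sqrt₂]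
  have : 0 < 1 + w t ^ 2 + p t ^ 2 := by positivity
  field_simp
  linear_combination (p t ^ 2 + w t ^ 2) * Real.sin_sq_add_cos_sq t

theorem ν_y (w p : ℝ → ℝ) (t : ℝ) :
    ν₁ w p t * y₁ w t + ν₂ w p t * y₂ w t + ν₃ w p t * y₃ w t = 0 := by
  simp only [ν₁, ν₂, ν₃, y₁, y₂, y₃]
  have := sqrt_pos₁ (w t)
  have := sqrt_pos₂ (w t) (p t)
  field_simp
  linear_combination (-w t) * Real.sin_sq_add_cos_sq t

theorem ν_z (w p : ℝ → ℝ) (t : ℝ) :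
    ν₁ w p t * z₁ w p t + ν₂ w p t * z₂ w p t + ν₃ w p t * z₃ w p t = 0 := by
  simp only [ν₁, ν₂, ν₃, z₁, z₂, z₃]
  have := sqrt_pos₁ (w t)
  have := sqrt_pos₂ (w t) (p t)
  field_simp
  linear_combination (-p t) * Real.sin_sq_add_cos_sq t

theorem z_sq (w p : ℝ → ℝ) (t : ℝ) : z₁ w p t ^ 2 + z₂ w p t ^ 2 + z₃ w p t ^ 2 =
    (√(1 + w t ^ 2 + p t ^ 2) / (1 + w t ^ 2)) ^ 2 := by
  have e : (√(1 + w t ^ 2) ^ 3) ^ 2 = (1 + w t ^ 2) ^ 3 := by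
    rw [← pow_mul, mul_comm 3 2, pow_mul, sq_sqrt₁]
  simp only [z₁, z₂, z₃, div_pow, e, sq_sqrt₂]
  have : 0 < 1 + w t ^ 2 := by positivity
  field_simp
  linear_combination ((1 + w t ^ 2) ^ 2 + w t ^ 2 * p t ^ 2) * Real.sin_sq_add_cos_sq t

theorem tail_point (w : ℝ → ℝ) (t : ℝ) (z : EuclideanSpace ℝ (Fin n)) : tail n (point n w t z) =
    ((√(1 + w t ^ 2))⁻¹ : ℝ) * (Real.cos t + Real.sin t * Complex.I) := by
  apply Complex.ext
  · simp only [point, tail_assemble, y₂, Complex.add_re, Complex.mul_re,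
      Complex.ofReal_re, Complex.ofReal_im, Complex.I_re, Complex.I_im]
    ring
  · simp only [point, tail_assemble, y₃, Complex.add_im, Complex.mul_im,
      Complex.ofReal_re, Complex.ofReal_im, Complex.I_re, Complex.I_im]
    ring

theorem tail_point_ne_zero (w : ℝ → ℝ) (t : ℝ) (z : EuclideanSpace ℝ (Fin n)) :
    tail n (point n w t z) ≠ 0 := by
  intro h0
  have h1 := congrArg Complex.re h0
  have h2 := congrArg Complex.im h0
  have hs := sqrt_pos₁ (w t)
  simp only [point, tail_assemble, y₂, y₃, Complex.zero_re, Complex.zero_im, div_eq_zero_iff,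
    hs.ne', or_false] at h1 h2
  have := Real.sin_sq_add_cos_sq t
  rw [h1, h2] at this
  norm_num at this

theorem norm_tail_point (w : ℝ → ℝ) (t : ℝ) (z : EuclideanSpace ℝ (Fin n)) :
    ‖tail n (point n w t z)‖ = (√(1 + w t ^ 2))⁻¹ := by
  have hs := sqrt_pos₁ (w t)
  rw [tail_point, norm_mul, Complex.norm_real, Real.norm_of_nonneg (by positivity),
    Complex.ofReal_cos, Complex.ofReal_sin, Complex.norm_cos_add_sin_mul_I, mul_one]

theorem head_point (w : ℝ → ℝ) (t : ℝ) (z : EuclideanSpace ℝ (Fin n)) :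
    head n (point n w t z) = y₁ w t • z := by
  simp [point]

theorem norm_head_point (h : IsProfile w p) (t : ℝ) (hz : ‖z‖ = 1) :
    ‖head n (point n w t z)‖ = y₁ w t := by
  rw [head_point, norm_smul, hz, mul_one, Real.norm_of_nonneg (h.y₁_pos t).le]

theorem angleFun_point {u : ℝ → ℝ} (hu : ∀ t, u (t + 2 * Real.pi) = u t) (w : ℝ → ℝ) (t : ℝ)
    (z : EuclideanSpace ℝ (Fin n)) : angleFun n u (point n w t z) = u t :=
  angleFun_eq hu (inv_pos.2 (sqrt_pos₁ (w t))) (tail_point w t z)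

theorem normal_point (h : IsProfile w p) (t : ℝ) (hz : ‖z‖ = 1) :
    normal n w p (point n w t z) = -assemble n (ν₁ w p t • z, ν₂ w p t, ν₃ w p t) := by
  unfold normal
  rw [angleFun_point h.periodic_ν₁, angleFun_point h.periodic_ν₂, angleFun_point h.periodic_ν₃,
    h.norm_head_point t hz, head_point, smul_smul, div_mul_cancel₀ _ (h.y₁_pos t).ne']

theorem norm_point (w : ℝ → ℝ) (t : ℝ) (hz : ‖z‖ = 1) : ‖point n w t z‖ = 1 := by
  have : ‖point n w t z‖ ^ 2 = 1 := by
    rw [← real_inner_self_eq_norm_sq, point, inner_assemble]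
    simp only [real_inner_self_eq_norm_sq, norm_smul, hz, mul_one, Real.norm_eq_abs, sq_abs]
    linarith [y_sq w t]
  nlinarith [norm_nonneg (point n w t z)]

end IsProfile

/-- The complement of the two coordinate subspaces fixed by the two blocks of rotations. -/
def regularSet (n : ℕ) : Set (Ambient n) := {x | head n x ≠ 0 ∧ tail n x ≠ 0}

theorem isOpen_regularSet (n : ℕ) : IsOpen (regularSet n) :=
  (isOpen_ne_fun (head n).continuous continuous_const).inter
    (isOpen_ne_fun (tail n).continuous continuous_const)

namespace IsProfile

variable {n : ℕ} {w p : ℝ → ℝ} {t : ℝ} {z : EuclideanSpace ℝ (Fin n)}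

theorem surface_subset_regularSet (h : IsProfile w p) : surface n w ⊆ regularSet n := by
  rintro _ ⟨t, z, hz, rfl⟩
  refine ⟨?_, tail_point_ne_zero w t z⟩
  rw [← norm_pos_iff, h.norm_head_point t hz]
  exact h.y₁_pos t

theorem surface_subset_unitSphere : surface n w ⊆ unitSphere n := by
  rintro _ ⟨t, z, hz, rfl⟩
  rw [unitSphere, mem_sphere_zero_iff_norm]
  exact norm_point w t hz

/-- The function whose zero set in the sphere is the hypersurface. -/
noncomputable def definingFun (n : ℕ) (w : ℝ → ℝ) (x : Ambient n) : ℝ :=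
  ‖head n x‖ - ‖tail n x‖ * angleFun n w x

theorem contDiffAt_norm_head {x : Ambient n} (hx : head n x ≠ 0) :
    ContDiffAt ℝ ∞ (fun x => ‖head n x‖) x :=
  (contDiffAt_norm ℝ hx).comp x (head n).contDiff.contDiffAt

theorem contDiffAt_norm_tail {x : Ambient n} (hx : tail n x ≠ 0) :
    ContDiffAt ℝ ∞ (fun x => ‖tail n x‖) x :=
  (contDiffAt_norm ℝ hx).comp x (tail n).contDiff.contDiffAt

theorem contDiffAt_definingFun (h : IsProfile w p) {x : Ambient n} (hx : x ∈ regularSet n) :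
    ContDiffAt ℝ ∞ (definingFun n w) x :=
  (contDiffAt_norm_head hx.1).sub
    ((contDiffAt_norm_tail hx.2).mul (contDiffAt_angleFun h.periodic h.smooth_w hx.2))

/-- On the unit sphere, `‖head‖ = w ‖tail‖` together with `‖head‖² + ‖tail‖² = 1` forces `‖tail‖ = 1
/ √(1 + w²)`, so the angle determines both radii. -/
theorem mem_surface_iff (h : IsProfile w p) {x : Ambient n} (hx : x ∈ regularSet n) :
    x ∈ surface n w ↔ x ∈ unitSphere n ∧ definingFun n w x = 0 := by
  constructor
  · intro hxM
    refine ⟨surface_subset_unitSphere hxM, ?_⟩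
    obtain ⟨t, z, hz, rfl⟩ := hxM
    rw [definingFun, h.norm_head_point t hz, norm_tail_point, angleFun_point h.periodic, y₁]
    ring
  · rintro ⟨hS, hf⟩
    have hnorm : ‖x‖ = 1 := mem_sphere_zero_iff_norm.1 hS
    have hh : 0 < ‖head n x‖ := norm_pos_iff.2 hx.1
    have hr : 0 < ‖tail n x‖ := norm_pos_iff.2 hx.2
    set θ := Complex.arg (tail n x) with hθ
    have hA : angleFun n w x = w θ := rfl
    have hs := sqrt_pos₁ (w θ)
    have hf' : ‖head n x‖ = ‖tail n x‖ * w θ := sub_eq_zero.1 hf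
    have h1 : ‖tail n x‖ = (√(1 + w θ ^ 2))⁻¹ := by
      have h2 := norm_sq_eq x
      rw [hnorm, hf'] at h2
      have h3 : (‖tail n x‖ * √(1 + w θ ^ 2)) ^ 2 = 1 := by
        rw [mul_pow, sq_sqrt₁]; linarith
      have h4 : ‖tail n x‖ * √(1 + w θ ^ 2) = 1 := by
        have : 0 < ‖tail n x‖ * √(1 + w θ ^ 2) := by positivity
        nlinarith
      exact eq_inv_of_mul_eq_one_left h4
    refine ⟨θ, ‖head n x‖⁻¹ • head n x, ?_, ?_⟩
    · rw [norm_smul, norm_inv, norm_norm, inv_mul_cancel₀ hh.ne']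
    · refine ambient_ext ?_ ?_
      · rw [head_point, smul_smul]
        have : y₁ w θ * ‖head n x‖⁻¹ = 1 := by
          rw [hf', h1, y₁]
          have := h.pos θ
          field_simp
        rw [this, one_smul]
      · rw [tail_point, ← h1]
        exact tail_eq_polar x

/-- The hypersurface is embedded. -/
theorem isEmbeddedHypersurface (h : IsProfile w p) : IsEmbeddedHypersurface n (surface n w) := by
  refine ⟨surface_subset_unitSphere, fun q hq => ⟨regularSet n, definingFun n w,
    isOpen_regularSet n, h.surface_subset_regularSet hq,
    fun x hx => (h.contDiffAt_definingFun hx).contDiffWithinAt, ?_, ?_⟩⟩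
  · rintro x ⟨-, hx⟩
    set a := ‖head n x‖ with ha
    set b := ‖tail n x‖ with hb
    have ha0 : 0 < a := norm_pos_iff.2 hx.1
    have hb0 : 0 < b := norm_pos_iff.2 hx.2
    -- This `v` is orthogonal to `x`, the two blocks contributing `a² b²` and `-a² b²`. Moving along
    -- it rescales the two blocks, with positive factors for small `s`, so the angle stays fixed and
    -- the derivative is `a b² + a² b w > 0`.
    let v : Ambient n := assemble n (b ^ 2 • head n x, -a ^ 2 * (tail n x).re,
      -a ^ 2 * (tail n x).im)
    have hvh : head n v = b ^ 2 • head n x := by simp [v]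
    have hvt : tail n v = ((-a ^ 2 : ℝ) : ℂ) * tail n x := by
      apply Complex.ext
      · rw [Complex.re_ofReal_mul]; simp [v]
      · rw [Complex.im_ofReal_mul]; simp [v]
    refine ⟨v, ?_, ?_⟩
    · have h2 : b ^ 2 = (tail n x).re * (tail n x).re + (tail n x).im * (tail n x).im := by
        rw [hb, Complex.sq_norm, Complex.normSq_apply]
      rw [inner_eq, hvh, hvt, Complex.re_ofReal_mul, Complex.im_ofReal_mul, real_inner_smul_right,
        real_inner_self_eq_norm_sq]
      rw [← ha]
      linear_combination (a ^ 2) * h2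
    · have hd : HasDerivAt (fun s : ℝ => definingFun n w (x + s • v))
          (fderiv ℝ (definingFun n w) x v) 0 := by
        have h1 : HasDerivAt (fun s : ℝ => x + s • v) v 0 := by
          simpa using ((hasDerivAt_id (0 : ℝ)).smul_const v).const_add x
        have h2 : HasFDerivAt (definingFun n w) (fderiv ℝ (definingFun n w) x) (x + (0 : ℝ) • v) := by
          rw [zero_smul, add_zero]
          exact ((h.contDiffAt_definingFun hx).differentiableAt (by simp)).hasFDerivAt
        exact h2.comp_hasDerivAt (0 : ℝ) h1
      have hd' : HasDerivAt (fun s : ℝ => (1 + s * b ^ 2) * a - (1 - s * a ^ 2) * b * angleFun n w x)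
          (b ^ 2 * a + a ^ 2 * b * angleFun n w x) 0 := by
        have h1 := ((((hasDerivAt_id (0 : ℝ)).mul_const (b ^ 2)).const_add 1).mul_const a).sub
          (((((hasDerivAt_id (0 : ℝ)).mul_const (a ^ 2)).const_sub 1).mul_const b).mul_const
            (angleFun n w x))
        refine h1.congr_deriv ?_
        ring
      have heq : (fun s : ℝ => definingFun n w (x + s • v)) =ᶠ[𝓝 0]
          fun s : ℝ => (1 + s * b ^ 2) * a - (1 - s * a ^ 2) * b * angleFun n w x := by
        have e1 : ∀ᶠ s : ℝ in 𝓝 0, 0 < 1 + s * b ^ 2 :=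
          ContinuousAt.eventually_lt (by fun_prop) (by fun_prop) (by norm_num)
        have e2 : ∀ᶠ s : ℝ in 𝓝 0, 0 < 1 - s * a ^ 2 :=
          ContinuousAt.eventually_lt (by fun_prop) (by fun_prop) (by norm_num)
        filter_upwards [e1, e2] with s h1 h2
        have hh : head n (x + s • v) = (1 + s * b ^ 2) • head n x := by
          rw [map_add, map_smul, hvh, smul_smul, add_smul, one_smul]
        have ht : tail n (x + s • v) = ((1 - s * a ^ 2 : ℝ) : ℂ) * tail n x := by
          rw [map_add, map_smul, hvt, Complex.real_smul]
          push_cast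
          ring
        have hA : angleFun n w (x + s • v) = angleFun n w x := by
          rw [angleFun, ht, Complex.arg_real_mul _ h2, angleFun]
        rw [definingFun, hA, hh, ht, norm_smul, norm_mul, Complex.norm_real,
          Real.norm_of_nonneg h1.le, Real.norm_of_nonneg h2.le]
      rw [hd.unique (hd'.congr_of_eventuallyEq heq)]
      have : 0 < angleFun n w x := h.pos _
      positivity
  · ext x
    constructor
    · rintro ⟨h1, h2⟩
      have := (h.mem_surface_iff h2).1 h1
      exact ⟨this.1, h2, this.2⟩
    · rintro ⟨h1, h2, h3⟩
      exact ⟨(h.mem_surface_iff h2).2 ⟨h1, h3⟩, h2⟩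

theorem continuous_point (h : IsProfile w p) :
    Continuous fun q : ℝ × EuclideanSpace ℝ (Fin n) => point n w q.1 q.2 := by
  have h1 := h.contDiff_y₁.continuous
  have h2 := h.contDiff_y₂.continuous
  have h3 := h.contDiff_y₃.continuous
  exact (assemble n).continuous.comp (((h1.comp continuous_fst).smul continuous_snd).prodMk
    ((h2.comp continuous_fst).prodMk (h3.comp continuous_fst)))

theorem surface_eq_image : surface n w = (fun q : ℝ × EuclideanSpace ℝ (Fin n) =>
    point n w q.1 q.2) '' (univ ×ˢ Metric.sphere 0 1) := by
  ext x
  constructor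
  · rintro ⟨t, z, hz, rfl⟩
    exact ⟨(t, z), ⟨mem_univ _, mem_sphere_zero_iff_norm.2 hz⟩, rfl⟩
  · rintro ⟨⟨t, z⟩, ⟨-, hz⟩, rfl⟩
    exact ⟨t, z, mem_sphere_zero_iff_norm.1 hz, rfl⟩

theorem periodic_point (h : IsProfile w p) (t : ℝ) (z : EuclideanSpace ℝ (Fin n)) :
    point n w (t + 2 * Real.pi) z = point n w t z := by
  simp only [point, y₁, y₂, y₃, h.periodic, Real.cos_add_two_pi, Real.sin_add_two_pi]

theorem isCompact_surface (h : IsProfile w p) : IsCompact (surface n w) := by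
  have : surface n w = (fun q : ℝ × EuclideanSpace ℝ (Fin n) => point n w q.1 q.2) ''
      (Icc 0 (2 * Real.pi) ×ˢ Metric.sphere 0 1) := by
    refine Subset.antisymm ?_ ?_
    · rintro _ ⟨t, z, hz, rfl⟩
      have hper : Function.Periodic (fun t => point n w t z) (2 * Real.pi) :=
        fun t => h.periodic_point t z
      obtain ⟨s, hs, hst⟩ := hper.exists_mem_Ico₀ Real.two_pi_pos t
      exact ⟨(s, z), ⟨Ico_subset_Icc_self hs, mem_sphere_zero_iff_norm.2 hz⟩, hst.symm⟩
    · rw [surface_eq_image]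
      exact image_mono (prod_mono_left (subset_univ _))
  rw [this]
  exact (isCompact_Icc.prod (isCompact_sphere 0 1)).image h.continuous_point

/-- The bound `n ≥ 2` makes the orbit sphere `Sⁿ⁻¹` connected. -/
theorem isConnected_surface (h : IsProfile w p) (hn : 2 ≤ n) : IsConnected (surface n w) := by
  rw [surface_eq_image]
  refine IsConnected.image ?_ _ h.continuous_point.continuousOn
  refine isConnected_univ.prod (isConnected_sphere ?_ 0 zero_le_one)
  rw [← Module.finrank_eq_rank, finrank_euclideanSpace_fin]
  exact_mod_cast hn

/-! ### Tangent spaces and principal curvatures -/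

/-- The velocity of a curve in the hypersurface. -/
theorem exists_velocity (h : IsProfile w p) (hz : ‖z‖ = 1) {γ : ℝ → Ambient n}
    (hγ : ContDiff ℝ ∞ γ) (hγM : ∀ s, γ s ∈ surface n w) (hγ0 : γ 0 = point n w t z) :
    ∃ (c : ℝ) (ζ : EuclideanSpace ℝ (Fin n)), ⟪z, ζ⟫ = 0 ∧ deriv γ 0 =
      assemble n ((c * z₁ w p t) • z + y₁ w t • ζ, c * z₂ w p t, c * z₃ w p t) := by
  obtain ⟨ℓ, hℓ, hℓ0, hℓx⟩ := exists_angle_branch (inv_pos.2 (sqrt_pos₁ (w t))) (tail_point w t z)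
  -- The curve is lifted to the parameters: `ℓ ∘ γ` for the angle and `Z` for the orbit, both
  -- differentiable at `0`.
  let Z : ℝ → EuclideanSpace ℝ (Fin n) := fun s => ‖head n (γ s)‖⁻¹ • head n (γ s)
  have hreg : ∀ s, γ s ∈ regularSet n := fun s => h.surface_subset_regularSet (hγM s)
  have hcγ : DifferentiableAt ℝ γ 0 := hγ.differentiable (by simp) 0
  have hZd : DifferentiableAt ℝ Z 0 := by
    have h1 : DifferentiableAt ℝ (fun s => head n (γ s)) 0 :=
      (head n).differentiableAt.comp 0 hcγ
    have h2 : DifferentiableAt ℝ (fun s => ‖head n (γ s)‖) 0 := h1.norm ℝ (hreg 0).1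
    exact (h2.inv (norm_ne_zero_iff.2 (hreg 0).1)).smul h1
  have hZ0 : Z 0 = z := by
    simp only [Z, hγ0]
    rw [h.norm_head_point t hz, head_point, smul_smul, inv_mul_cancel₀ (h.y₁_pos t).ne', one_smul]
  have hZn : ∀ s, ‖Z s‖ = 1 := fun s => by
    have := norm_pos_iff.2 (hreg s).1
    simp only [Z, norm_smul, norm_inv, norm_norm]
    exact inv_mul_cancel₀ this.ne'
  have hℓd : HasDerivAt (fun s => ℓ (γ s)) (fderiv ℝ ℓ (γ 0) (deriv γ 0)) 0 := by
    refine HasFDerivAt.comp_hasDerivAt (0 : ℝ) ?_ hcγ.hasDerivAt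
    rw [hγ0]
    exact (hℓ.differentiableAt (by simp)).hasFDerivAt
  set c := fderiv ℝ ℓ (γ 0) (deriv γ 0)
  have hγeq : ∀ s, γ s = assemble n (y₁ w (ℓ (γ s)) • Z s, y₂ w (ℓ (γ s)), y₃ w (ℓ (γ s))) := by
    intro s
    obtain ⟨θ, ζ, hζ, hs⟩ := hγM s
    -- The parameter `θ` of `γ s` and the branch `ℓ` agree only modulo `2π`, which suffices because
    -- `y₁`, `y₂`, `y₃` are periodic.
    have hang : (ℓ (γ s) : Real.Angle) = θ := by
      have h1 : ((Complex.arg (tail n (γ s)) : ℝ) : Real.Angle) = ℓ (γ s) := by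
        rw [hℓx _ (hreg s).2]
        exact_mod_cast Complex.arg_mul_cos_add_sin_mul_I_coe_angle
          (norm_pos_iff.2 (hreg s).2) (ℓ (γ s) : Real.Angle)
      have h2 : ((Complex.arg (tail n (γ s)) : ℝ) : Real.Angle) = θ := by
        rw [hs, tail_point]
        exact_mod_cast Complex.arg_mul_cos_add_sin_mul_I_coe_angle
          (inv_pos.2 (sqrt_pos₁ (w θ))) (θ : Real.Angle)
      exact h1.symm.trans h2
    have hper : ∀ u : ℝ → ℝ, (∀ t, u (t + 2 * Real.pi) = u t) → u (ℓ (γ s)) = u θ :=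
      fun u hu => eq_of_angle_eq hu hang
    have hZs : Z s = ζ := by
      simp only [Z, hs]
      rw [h.norm_head_point θ hζ, head_point, smul_smul, inv_mul_cancel₀ (h.y₁_pos θ).ne', one_smul]
    rw [hZs, hper (y₁ w) (fun t => by simp only [y₁, h.periodic]),
      hper (y₂ w) (fun t => by simp only [y₂, h.periodic, Real.cos_add_two_pi]),
      hper (y₃ w) (fun t => by simp only [y₃, h.periodic, Real.sin_add_two_pi]), hs, point]
  refine ⟨c, deriv Z 0, ?_, ?_⟩
  · have h1 : HasDerivAt (fun s => ⟪Z s, Z s⟫) (⟪Z 0, deriv Z 0⟫ + ⟪deriv Z 0, Z 0⟫) 0 :=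
      hZd.hasDerivAt.inner ℝ hZd.hasDerivAt
    have h2 : (fun s => ⟪Z s, Z s⟫) = fun _ => (1 : ℝ) := by
      funext s
      rw [real_inner_self_eq_norm_sq, hZn, one_pow]
    rw [h2] at h1
    have h3 := h1.unique (hasDerivAt_const (0 : ℝ) (1 : ℝ))
    rw [hZ0, real_inner_comm] at h3
    rw [real_inner_comm]
    linarith
  · have hℓ00 : ℓ (γ 0) = t := by rw [hγ0, hℓ0]
    have h1 := (h.hasDerivAt_y₁ (ℓ (γ 0))).comp 0 hℓd
    have h2 := (h.hasDerivAt_y₂ (ℓ (γ 0))).comp 0 hℓd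
    have h3 := (h.hasDerivAt_y₃ (ℓ (γ 0))).comp 0 hℓd
    have h4 := ((h1.smul hZd.hasDerivAt).prodMk (h2.prodMk h3))
    have h5 := (assemble n).hasFDerivAt.comp_hasDerivAt (0 : ℝ) h4
    have h6 : HasDerivAt γ _ 0 := h5.congr_of_eventuallyEq (Eventually.of_forall hγeq)
    rw [h6.deriv]
    simp only [Function.comp, hℓ00, hZ0]
    refine congrArg (assemble n) (Prod.ext ?_ (Prod.ext (mul_comm _ _) (mul_comm _ _)))
    exact (add_comm _ _).trans (by rw [mul_comm (z₁ w p t)])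

end IsProfile

/-- The elementary symmetric functions of `n` numbers of which `n - 1` are equal. -/
theorem sum_powersetCard_update {n m : ℕ} (hm : 1 ≤ m) (i₀ : Fin n) (l μ : ℝ) :
    ∑ s ∈ Finset.powersetCard m (Finset.univ : Finset (Fin n)),
      ∏ i ∈ s, (if i = i₀ then μ else l) =
      (n - 1).choose m * l ^ m + (n - 1).choose (m - 1) * (l ^ (m - 1) * μ) := by
  obtain ⟨j, rfl⟩ : ∃ j, m = j + 1 := ⟨m - 1, by omega⟩
  have hi : i₀ ∉ Finset.univ.erase i₀ := Finset.notMem_erase _ _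
  have huniv : (Finset.univ : Finset (Fin n)) = insert i₀ (Finset.univ.erase i₀) :=
    (Finset.insert_erase (Finset.mem_univ _)).symm
  have hcard : (Finset.univ.erase i₀).card = n - 1 := by
    rw [Finset.card_erase_of_mem (Finset.mem_univ _), Finset.card_univ, Fintype.card_fin]
  have hconst : ∀ s ⊆ Finset.univ.erase i₀, ∏ i ∈ s, (if i = i₀ then μ else l) = l ^ s.card := by
    intro s hs
    rw [← Finset.prod_const]
    refine Finset.prod_congr rfl fun i hi => ?_
    rw [if_neg (Finset.ne_of_mem_erase (hs hi))]
  rw [huniv, Finset.powersetCard_succ_insert hi, Finset.sum_union]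
  · congr 1
    · rw [Finset.sum_congr rfl (g := fun _ => l ^ (j + 1))]
      · rw [Finset.sum_const, Finset.card_powersetCard, hcard, nsmul_eq_mul]
      · intro s hs
        rw [Finset.mem_powersetCard] at hs
        rw [hconst s hs.1, hs.2]
    · rw [Finset.sum_image, Finset.sum_congr rfl (g := fun _ => l ^ j * μ)]
      · rw [Finset.sum_const, Finset.card_powersetCard, hcard, nsmul_eq_mul, Nat.add_sub_cancel]
      · intro s hs
        rw [Finset.mem_powersetCard] at hs
        rw [Finset.prod_insert fun h => hi (hs.1 h), hconst s hs.1, hs.2, if_pos rfl, mul_comm]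
      · intro s hs t ht hst
        have hs' := (Finset.mem_powersetCard.1 hs).1
        have ht' := (Finset.mem_powersetCard.1 ht).1
        rw [← Finset.erase_insert fun h => hi (hs' h), hst,
          Finset.erase_insert fun h => hi (ht' h)]
  · rw [Finset.disjoint_left]
    intro s hs hs'
    obtain ⟨t, -, rfl⟩ := Finset.mem_image.1 hs'
    exact hi ((Finset.mem_powersetCard.1 hs).1 (Finset.mem_insert_self _ _))

/-- Pascal's rule and `m C(n, m) = n C(n-1, m-1)` turn the symmetric function into `C(n, m) / n`
times the left side of `h`. -/
theorem sum_powersetCard_eq {n m : ℕ} (hm : 1 ≤ m) (hmn : m ≤ n) (i₀ : Fin n) {l μ H : ℝ}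
    (h : (n - m) * l ^ m + m * l ^ (m - 1) * μ = n * H) :
    (n.choose m : ℝ) * H = ∑ s ∈ Finset.powersetCard m (Finset.univ : Finset (Fin n)),
      ∏ i ∈ s, (if i = i₀ then μ else l) := by
  rw [sum_powersetCard_update hm]
  obtain ⟨j, rfl⟩ : ∃ j, m = j + 1 := ⟨m - 1, by omega⟩
  obtain ⟨k, rfl⟩ : ∃ k, n = k + 1 := ⟨n - 1, by omega⟩
  simp only [Nat.add_sub_cancel] at h ⊢
  have h1 : ((k + 1).choose (j + 1) : ℝ) * (j + 1) = (k + 1) * k.choose j := by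
    exact_mod_cast (Nat.add_one_mul_choose_eq k j).symm
  have h2 : ((k + 1).choose (j + 1) : ℝ) = k.choose j + k.choose (j + 1) := by
    exact_mod_cast Nat.choose_succ_succ k j
  have hk : (0 : ℝ) < k + 1 := by positivity
  refine mul_left_cancel₀ hk.ne' ?_
  push_cast at h
  linear_combination (-((k + 1).choose (j + 1) : ℝ)) * h +
    (l ^ j * μ - l ^ (j + 1)) * h1 + (k + 1) * l ^ (j + 1) * h2

namespace IsProfile

variable {n : ℕ} {w p : ℝ → ℝ} {t : ℝ} {z : EuclideanSpace ℝ (Fin n)}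

theorem contDiffAt_normal (h : IsProfile w p) {x : Ambient n} (hx : x ∈ regularSet n) :
    ContDiffAt ℝ ∞ (normal n w p) x := by
  have h1 := contDiffAt_angleFun h.periodic_ν₁ h.contDiff_ν₁ hx.2
  have h2 := contDiffAt_angleFun h.periodic_ν₂ h.contDiff_ν₂ hx.2
  have h3 := contDiffAt_angleFun h.periodic_ν₃ h.contDiff_ν₃ hx.2
  have h4 := h1.div (contDiffAt_norm_head hx.1) (norm_ne_zero_iff.2 hx.1)
  have h5 := ((h4.smul (head n).contDiff.contDiffAt).prodMk (h2.prodMk h3))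
  exact ((assemble n).contDiff.contDiffAt.comp x h5).neg

theorem isUnitNormal (h : IsProfile w p) : IsUnitNormal (surface n w) (normal n w p) := by
  refine ⟨⟨regularSet n, isOpen_regularSet n, h.surface_subset_regularSet,
    fun x hx => (h.contDiffAt_normal hx).contDiffWithinAt⟩, ?_⟩
  rintro _ ⟨t, z, hz, rfl⟩
  rw [h.normal_point t hz]
  have hzz : ⟪z, z⟫ = 1 := by rw [real_inner_self_eq_norm_sq, hz, one_pow]
  refine ⟨?_, ?_, ?_⟩
  · rw [norm_neg]
    have h1 : ‖assemble n (ν₁ w p t • z, ν₂ w p t, ν₃ w p t)‖ ^ 2 = 1 := by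
      rw [← real_inner_self_eq_norm_sq, inner_assemble, real_inner_smul_left,
        real_inner_smul_right, hzz]
      linarith [ν_sq w p t]
    nlinarith [norm_nonneg (assemble n (ν₁ w p t • z, ν₂ w p t, ν₃ w p t))]
  · rw [inner_neg_left, point, inner_assemble, real_inner_smul_left, real_inner_smul_right, hzz]
    linarith [ν_y w p t]
  · intro v hv
    induction hv using Submodule.span_induction with
    | mem v hv =>
      obtain ⟨γ, hγ, hγM, hγ0, rfl⟩ := hv
      obtain ⟨c, ζ, hζ, hv⟩ := h.exists_velocity hz hγ hγM hγ0
      rw [hv, inner_neg_left, inner_assemble, real_inner_smul_left, inner_add_right,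
        real_inner_smul_right, real_inner_smul_right, hzz, hζ]
      linear_combination (-c) * ν_z w p t
    | zero => exact inner_zero_right _
    | add x y _ _ hx hy => rw [inner_add_right, hx, hy, add_zero]
    | smul a x _ hx => rw [real_inner_smul_right, hx, mul_zero]

/-- The derivative of the normal field along a curve in the hypersurface. -/
theorem fderiv_normal (h : IsProfile w p) {γ : ℝ → Ambient n} {v v' : Ambient n}
    (hγ : HasDerivAt γ v 0) (hγ0 : γ 0 = point n w t z) (hz : ‖z‖ = 1)
    (hN : HasDerivAt (fun s => normal n w p (γ s)) v' 0) :
    fderiv ℝ (normal n w p) (point n w t z) v = v' := by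
  have hreg : γ 0 ∈ regularSet n := by
    rw [hγ0]; exact h.surface_subset_regularSet ⟨t, z, hz, rfl⟩
  have h1 := ((h.contDiffAt_normal hreg).differentiableAt (by simp)).hasFDerivAt.comp_hasDerivAt
    (0 : ℝ) hγ
  rw [← hγ0]
  exact h1.unique hN

theorem hasDerivAt_assemble {f₁ : ℝ → EuclideanSpace ℝ (Fin n)} {f₂ f₃ : ℝ → ℝ}
    {v₁ : EuclideanSpace ℝ (Fin n)} {v₂ v₃ s : ℝ} (h1 : HasDerivAt f₁ v₁ s)
    (h2 : HasDerivAt f₂ v₂ s) (h3 : HasDerivAt f₃ v₃ s) :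
    HasDerivAt (fun s => assemble n (f₁ s, f₂ s, f₃ s)) (assemble n (v₁, v₂, v₃)) s :=
  (assemble n).hasFDerivAt.comp_hasDerivAt s (h1.prodMk (h2.prodMk h3))

theorem contDiff_assemble {f₁ : ℝ → EuclideanSpace ℝ (Fin n)} {f₂ f₃ : ℝ → ℝ}
    (h1 : ContDiff ℝ ∞ f₁) (h2 : ContDiff ℝ ∞ f₂) (h3 : ContDiff ℝ ∞ f₃) :
    ContDiff ℝ ∞ (fun s => assemble n (f₁ s, f₂ s, f₃ s)) :=
  (assemble n).contDiff.comp (h1.prodMk (h2.prodMk h3))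

theorem norm_cos_add_sin {b : EuclideanSpace ℝ (Fin n)} (hz : ‖z‖ = 1) (hb : ‖b‖ = 1)
    (hzb : ⟪z, b⟫ = 0) (s : ℝ) : ‖Real.cos s • z + Real.sin s • b‖ = 1 := by
  have h1 : ‖Real.cos s • z + Real.sin s • b‖ ^ 2 = 1 := by
    rw [norm_add_sq_real, norm_smul, norm_smul, real_inner_smul_left, real_inner_smul_right, hz, hb,
      hzb, mul_one, mul_one, Real.norm_eq_abs, Real.norm_eq_abs, sq_abs, sq_abs]
    linarith [Real.sin_sq_add_cos_sq s]
  nlinarith [norm_nonneg (Real.cos s • z + Real.sin s • b)]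

theorem hasDerivAt_cos_add_sin (z b : EuclideanSpace ℝ (Fin n)) :
    HasDerivAt (fun s => Real.cos s • z + Real.sin s • b) b 0 := by
  have := ((Real.hasDerivAt_cos 0).smul_const z).fun_add ((Real.hasDerivAt_sin 0).smul_const b)
  simpa using this

/-- The orbit directions are principal. -/
theorem orbit_direction (h : IsProfile w p) (hz : ‖z‖ = 1) {b : EuclideanSpace ℝ (Fin n)}
    (hb : ‖b‖ = 1) (hzb : ⟪z, b⟫ = 0) :
    assemble n (b, 0, 0) ∈ tangentSpace (surface n w) (point n w t z) ∧
    fderiv ℝ (normal n w p) (point n w t z) (assemble n (b, 0, 0)) =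
      -(orbitCurvature (w t) (p t ^ 2) • assemble n (b, 0, 0)) := by
  set γ : ℝ → Ambient n := fun s => point n w t (Real.cos s • z + Real.sin s • b) with hγ
  have hu := norm_cos_add_sin hz hb hzb
  have hγ0 : γ 0 = point n w t z := by simp [hγ]
  have hd : HasDerivAt γ (y₁ w t • assemble n (b, 0, 0)) 0 := by
    have := hasDerivAt_assemble ((hasDerivAt_cos_add_sin z b).const_smul (y₁ w t))
      (hasDerivAt_const (0 : ℝ) (y₂ w t)) (hasDerivAt_const (0 : ℝ) (y₃ w t))
    refine this.congr_deriv ?_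
    rw [← map_smul]
    simp
  have hsm : ContDiff ℝ ∞ γ := by
    have h1 : ContDiff ℝ ∞ fun s => y₁ w t • (Real.cos s • z + Real.sin s • b) := by fun_prop
    exact contDiff_assemble h1 contDiff_const contDiff_const
  have hy := h.y₁_pos t
  have hmem : y₁ w t • assemble n (b, 0, 0) ∈ tangentSpace (surface n w) (point n w t z) :=
    Submodule.subset_span ⟨γ, hsm, fun s => ⟨t, _, hu s, rfl⟩, hγ0, hd.deriv⟩
  have hN : HasDerivAt (fun s => normal n w p (γ s)) (-(ν₁ w p t • assemble n (b, 0, 0))) 0 := by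
    have h1 : (fun s => normal n w p (γ s)) = fun s => -assemble n
        (ν₁ w p t • (Real.cos s • z + Real.sin s • b), ν₂ w p t, ν₃ w p t) :=
      funext fun s => h.normal_point t (hu s)
    rw [h1]
    have := (hasDerivAt_assemble ((hasDerivAt_cos_add_sin z b).const_smul (ν₁ w p t))
      (hasDerivAt_const (0 : ℝ) (ν₂ w p t)) (hasDerivAt_const (0 : ℝ) (ν₃ w p t))).neg
    refine this.congr_deriv ?_
    rw [← map_smul]
    simp
  refine ⟨(Submodule.smul_mem_iff _ hy.ne').1 hmem, ?_⟩
  have h2 := h.fderiv_normal hd hγ0 hz hN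
  rw [map_smul] at h2
  -- The orbit curve has velocity `y₁ b` and its normal has derivative `-ν₁ b`; dividing by `y₁`
  -- leaves `-λ b`.
  have h3 : ν₁ w p t = y₁ w t * orbitCurvature (w t) (p t ^ 2) := orbitCurvature_eq (h.pos t) (p t)
  rw [h3, mul_smul, ← smul_neg] at h2
  exact smul_right_injective _ hy.ne' h2

/-- The direction of the profile curve is principal. -/
theorem profile_direction (h : IsProfile w p) (hz : ‖z‖ = 1) {m : ℕ} {H : ℝ}
    (hs : IsSolution (profileEquation n m H) w p) :
    assemble n (z₁ w p t • z, z₂ w p t, z₃ w p t) ∈ tangentSpace (surface n w) (point n w t z) ∧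
    fderiv ℝ (normal n w p) (point n w t z) (assemble n (z₁ w p t • z, z₂ w p t, z₃ w p t)) =
      -(profileCurvature n m H (w t) (p t ^ 2) •
        assemble n (z₁ w p t • z, z₂ w p t, z₃ w p t)) := by
  set γ : ℝ → Ambient n := fun s => point n w (s + t) z with hγ
  have hγ0 : γ 0 = point n w t z := by simp [hγ]
  have hd : HasDerivAt γ (assemble n (z₁ w p t • z, z₂ w p t, z₃ w p t)) 0 := by
    have e : t = 0 + t := (zero_add t).symm
    have h1 := h.hasDerivAt_y₁ t
    have h2 := h.hasDerivAt_y₂ t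
    have h3 := h.hasDerivAt_y₃ t
    rw [e] at h1 h2 h3
    have h1 := h1.comp_add_const 0 t
    have h2 := h2.comp_add_const 0 t
    have h3 := h3.comp_add_const 0 t
    rw [zero_add] at h1 h2 h3
    exact hasDerivAt_assemble (h1.smul_const z) h2 h3
  have hsm : ContDiff ℝ ∞ γ := by
    have hadd : ContDiff ℝ ∞ (fun s : ℝ => s + t) := contDiff_id.add contDiff_const
    exact contDiff_assemble ((h.contDiff_y₁.comp hadd).smul contDiff_const)
      (h.contDiff_y₂.comp hadd) (h.contDiff_y₃.comp hadd)
  refine ⟨Submodule.subset_span ⟨γ, hsm, fun s => ⟨s + t, z, hz, rfl⟩, hγ0, hd.deriv⟩, ?_⟩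
  refine h.fderiv_normal hd hγ0 hz ?_
  have h1 : (fun s => normal n w p (γ s)) = fun s => -assemble n
      (ν₁ w p (s + t) • z, ν₂ w p (s + t), ν₃ w p (s + t)) :=
    funext fun s => h.normal_point (s + t) hz
  rw [h1]
  have e : t = 0 + t := (zero_add t).symm
  have h2 : HasDerivAt (ν₁ w p) (profileCurvature n m H (w t) (p t ^ 2) * z₁ w p t) t :=
    hasDerivAt_ν₁ (hs t).1 (hs t).2.1 rfl
  have h3 : HasDerivAt (ν₂ w p) (profileCurvature n m H (w t) (p t ^ 2) * z₂ w p t) t :=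
    hasDerivAt_ν₂ (hs t).1 (hs t).2.1 rfl
  have h4 : HasDerivAt (ν₃ w p) (profileCurvature n m H (w t) (p t ^ 2) * z₃ w p t) t :=
    hasDerivAt_ν₃ (hs t).1 (hs t).2.1 rfl
  set μ := profileCurvature n m H (w t) (p t ^ 2)
  rw [show HasDerivAt (ν₁ w p) (μ * z₁ w p t) t ↔ HasDerivAt (ν₁ w p) (μ * z₁ w p t) (0 + t) by
    rw [zero_add]] at h2
  rw [show HasDerivAt (ν₂ w p) (μ * z₂ w p t) t ↔ HasDerivAt (ν₂ w p) (μ * z₂ w p t) (0 + t) by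
    rw [zero_add]] at h3
  rw [show HasDerivAt (ν₃ w p) (μ * z₃ w p t) t ↔ HasDerivAt (ν₃ w p) (μ * z₃ w p t) (0 + t) by
    rw [zero_add]] at h4
  have h5 := (hasDerivAt_assemble ((h2.comp_add_const 0 t).smul_const z) (h3.comp_add_const 0 t)
    (h4.comp_add_const 0 t)).neg
  refine h5.congr_deriv ?_
  rw [← map_smul]
  simp [mul_smul]

theorem norm_velocity (w p : ℝ → ℝ) (t : ℝ) (hz : ‖z‖ = 1) :
    ‖assemble n (z₁ w p t • z, z₂ w p t, z₃ w p t)‖ =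
      √(1 + w t ^ 2 + p t ^ 2) / (1 + w t ^ 2) := by
  have hs := sqrt_pos₂ (w t) (p t)
  have h1 : ‖assemble n (z₁ w p t • z, z₂ w p t, z₃ w p t)‖ ^ 2 =
      (√(1 + w t ^ 2 + p t ^ 2) / (1 + w t ^ 2)) ^ 2 := by
    rw [← z_sq, ← real_inner_self_eq_norm_sq, inner_assemble, real_inner_smul_left,
      real_inner_smul_right, real_inner_self_eq_norm_sq, hz]
    ring
  exact (pow_left_inj₀ (norm_nonneg _) (by positivity) two_ne_zero).1 h1

/-- An orthonormal basis of `ℝⁿ` through `z` gives the eigenbasis: its other vectors are orbit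
directions, and `z` is replaced by the normalized velocity of the profile. -/
theorem arePrincipalCurvatures (h : IsProfile w p) (hz : ‖z‖ = 1) {m : ℕ} {H : ℝ}
    (hs : IsSolution (profileEquation n m H) w p) (i₀ : Fin n) :
    ArePrincipalCurvatures (surface n w) (normal n w p) (point n w t z)
      (fun i => if i = i₀ then profileCurvature n m H (w t) (p t ^ 2)
        else orbitCurvature (w t) (p t ^ 2)) := by
  classical
  set M := surface n w
  set q := point n w t z
  -- an orthonormal basis of `ℝⁿ` that contains `z`
  obtain ⟨b, hb⟩ : ∃ b : OrthonormalBasis (Fin n) ℝ (EuclideanSpace ℝ (Fin n)), b i₀ = z := by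
    have ho : Orthonormal ℝ (({i₀} : Set (Fin n)).domRestrict (fun _ : Fin n => z)) := by
      rw [orthonormal_iff_ite]
      rintro ⟨i, hi⟩ ⟨j, hj⟩
      obtain rfl : i = i₀ := hi
      obtain rfl : j = i := hj
      show ⟪z, z⟫ = _
      simp [hz]
    obtain ⟨b, hb⟩ := ho.exists_orthonormalBasis_extension_of_card_eq (by simp)
    exact ⟨b, hb i₀ rfl⟩
  set τ := assemble n (z₁ w p t • z, z₂ w p t, z₃ w p t) with hτ
  have hτ0 : 0 < ‖τ‖ := by
    rw [hτ, norm_velocity w p t hz]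
    have := sqrt_pos₂ (w t) (p t)
    positivity
  let e : Fin n → Ambient n := fun i => if i = i₀ then ‖τ‖⁻¹ • τ else assemble n (b i, 0, 0)
  have hbz : ∀ i, i ≠ i₀ → ⟪z, b i⟫ = 0 := fun i hi => by
    rw [← hb, b.inner_eq_ite, if_neg hi.symm]
  have hprof := h.profile_direction (t := t) hz hs
  have horb : ∀ i, i ≠ i₀ → _ := fun i hi =>
    h.orbit_direction (t := t) (p := p) hz (b.norm_eq_one i) (hbz i hi)
  have hmem : ∀ i, e i ∈ tangentSpace M q := fun i => by
    by_cases hi : i = i₀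
    · simp only [e, if_pos hi]
      exact Submodule.smul_mem _ _ hprof.1
    · simp only [e, if_neg hi]
      exact (horb i hi).1
  have hτb : ∀ i, i ≠ i₀ → ⟪τ, assemble n (b i, 0, 0)⟫ = 0 := fun i hi => by
    rw [hτ, inner_assemble, real_inner_smul_left, hbz i hi]
    simp
  have hon : Orthonormal ℝ e := by
    rw [orthonormal_iff_ite]
    intro i j
    by_cases hi : i = i₀ <;> by_cases hj : j = i₀
    · simp only [e, hi, hj, if_true, real_inner_self_eq_norm_sq]
      rw [norm_smul, norm_inv, norm_norm, inv_mul_cancel₀ hτ0.ne', one_pow]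
    · simp only [e, if_pos hi, if_neg hj, real_inner_smul_left, hτb j hj, mul_zero]
      rw [if_neg]
      rintro rfl
      exact hj hi
    · simp only [e, if_neg hi, if_pos hj, real_inner_smul_right]
      rw [real_inner_comm, hτb i hi, mul_zero, if_neg]
      rintro rfl
      exact hi hj
    · simp only [e, if_neg hi, if_neg hj]
      rw [inner_assemble, b.inner_eq_ite]
      simp
  -- No further tangent directions exist: by `exists_velocity`, every velocity is a multiple of `τ`
  -- plus an orbit direction orthogonal to `z`.
  have hspan : tangentSpace M q ≤ Submodule.span ℝ (range e) := by
    refine Submodule.span_le.2 ?_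
    rintro _ ⟨γ, hγ, hγM, hγ0, rfl⟩
    obtain ⟨c, ζ, hζ, hv⟩ := h.exists_velocity hz hγ hγM hγ0
    have hτmem : τ ∈ Submodule.span ℝ (range e) := by
      have h1 : ‖τ‖⁻¹ • τ ∈ Submodule.span ℝ (range e) :=
        Submodule.subset_span ⟨i₀, by simp only [e, if_true]⟩
      exact (Submodule.smul_mem_iff _ (inv_ne_zero hτ0.ne')).1 h1
    have hζmem : assemble n (ζ, 0, 0) ∈ Submodule.span ℝ (range e) := by
      have h1 : assemble n (ζ, 0, 0) = ∑ i, ⟪b i, ζ⟫ • assemble n (b i, 0, 0) := by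
        have h2 := b.sum_repr' ζ
        have h3 : (ζ, (0 : ℝ), (0 : ℝ)) = ∑ i, ⟪b i, ζ⟫ • (b i, (0 : ℝ), (0 : ℝ)) := by
          refine Prod.ext ?_ (Prod.ext ?_ ?_)
          · rw [Prod.fst_sum]; exact h2.symm
          · simp [Prod.snd_sum]
          · simp [Prod.snd_sum]
        rw [h3, map_sum]
        simp only [map_smul]
      rw [h1]
      refine Submodule.sum_mem _ fun i _ => ?_
      by_cases hi : i = i₀
      · rw [hi, hb, hζ, zero_smul]
        exact Submodule.zero_mem _
      · exact Submodule.smul_mem _ _ (Submodule.subset_span ⟨i, by simp only [e, if_neg hi]⟩)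
    have : deriv γ 0 = c • τ + y₁ w t • assemble n (ζ, 0, 0) := by
      rw [hv, hτ, ← map_smul, ← map_smul, ← map_add]
      simp [mul_smul]
    rw [this]
    exact Submodule.add_mem _ (Submodule.smul_mem _ _ hτmem) (Submodule.smul_mem _ _ hζmem)
  let e' : Fin n → tangentSpace M q := fun i => ⟨e i, hmem i⟩
  have hon' : Orthonormal ℝ e' := by
    rw [orthonormal_iff_ite] at hon ⊢
    exact hon
  have hsp : ⊤ ≤ Submodule.span ℝ (range e') := by
    rw [← Submodule.map_le_map_iff_of_injective (tangentSpace M q).injective_subtype,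
      Submodule.map_subtype_top, Submodule.map_span, ← range_comp]
    exact hspan
  refine ⟨OrthonormalBasis.mk hon' hsp, fun i => ?_⟩
  rw [OrthonormalBasis.coe_mk]
  show fderiv ℝ (normal n w p) q (e i) = -((if i = i₀ then _ else _) • e i)
  by_cases hi : i = i₀
  · simp only [e, if_pos hi]
    rw [map_smul, hprof.2, smul_neg, smul_comm]
  · simp only [e, if_neg hi]
    exact (horb i hi).2

theorem hasConstantMeanCurvature (h : IsProfile w p) {m : ℕ} {H : ℝ} (hm : 1 ≤ m) (hmn : m < n)
    (hs : IsSolution (profileEquation n m H) w p) :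
    HasConstantMeanCurvature m (surface n w) (normal n w p) H := by
  rintro _ ⟨t, z, hz, rfl⟩
  refine ⟨_, h.arePrincipalCurvatures hz hs ⟨0, by omega⟩, ?_⟩
  exact sum_powersetCard_eq hm hmn.le _ (profileCurvature_eq hm H (h.pos t) (p t))

/-! ### Arc length parametrization -/

/-- The hypersurface is rotational, with a profile curve parametrized by arc length. -/
theorem isRotational (h : IsProfile w p) : IsRotational (surface n w) := by
  let σ : ℝ → ℝ := fun t => √(1 + w t ^ 2 + p t ^ 2) / (1 + w t ^ 2)
  have hσs : ContDiff ℝ ∞ σ := h.contDiff_sqrt₂.div (contDiff_const.add (h.smooth_w.pow 2))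
    fun t => by positivity
  have hσpos : ∀ t, 0 < σ t := fun t => by
    have := sqrt_pos₂ (w t) (p t)
    simp only [σ]
    positivity
  have hσper : Function.Periodic σ (2 * Real.pi) := fun t => by
    simp only [σ, h.periodic, h.periodic_p]
  -- Periodicity gives the speed a positive lower bound, so the arc length is unbounded in both
  -- directions and is a diffeomorphism of the whole line.
  obtain ⟨c, hc, hσc⟩ : ∃ c > 0, ∀ t, c ≤ σ t := by
    obtain ⟨t₀, -, hmin⟩ := isCompact_Icc.exists_isMinOn
      (nonempty_Icc.2 Real.two_pi_pos.le) hσs.continuous.continuousOn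
    refine ⟨σ t₀, hσpos t₀, fun t => ?_⟩
    obtain ⟨s, hs, hst⟩ := hσper.exists_mem_Ico₀ Real.two_pi_pos t
    rw [hst]
    exact hmin (Ico_subset_Icc_self hs)
  let S : ℝ → ℝ := fun t => ∫ s in (0 : ℝ)..t, σ s
  have hS : ∀ t, HasDerivAt S (σ t) t := fun t =>
    intervalIntegral.integral_hasDerivAt_right (hσs.continuous.intervalIntegrable _ _)
      (hσs.continuous.stronglyMeasurableAtFilter _ _) hσs.continuous.continuousAt
  have hSc : Continuous S := continuous_iff_continuousAt.2 fun t => (hS t).continuousAt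
  have hSmono : StrictMono S := strictMono_of_deriv_pos fun t => by
    rw [(hS t).deriv]; exact hσpos t
  have hSmooth : ContDiff ℝ ∞ S := by
    rw [contDiff_infty_iff_deriv]
    refine ⟨fun t => (hS t).differentiableAt, ?_⟩
    rw [show deriv S = σ from funext fun t => (hS t).deriv]
    exact hσs
  have hlin : Monotone fun t => S t - c * t := by
    refine monotone_of_deriv_nonneg (fun t => ?_) fun t => ?_
    · exact ((hS t).sub ((hasDerivAt_id t).const_mul c)).differentiableAt
    · have := (hS t).sub ((hasDerivAt_id t).const_mul c)
      rw [HasDerivAt.deriv (f := fun t => S t - c * t) this]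
      simp only [mul_one, sub_nonneg]
      exact hσc t
  have hS0 : S 0 = 0 := intervalIntegral.integral_same
  have htop : Tendsto S atTop atTop := by
    refine tendsto_atTop_mono' _ ?_ (tendsto_id.const_mul_atTop hc)
    filter_upwards [eventually_ge_atTop 0] with t ht
    have := hlin ht
    simp only [hS0, mul_zero, sub_zero] at this
    simpa using this
  have hbot : Tendsto S atBot atBot := by
    refine tendsto_atBot_mono' _ ?_ (tendsto_id.const_mul_atBot hc)
    filter_upwards [eventually_le_atBot 0] with t ht
    have := hlin ht
    simp only [hS0, mul_zero, sub_zero] at this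
    simpa using this
  have hsurj : Function.Surjective S := hSc.surjective htop hbot
  let Φ : ℝ ≃ₜ ℝ := (hSmono.orderIsoOfSurjective S hsurj).toHomeomorph
  have hΦ : ⇑Φ = S := rfl
  have hinv : ContDiff ℝ ∞ Φ.symm :=
    Φ.contDiff_symm_deriv (f' := σ) (fun t => (hσpos t).ne') hS hSmooth
  have hinvd : ∀ s, HasDerivAt Φ.symm (σ (Φ.symm s))⁻¹ s := fun s =>
    HasDerivAt.of_local_left_inverse Φ.symm.continuous.continuousAt (hS _) (hσpos _).ne'
      (Eventually.of_forall fun s => Φ.apply_symm_apply s)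
  refine ⟨y₁ w ∘ Φ.symm, y₂ w ∘ Φ.symm, y₃ w ∘ Φ.symm, h.contDiff_y₁.comp hinv,
    h.contDiff_y₂.comp hinv, h.contDiff_y₃.comp hinv, fun s => h.y₁_pos _, fun s => y_sq w _,
    fun s => ?_, ?_⟩
  · rw [((h.hasDerivAt_y₁ _).comp s (hinvd s)).deriv, ((h.hasDerivAt_y₂ _).comp s (hinvd s)).deriv,
      ((h.hasDerivAt_y₃ _).comp s (hinvd s)).deriv]
    have h1 : z₁ w p (Φ.symm s) ^ 2 + z₂ w p (Φ.symm s) ^ 2 + z₃ w p (Φ.symm s) ^ 2 =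
      σ (Φ.symm s) ^ 2 := z_sq w p (Φ.symm s)
    have h2 := hσpos (Φ.symm s)
    field_simp
    exact h1
  · ext x
    constructor
    · rintro ⟨t, z, hz, rfl⟩
      refine ⟨Φ t, z, hz, fun i => ?_, ?_, ?_⟩ <;> simp [point]
    · rintro ⟨s, z, hz, h1, h2, h3⟩
      refine ⟨Φ.symm s, z, hz, ambient_ext ?_ ?_⟩
      · ext i
        simp [point, h1]
      · apply Complex.ext <;> simp [point, h2, h3]

end IsProfile

/-! ### Gauss's equation and the sign of the curvature -/

section DirectionalDerivatives

theorem two_le_smooth : (2 : WithTop ℕ∞) ≤ ∞ :=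
  WithTop.coe_le_coe.2 (le_top : (2 : ℕ∞) ≤ ⊤)

variable {P E : Type*} [NormedAddCommGroup P] [NormedSpace ℝ P]
  [NormedAddCommGroup E] [InnerProductSpace ℝ E]

/-- The derivative of `F` in the constant direction `d`. -/
noncomputable def dirDeriv {E : Type*} [NormedAddCommGroup E] [NormedSpace ℝ E] (d : P) (F : P → E)
    (x : P) : E := fderiv ℝ F x d

theorem dirDeriv_eq {E : Type*} [NormedAddCommGroup E] [NormedSpace ℝ E] {F : P → E}
    (hF : ContDiff ℝ ∞ F) {x d : P} {v : E} (h : HasDerivAt (fun s : ℝ => F (x + s • d)) v 0) :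
    dirDeriv d F x = v := by
  have h1 : HasDerivAt (fun s : ℝ => x + s • d) d 0 := by
    simpa using ((hasDerivAt_id (0 : ℝ)).smul_const d).const_add x
  have h2 : HasFDerivAt F (fderiv ℝ F x) (x + (0 : ℝ) • d) := by
    rw [zero_smul, add_zero]
    exact (hF.differentiable (by simp) x).hasFDerivAt
  exact (h2.comp_hasDerivAt (0 : ℝ) h1).unique h

theorem contDiff_dirDeriv {E : Type*} [NormedAddCommGroup E] [NormedSpace ℝ E] {F : P → E}
    (hF : ContDiff ℝ ∞ F) (d : P) : ContDiff ℝ ∞ (dirDeriv d F) :=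
  (hF.fderiv_right (m := ∞) (by simp)).clm_apply contDiff_const

theorem dirDeriv_comm {E : Type*} [NormedAddCommGroup E] [NormedSpace ℝ E] {F : P → E}
    (hF : ContDiff ℝ ∞ F) (a b : P) : dirDeriv a (dirDeriv b F) = dirDeriv b (dirDeriv a F) := by
  funext x
  have h1 : DifferentiableAt ℝ (fderiv ℝ F) x :=
    (hF.fderiv_right (m := ∞) (by simp)).differentiable (by simp) x
  have h2 : ∀ c d : P, dirDeriv c (dirDeriv d F) x = fderiv ℝ (fderiv ℝ F) x c d := by
    intro c d
    have := fderiv_clm_apply h1 (differentiableAt_const d)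
    unfold dirDeriv
    rw [this]
    simp
  rw [h2, h2]
  exact (hF.contDiffAt.isSymmSndFDerivAt (by simpa using two_le_smooth)) a b

theorem dirDeriv_inner {F G : P → E} (hF : ContDiff ℝ ∞ F) (hG : ContDiff ℝ ∞ G) (d : P) :
    dirDeriv d (fun x => ⟪F x, G x⟫) =
      fun x => ⟪F x, dirDeriv d G x⟫ + ⟪dirDeriv d F x, G x⟫ := by
  funext x
  exact fderiv_inner_apply ℝ (hF.differentiable (by simp) x) (hG.differentiable (by simp) x) d

/-- Koszul's formula in a coordinate system. -/
theorem koszul {F : P → E} (hF : ContDiff ℝ ∞ F) (a b c x : P) :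
    2 * ⟪dirDeriv a (dirDeriv b F) x, dirDeriv c F x⟫ =
      dirDeriv a (fun x => ⟪dirDeriv b F x, dirDeriv c F x⟫) x +
      dirDeriv b (fun x => ⟪dirDeriv a F x, dirDeriv c F x⟫) x -
      dirDeriv c (fun x => ⟪dirDeriv a F x, dirDeriv b F x⟫) x := by
  have ha := contDiff_dirDeriv hF a
  have hb := contDiff_dirDeriv hF b
  have hc := contDiff_dirDeriv hF c
  rw [dirDeriv_inner hb hc, dirDeriv_inner ha hc, dirDeriv_inner ha hb, dirDeriv_comm hF c b,
    dirDeriv_comm hF c a, dirDeriv_comm hF b a]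
  simp only []
  have := real_inner_comm (dirDeriv a (dirDeriv c F) x) (dirDeriv b F x)
  linarith

/-- Gauss's equation in flat space: the curvature term depends only on the metric. -/
theorem gauss_equation {F : P → E} (hF : ContDiff ℝ ∞ F) (a b x : P) :
    ⟪dirDeriv a (dirDeriv a F) x, dirDeriv b (dirDeriv b F) x⟫ -
      ⟪dirDeriv a (dirDeriv b F) x, dirDeriv a (dirDeriv b F) x⟫ =
    dirDeriv a (dirDeriv b fun x => ⟪dirDeriv a F x, dirDeriv b F x⟫) x -
      dirDeriv b (dirDeriv b fun x => ⟪dirDeriv a F x, dirDeriv a F x⟫) x / 2 -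
      dirDeriv a (dirDeriv a fun x => ⟪dirDeriv b F x, dirDeriv b F x⟫) x / 2 := by
  have ha := contDiff_dirDeriv hF a
  have hb := contDiff_dirDeriv hF b
  have haa := contDiff_dirDeriv ha a
  have hab := contDiff_dirDeriv hb a
  have hbb := contDiff_dirDeriv hb b
  have e1 : ∀ {f g : P → ℝ}, ContDiff ℝ ∞ f → ContDiff ℝ ∞ g → ∀ d,
      dirDeriv d (fun x => f x + g x) x = dirDeriv d f x + dirDeriv d g x := by
    intro f g hf hg d
    unfold dirDeriv
    rw [fderiv_fun_add (hf.differentiable (by simp) x) (hg.differentiable (by simp) x)]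
    rfl
  have hba : dirDeriv b (dirDeriv a F) = dirDeriv a (dirDeriv b F) := dirDeriv_comm hF b a
  -- By symmetry of the derivatives, the third order terms of the three metric coefficients cancel.
  have haab : dirDeriv a (dirDeriv a (dirDeriv b F)) = dirDeriv b (dirDeriv a (dirDeriv a F)) := by
    rw [dirDeriv_comm hF a b, dirDeriv_comm ha a b]
  have habb : dirDeriv b (dirDeriv a (dirDeriv b F)) = dirDeriv a (dirDeriv b (dirDeriv b F)) :=
    dirDeriv_comm hb b a
  rw [dirDeriv_inner ha hb, dirDeriv_inner ha ha, dirDeriv_inner hb hb, hba,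
    e1 (ha.inner ℝ hbb) (hab.inner ℝ hb), e1 (ha.inner ℝ hab) (hab.inner ℝ ha),
    e1 (hb.inner ℝ hab) (hab.inner ℝ hb), dirDeriv_inner ha hbb, dirDeriv_inner hab hb,
    dirDeriv_inner ha hab, dirDeriv_inner hab ha, dirDeriv_inner hb hab, hba, habb, haab]
  simp only []
  have c1 := real_inner_comm (dirDeriv a F x) (dirDeriv a (dirDeriv b (dirDeriv b F)) x)
  have c2 := real_inner_comm (dirDeriv b F x) (dirDeriv b (dirDeriv a (dirDeriv a F)) x)
  have c3 := real_inner_comm (dirDeriv a (dirDeriv a F) x) (dirDeriv b (dirDeriv b F) x)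
  linarith

/-- The Gauss curvature term of a submanifold of codimension two whose second fundamental form is a
combination of positive semidefinite forms in orthogonal directions is nonnegative. -/
theorem curvature_nonneg [FiniteDimensional ℝ P] [FiniteDimensional ℝ E] {F : P → E} {a b x : P}
    {N : Fin 2 → E} (hN : Orthonormal ℝ N) {A : Fin 2 → E →L[ℝ] E} {c : Fin 2 → ℝ}
    (hA : ∀ i u v, ⟪A i u, v⟫ ^ 2 ≤ ⟪A i u, u⟫ * ⟪A i v, v⟫)
    (htan : ∀ i d, ⟪N i, dirDeriv d F x⟫ = 0)
    (hsec : ∀ i d d', ⟪N i, dirDeriv d (dirDeriv d' F) x⟫ =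
      -(c i * ⟪A i (dirDeriv d F x), dirDeriv d' F x⟫))
    (hrank : Module.finrank ℝ (LinearMap.range (fderiv ℝ F x).toLinearMap) + 2 =
      Module.finrank ℝ E)
    (haa : ∀ d, ⟪dirDeriv a (dirDeriv a F) x, dirDeriv d F x⟫ = 0)
    (hab : ∀ d, ⟪dirDeriv a (dirDeriv b F) x, dirDeriv d F x⟫ = 0) :
    0 ≤ ⟪dirDeriv a (dirDeriv a F) x, dirDeriv b (dirDeriv b F) x⟫ -
      ⟪dirDeriv a (dirDeriv b F) x, dirDeriv a (dirDeriv b F) x⟫ := by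
  set T := LinearMap.range (fderiv ℝ F x).toLinearMap
  -- The two normals span the normal space because the rank of `F` leaves codimension two.
  have hspan : Submodule.span ℝ (range N) = Tᗮ := by
    refine Submodule.eq_of_le_of_finrank_eq ?_ ?_
    · rw [Submodule.span_le]
      rintro _ ⟨i, rfl⟩
      rw [SetLike.mem_coe, Submodule.mem_orthogonal]
      rintro _ ⟨d, rfl⟩
      rw [real_inner_comm]
      exact htan i d
    · have h1 := Submodule.finrank_add_finrank_orthogonal T
      rw [finrank_span_eq_card hN.linearIndependent, Fintype.card_fin]
      omega
  have hexp : ∀ v ∈ Tᗮ, v = ⟪N 0, v⟫ • N 0 + ⟪N 1, v⟫ • N 1 := by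
    intro v hv
    rw [← hspan] at hv
    obtain ⟨k, rfl⟩ := (Submodule.mem_span_range_iff_exists_fun ℝ).1 hv
    have h1 : ∀ i, ⟪N i, ∑ j, k j • N j⟫ = k i := fun i => hN.inner_right_fintype k i
    rw [h1, h1, Fin.sum_univ_two]
  have horth : ∀ v, (∀ d, ⟪v, dirDeriv d F x⟫ = 0) → v ∈ Tᗮ := by
    intro v hv
    rw [Submodule.mem_orthogonal']
    rintro _ ⟨d, rfl⟩
    exact hv d
  -- Only one factor of each product has to be normal, so nothing is required of the tangential part
  -- of the second derivative along `b`. The curvature term becomes the sum of `c i ^ 2` times the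
  -- Cauchy–Schwarz defects of the forms `A i`.
  have hin : ∀ v ∈ Tᗮ, ∀ u, ⟪v, u⟫ = ⟪N 0, v⟫ * ⟪N 0, u⟫ + ⟪N 1, v⟫ * ⟪N 1, u⟫ := by
    intro v hv u
    conv_lhs => rw [hexp v hv]
    rw [inner_add_left, real_inner_smul_left, real_inner_smul_left]
  rw [hin _ (horth _ haa), hin _ (horth _ hab)]
  simp only [hsec]
  have h0 := mul_le_mul_of_nonneg_left (hA 0 (dirDeriv a F x) (dirDeriv b F x)) (sq_nonneg (c 0))
  have h1 := mul_le_mul_of_nonneg_left (hA 1 (dirDeriv a F x) (dirDeriv b F x)) (sq_nonneg (c 1))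
  nlinarith

end DirectionalDerivatives

/-! ### Nonnegative curvature of round spheres and Clifford hypersurfaces -/

section Blocks

variable {n : ℕ} {P : Type*} [NormedAddCommGroup P] [NormedSpace ℝ P]

/-- The orthogonal projection onto the coordinates in `S`. -/
noncomputable def blockProj (S : Finset (Fin (n + 2))) : Ambient n →L[ℝ] Ambient n :=
  LinearMap.toContinuousLinearMap
    { toFun := fun x => WithLp.toLp 2 fun i => if i ∈ S then x i else 0
      map_add' := fun x y => by ext i; by_cases h : i ∈ S <;> simp [h]
      map_smul' := fun c x => by ext i; by_cases h : i ∈ S <;> simp [h] }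

theorem blockProj_apply (S : Finset (Fin (n + 2))) (x : Ambient n) (i : Fin (n + 2)) :
    blockProj S x i = if i ∈ S then x i else 0 := rfl

theorem inner_blockProj (S : Finset (Fin (n + 2))) (x y : Ambient n) :
    ⟪blockProj S x, y⟫ = ∑ i ∈ S, x i * y i := by
  simp only [PiLp.inner_apply, blockProj_apply, RCLike.inner_apply, conj_trivial]
  rw [← Finset.sum_filter_add_sum_filter_not Finset.univ (· ∈ S)]
  rw [Finset.sum_eq_zero (s := Finset.univ.filter fun i => ¬ i ∈ S), add_zero]
  · rw [Finset.filter_mem_eq_inter, Finset.univ_inter]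
    exact Finset.sum_congr rfl fun i hi => by rw [if_pos hi, mul_comm]
  · intro i hi
    rw [if_neg (Finset.mem_filter.1 hi).2, mul_zero]

theorem inner_blockProj_sq_le (S : Finset (Fin (n + 2))) (x y : Ambient n) :
    ⟪blockProj S x, y⟫ ^ 2 ≤ ⟪blockProj S x, x⟫ * ⟪blockProj S y, y⟫ := by
  simp only [inner_blockProj, ← sq]
  exact Finset.sum_mul_sq_le_sq_mul_sq S _ _

theorem inner_blockProj_comm (S : Finset (Fin (n + 2))) (x y : Ambient n) :
    ⟪blockProj S x, y⟫ = ⟪blockProj S y, x⟫ := by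
  simp only [inner_blockProj]
  exact Finset.sum_congr rfl fun i _ => mul_comm _ _

theorem inner_blockProj_blockProj (S T : Finset (Fin (n + 2))) (x y : Ambient n) :
    ⟪blockProj S x, blockProj T y⟫ = ∑ i ∈ S ∩ T, x i * y i := by
  rw [inner_blockProj, ← Finset.sum_filter_add_sum_filter_not S (· ∈ T),
    Finset.sum_eq_zero (s := S.filter fun i => ¬ i ∈ T), add_zero, Finset.filter_mem_eq_inter]
  · exact Finset.sum_congr rfl fun i hi => by
      rw [blockProj_apply, if_pos (Finset.mem_inter.1 hi).2]
  · intro i hi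
    rw [blockProj_apply, if_neg (Finset.mem_filter.1 hi).2, mul_zero]

/-- The normal direction defined by a block of coordinates on which the norm is constant. -/
theorem block_constraint {F : P → Ambient n} (hF : ContDiff ℝ ∞ F) (S : Finset (Fin (n + 2)))
    {k : ℝ} (hk : ∀ x, ∑ i ∈ S, F x i ^ 2 = k) (x : P) :
    (∀ d, ⟪blockProj S (F x), dirDeriv d F x⟫ = 0) ∧
    ∀ d d', ⟪blockProj S (F x), dirDeriv d (dirDeriv d' F) x⟫ =
      -⟪blockProj S (dirDeriv d F x), dirDeriv d' F x⟫ := by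
  have hB : ∀ {G : P → Ambient n}, ContDiff ℝ ∞ G → ContDiff ℝ ∞ fun x => blockProj S (G x) :=
    fun hG => (blockProj S).contDiff.comp hG
  have hBd : ∀ d x, dirDeriv d (fun x => blockProj S (F x)) x = blockProj S (dirDeriv d F x) := by
    intro d x
    unfold dirDeriv
    have := ((blockProj S).hasFDerivAt.comp x (hF.differentiable (by simp) x).hasFDerivAt).fderiv
    exact DFunLike.congr_fun this d
  have h1 : ∀ d x, ⟪blockProj S (F x), dirDeriv d F x⟫ = 0 := by
    intro d x
    have h2 : (fun x => ⟪blockProj S (F x), F x⟫) = fun _ => k := by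
      funext x
      rw [inner_blockProj, ← hk x]
      exact Finset.sum_congr rfl fun i _ => (sq _).symm
    have h3 := congrFun (dirDeriv_inner (hB hF) hF d) x
    rw [h2, hBd, inner_blockProj_comm S (dirDeriv d F x)] at h3
    have h4 : dirDeriv d (fun _ : P => k) x = 0 := by
      unfold dirDeriv
      rw [fderiv_fun_const]
      rfl
    linarith
  refine ⟨fun d => h1 d x, fun d d' => ?_⟩
  have h2 : (fun x => ⟪blockProj S (F x), dirDeriv d' F x⟫) = fun _ => 0 := funext fun x => h1 d' x
  have h3 := congrFun (dirDeriv_inner (hB hF) (contDiff_dirDeriv hF d') d) x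
  rw [h2, hBd] at h3
  have h4 : dirDeriv d (fun _ : P => (0 : ℝ)) x = 0 := by
    unfold dirDeriv
    rw [fderiv_fun_const]
    rfl
  linarith

/-- Submanifolds of the sphere of the two kinds that are excluded have nonnegative curvature. -/
theorem curvature_nonneg_of_blocks [FiniteDimensional ℝ P] {F : P → Ambient n}
    (hF : ContDiff ℝ ∞ F) {a b x : P}
    {S T : Finset (Fin (n + 2))} (hST : Disjoint S T) {r : ℝ} (hr : 0 < r)
    (hS : ∀ x, ∑ i ∈ S, F x i ^ 2 = r ^ 2)
    (hT : (∃ s : ℝ, 0 < s ∧ ∀ x, ∑ i ∈ T, F x i ^ 2 = s ^ 2) ∨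
      ∃ (i : Fin (n + 2)) (k : ℝ), T = {i} ∧ ∀ x, F x i = k)
    (hrank : Module.finrank ℝ (LinearMap.range (fderiv ℝ F x).toLinearMap) = n)
    (haa : ∀ d, ⟪dirDeriv a (dirDeriv a F) x, dirDeriv d F x⟫ = 0)
    (hab : ∀ d, ⟪dirDeriv a (dirDeriv b F) x, dirDeriv d F x⟫ = 0) :
    0 ≤ ⟪dirDeriv a (dirDeriv a F) x, dirDeriv b (dirDeriv b F) x⟫ -
      ⟪dirDeriv a (dirDeriv b F) x, dirDeriv a (dirDeriv b F) x⟫ := by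
  have hrank' : Module.finrank ℝ (LinearMap.range (fderiv ℝ F x).toLinearMap) + 2 =
      Module.finrank ℝ (Ambient n) := by
    rw [hrank, finrank_euclideanSpace_fin]
  have hnorm : ∀ (S : Finset (Fin (n + 2))) {r : ℝ}, 0 < r → (∑ i ∈ S, F x i ^ 2 = r ^ 2) →
      ⟪r⁻¹ • blockProj S (F x), r⁻¹ • blockProj S (F x)⟫ = 1 := by
    intro S r hr hS
    rw [real_inner_smul_left, real_inner_smul_right, inner_blockProj_blockProj, Finset.inter_self]
    simp only [← sq]
    rw [hS]
    field_simp
  obtain ⟨h1, h2⟩ := block_constraint hF S hS x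
  rcases hT with ⟨s, hs, hT⟩ | ⟨i, k, rfl, hT⟩
  · obtain ⟨h3, h4⟩ := block_constraint hF T hT x
    have hon : Orthonormal ℝ ![r⁻¹ • blockProj S (F x), s⁻¹ • blockProj T (F x)] := by
      have h5 : ⟪r⁻¹ • blockProj S (F x), s⁻¹ • blockProj T (F x)⟫ = 0 := by
        rw [real_inner_smul_left, real_inner_smul_right, inner_blockProj_blockProj,
          Finset.disjoint_iff_inter_eq_empty.1 hST]
        simp
      rw [orthonormal_iff_ite]
      intro i j
      fin_cases i <;> fin_cases j
      · exact hnorm S hr (hS x)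
      · exact h5
      · exact (real_inner_comm _ _).trans h5
      · exact hnorm T hs (hT x)
    refine curvature_nonneg hon (A := ![blockProj S, blockProj T]) (c := ![r⁻¹, s⁻¹])
      ?_ ?_ ?_ hrank' haa hab
    · intro i u v
      fin_cases i
      · exact inner_blockProj_sq_le S u v
      · exact inner_blockProj_sq_le T u v
    · intro i d
      fin_cases i
      · show ⟪r⁻¹ • blockProj S (F x), _⟫ = 0
        rw [real_inner_smul_left, h1, mul_zero]
      · show ⟪s⁻¹ • blockProj T (F x), _⟫ = 0
        rw [real_inner_smul_left, h3, mul_zero]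
    · intro i d d'
      fin_cases i
      · show ⟪r⁻¹ • blockProj S (F x), _⟫ = -(r⁻¹ * ⟪blockProj S _, _⟫)
        rw [real_inner_smul_left, h2, mul_neg]
      · show ⟪s⁻¹ • blockProj T (F x), _⟫ = -(s⁻¹ * ⟪blockProj T _, _⟫)
        rw [real_inner_smul_left, h4, mul_neg]
  · set e : Ambient n := EuclideanSpace.single i 1 with he
    have hin : ∀ v : Ambient n, ⟪e, v⟫ = v i := fun v => by
      rw [he, EuclideanSpace.inner_single_left]
      simp
    have hcoord : ∀ {G : P → Ambient n}, ContDiff ℝ ∞ G → (∃ k, ∀ x, G x i = k) → ∀ d x,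
        dirDeriv d G x i = 0 := by
      rintro G hG ⟨k, hk⟩ d x
      have h3 := congrFun (dirDeriv_inner (F := fun _ : P => e) contDiff_const hG d) x
      have h4 : (fun x => ⟪e, G x⟫) = fun _ => k := funext fun x => (hin _).trans (hk x)
      rw [h4] at h3
      simp only [dirDeriv, fderiv_fun_const, Pi.zero_apply, zero_apply,
        inner_zero_left, add_zero] at h3
      rw [← hin]
      exact h3.symm
    have hi1 : ∀ d x, dirDeriv d F x i = 0 := hcoord hF ⟨k, hT⟩
    have hon : Orthonormal ℝ ![r⁻¹ • blockProj S (F x), e] := by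
      have h5 : ⟪e, r⁻¹ • blockProj S (F x)⟫ = 0 := by
        rw [hin, PiLp.smul_apply, blockProj_apply,
          if_neg (Finset.disjoint_singleton_right.1 hST), smul_zero]
      rw [orthonormal_iff_ite]
      intro i j
      fin_cases i <;> fin_cases j
      · exact hnorm S hr (hS x)
      · exact (real_inner_comm _ _).trans h5
      · exact h5
      · show ⟪e, e⟫ = 1
        rw [hin, he]
        simp
    refine curvature_nonneg hon (A := ![blockProj S, blockProj S]) (c := ![r⁻¹, 0])
      ?_ ?_ ?_ hrank' haa hab
    · intro i u v
      fin_cases i <;> exact inner_blockProj_sq_le S u v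
    · intro j d
      fin_cases j
      · show ⟪r⁻¹ • blockProj S (F x), _⟫ = 0
        rw [real_inner_smul_left, h1, mul_zero]
      · exact (hin _).trans (hi1 d x)
    · intro j d d'
      fin_cases j
      · show ⟪r⁻¹ • blockProj S (F x), _⟫ = -(r⁻¹ * ⟪blockProj S _, _⟫)
        rw [real_inner_smul_left, h2, mul_neg]
      · show ⟪e, _⟫ = -(0 * _)
        rw [zero_mul, neg_zero, hin]
        exact hcoord (contDiff_dirDeriv hF d') ⟨0, hi1 d'⟩ d x

end Blocks

/-! ### Negative curvature at a waist of a warped product -/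

section WarpedProduct

variable {Q W E : Type*} [NormedAddCommGroup Q] [NormedSpace ℝ Q]
  [NormedAddCommGroup W] [InnerProductSpace ℝ W] [NormedAddCommGroup E] [InnerProductSpace ℝ E]

theorem dirDeriv_comp_fst {g : ℝ → ℝ} (hg : ContDiff ℝ ∞ g) (d x : ℝ × Q) :
    dirDeriv d (fun x : ℝ × Q => g x.1) x = d.1 * deriv g x.1 := by
  refine dirDeriv_eq (hg.comp contDiff_fst) ?_
  have h1 : HasDerivAt (fun s : ℝ => x.1 + s * d.1) d.1 0 := by
    simpa using ((hasDerivAt_id (0 : ℝ)).mul_const d.1).const_add x.1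
  have h2 : HasDerivAt g (deriv g x.1) (x.1 + 0 * d.1) := by
    rw [zero_mul, add_zero]
    exact (hg.differentiable (by simp) _).hasDerivAt
  rw [mul_comm]
  exact h2.comp (0 : ℝ) h1

theorem dirDeriv_one_zero {f : ℝ → ℝ} {ψ : Q → ℝ} (hf : ContDiff ℝ ∞ f) (hψ : ContDiff ℝ ∞ ψ) :
    dirDeriv ((1 : ℝ), (0 : Q)) (fun x : ℝ × Q => f x.1 * ψ x.2) =
      fun x => deriv f x.1 * ψ x.2 := by
  funext x
  refine dirDeriv_eq ((hf.comp contDiff_fst).mul (hψ.comp contDiff_snd)) ?_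
  have h1 : HasDerivAt (fun s : ℝ => x.1 + s) 1 0 := (hasDerivAt_id (0 : ℝ)).const_add x.1
  have h2 : HasDerivAt f (deriv f x.1) (x.1 + 0) := by
    rw [add_zero]
    exact (hf.differentiable (by simp) _).hasDerivAt
  have h3 := (h2.comp (0 : ℝ) h1).mul_const (ψ x.2)
  simpa [Function.comp_def] using h3

theorem dirDeriv_zero_fun (d : Q) : dirDeriv d (fun _ : Q => (0 : ℝ)) = fun _ => 0 := by
  funext x
  simp [dirDeriv]

theorem dirDeriv_zero (F : Q → W) (x : Q) : dirDeriv 0 F x = 0 := map_zero _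

/-- An isometric immersion of a warped product is, at a waist of the warping function, negatively
curved, with second derivatives along the base and mixed ones normal. -/
theorem warped_product_waist [FiniteDimensional ℝ Q] {F : ℝ × Q → E} {u : Q → W} {e f : ℝ → ℝ}
    (hF : ContDiff ℝ ∞ F) (hu : ContDiff ℝ ∞ u) (he : ContDiff ℝ ∞ e) (hf : ContDiff ℝ ∞ f)
    (hG : ∀ b c x, ⟪dirDeriv b F x, dirDeriv c F x⟫ = b.1 * c.1 * e x.1 +
      f x.1 * ⟪dirDeriv b.2 u x.2, dirDeriv c.2 u x.2⟫)
    (he₀ : 0 < e 0) (he₁ : deriv e 0 = 0) (hf₀ : 0 < f 0) (hf₁ : deriv f 0 = 0)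
    (hf₂ : 0 < deriv (deriv f) 0) (hinj : ∀ η, dirDeriv η u 0 = 0 → η = 0) {τ : Q} (hτ : τ ≠ 0) :
    Module.finrank ℝ (LinearMap.range (fderiv ℝ F 0).toLinearMap) = Module.finrank ℝ Q + 1 ∧
    (∀ d, ⟪dirDeriv (1, 0) (dirDeriv (1, 0) F) 0, dirDeriv d F 0⟫ = 0) ∧
    (∀ d, ⟪dirDeriv (1, 0) (dirDeriv (0, τ) F) 0, dirDeriv d F 0⟫ = 0) ∧
    ⟪dirDeriv (1, 0) (dirDeriv (1, 0) F) 0, dirDeriv (0, τ) (dirDeriv (0, τ) F) 0⟫ -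
      ⟪dirDeriv (1, 0) (dirDeriv (0, τ) F) 0, dirDeriv (1, 0) (dirDeriv (0, τ) F) 0⟫ < 0 := by
  have hψ : ∀ η ζ, ContDiff ℝ ∞ fun x => ⟪dirDeriv η u x, dirDeriv ζ u x⟫ := fun η ζ =>
    (contDiff_dirDeriv hu η).inner ℝ (contDiff_dirDeriv hu ζ)
  have hf' : ContDiff ℝ ∞ (deriv f) := (contDiff_infty_iff_deriv.1 hf).2
  have g1 : ∀ c : ℝ × Q, (fun x => ⟪dirDeriv (1, 0) F x, dirDeriv c F x⟫) =
      fun x : ℝ × Q => c.1 * e x.1 := by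
    intro c
    funext x
    rw [hG]
    simp [dirDeriv_zero]
  have g2 : ∀ c : ℝ × Q, (fun x => ⟪dirDeriv (0, τ) F x, dirDeriv c F x⟫) =
      fun x : ℝ × Q => f x.1 * ⟪dirDeriv τ u x.2, dirDeriv c.2 u x.2⟫ := by
    intro c
    funext x
    rw [hG]
    simp
  have g3 : ∀ (k : ℝ) (d x : ℝ × Q), dirDeriv d (fun x : ℝ × Q => k * e x.1) x =
      d.1 * (k * deriv e x.1) := by
    intro k d x
    rw [dirDeriv_comp_fst (g := fun t => k * e t) (contDiff_const.mul he), deriv_const_mul_field]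
  have g4 : (fun x : ℝ × Q => (0 : ℝ) * e x.1) = fun _ => 0 := by simp
  have g5 : ∀ k : ℝ, dirDeriv ((0 : ℝ), τ) (fun x : ℝ × Q => k * e x.1) = fun _ => 0 := by
    intro k
    funext x
    rw [g3, zero_mul]
  refine ⟨?_, ?_, ?_, ?_⟩
  · rw [LinearMap.finrank_range_of_inj, Module.finrank_prod, Module.finrank_self, add_comm]
    rw [← LinearMap.ker_eq_bot, LinearMap.ker_eq_bot']
    intro d hd
    have hd' : dirDeriv d F 0 = 0 := hd
    have h1 := hG d d 0
    rw [hd', inner_zero_left, real_inner_self_eq_norm_sq] at h1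
    simp only [Prod.fst_zero, Prod.snd_zero] at h1
    have h2 : 0 ≤ d.1 * d.1 * e 0 := mul_nonneg (mul_self_nonneg _) he₀.le
    have h3 : 0 ≤ f 0 * ‖dirDeriv d.2 u 0‖ ^ 2 := mul_nonneg hf₀.le (sq_nonneg _)
    have h4 : d.1 * d.1 * e 0 = 0 := by linarith
    have h5 : f 0 * ‖dirDeriv d.2 u 0‖ ^ 2 = 0 := by linarith
    refine Prod.ext ?_ (hinj _ ?_)
    · simpa [he₀.ne'] using h4
    · simpa [hf₀.ne'] using h5
  · intro d
    -- Koszul's formula expresses the tangential parts of these second derivatives by `e'` and `f'`,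
    -- which vanish at the waist.
    have h1 := koszul hF ((1 : ℝ), (0 : Q)) (1, 0) d 0
    rw [g1, g1, g3, g3] at h1
    simp only [Prod.fst_zero, he₁] at h1
    linarith
  · intro d
    have h1 := koszul hF ((1 : ℝ), (0 : Q)) (0, τ) d 0
    rw [g1, g1, g2, g3, g3, dirDeriv_one_zero hf (hψ _ _)] at h1
    simp only [Prod.fst_zero, he₁, hf₁] at h1
    linarith
  -- The first two terms of Gauss's equation vanish, as the mixed coefficient is zero and `e` does
  -- not depend on the orbit variable. What remains is `-f'' ‖dirDeriv τ u 0‖² / 2`.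
  · rw [gauss_equation hF, g1, g1, g2, dirDeriv_one_zero hf (hψ _ _),
      dirDeriv_one_zero hf' (hψ _ _), g4, g5, dirDeriv_zero_fun,
      dirDeriv_zero_fun]
    simp only [Prod.fst_zero, Prod.snd_zero, real_inner_self_eq_norm_sq, zero_div]
    have h1 : dirDeriv τ u 0 ≠ 0 := fun h => hτ (hinj τ h)
    have h2 : 0 < deriv (deriv f) 0 * ‖dirDeriv τ u 0‖ ^ 2 :=
      mul_pos hf₂ (pow_pos (norm_pos_iff.2 h1) 2)
    linarith

end WarpedProduct

section SphereChart

variable {W : Type*} [NormedAddCommGroup W] [InnerProductSpace ℝ W]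

/-- The central projection of the tangent space of the unit sphere at `e`. -/
noncomputable def centralProj (e : W) (ζ : (ℝ ∙ e)ᗮ) : W := (√(1 + ‖ζ‖ ^ 2))⁻¹ • (e + ζ)

theorem contDiff_centralProj (e : W) : ContDiff ℝ ∞ (centralProj e) := by
  have h1 : ContDiff ℝ ∞ fun ζ : (ℝ ∙ e)ᗮ => √(1 + ‖ζ‖ ^ 2) :=
    (contDiff_const.add (contDiff_norm_sq ℝ)).sqrt fun _ => by positivity
  exact (h1.inv fun _ => (Real.sqrt_pos.2 (by positivity)).ne').smul
    (contDiff_const.add (Submodule.subtypeL (ℝ ∙ e)ᗮ).contDiff)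

theorem norm_centralProj {e : W} (he : ‖e‖ = 1) (ζ : (ℝ ∙ e)ᗮ) : ‖centralProj e ζ‖ = 1 := by
  have h1 : ‖e + ζ‖ ^ 2 = 1 + ‖ζ‖ ^ 2 := by
    rw [norm_add_sq_real, he, Submodule.mem_orthogonal_singleton_iff_inner_right.1 ζ.2]
    simp
  rw [centralProj, norm_smul, norm_inv, Real.norm_of_nonneg (Real.sqrt_nonneg _), ← h1,
    Real.sqrt_sq (norm_nonneg _), inv_mul_cancel₀]
  intro h
  rw [h] at h1
  nlinarith [sq_nonneg ‖ζ‖]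

theorem dirDeriv_centralProj_zero (e : W) (η : (ℝ ∙ e)ᗮ) : dirDeriv η (centralProj e) 0 = η := by
  refine dirDeriv_eq (contDiff_centralProj e) ?_
  have h1 : HasDerivAt (fun s : ℝ => 1 + s ^ 2 * ‖η‖ ^ 2) 0 0 := by
    simpa using (((hasDerivAt_id (0 : ℝ)).pow 2).mul_const (‖η‖ ^ 2)).const_add 1
  have h2 := (h1.sqrt (by norm_num)).inv (by norm_num)
  have h3 : HasDerivAt (fun s : ℝ => e + s • (η : W)) (η : W) 0 := by
    simpa using ((hasDerivAt_id (0 : ℝ)).smul_const (η : W)).const_add e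
  have h4 := h2.smul h3
  have h5 : (fun s : ℝ => centralProj e (0 + s • η)) =
      (fun s : ℝ => √(1 + s ^ 2 * ‖η‖ ^ 2))⁻¹ • fun s : ℝ => e + s • (η : W) := by
    funext s
    simp [centralProj, norm_smul, mul_pow]
  rw [h5]
  simpa using h4

end SphereChart

/-! ### Nontriviality -/

namespace IsProfile

variable {n : ℕ} {w p : ℝ → ℝ} {Q : Type*} [NormedAddCommGroup Q] [NormedSpace ℝ Q]
  {u : Q → EuclideanSpace ℝ (Fin n)}

theorem contDiff_point (h : IsProfile w p) (hu : ContDiff ℝ ∞ u) :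
    ContDiff ℝ ∞ fun x : ℝ × Q => point n w x.1 (u x.2) :=
  (assemble n).contDiff.comp (((h.contDiff_y₁.comp contDiff_fst).smul (hu.comp contDiff_snd)).prodMk
    ((h.contDiff_y₂.comp contDiff_fst).prodMk (h.contDiff_y₃.comp contDiff_fst)))

theorem dirDeriv_point (h : IsProfile w p) (hu : ContDiff ℝ ∞ u) (d x : ℝ × Q) :
    dirDeriv d (fun x : ℝ × Q => point n w x.1 (u x.2)) x =
      assemble n ((d.1 * z₁ w p x.1) • u x.2 + y₁ w x.1 • dirDeriv d.2 u x.2,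
        d.1 * z₂ w p x.1, d.1 * z₃ w p x.1) := by
  refine dirDeriv_eq (h.contDiff_point hu) ?_
  have h1 : HasDerivAt (fun s : ℝ => x.1 + s * d.1) d.1 0 := by
    simpa using ((hasDerivAt_id (0 : ℝ)).mul_const d.1).const_add x.1
  have h2 : HasDerivAt (fun s : ℝ => x.2 + s • d.2) d.2 0 := by
    simpa using ((hasDerivAt_id (0 : ℝ)).smul_const d.2).const_add x.2
  have hx1 : x.1 + 0 * d.1 = x.1 := by rw [zero_mul, add_zero]
  have hx2 : x.2 + (0 : ℝ) • d.2 = x.2 := by rw [zero_smul, add_zero]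
  have k1 := (hx1.symm ▸ h.hasDerivAt_y₁ x.1 :
    HasDerivAt (y₁ w) (z₁ w p x.1) (x.1 + 0 * d.1)).comp (0 : ℝ) h1
  have k2 := (hx1.symm ▸ h.hasDerivAt_y₂ x.1 :
    HasDerivAt (y₂ w) (z₂ w p x.1) (x.1 + 0 * d.1)).comp (0 : ℝ) h1
  have k3 := (hx1.symm ▸ h.hasDerivAt_y₃ x.1 :
    HasDerivAt (y₃ w) (z₃ w p x.1) (x.1 + 0 * d.1)).comp (0 : ℝ) h1
  have k4 : HasDerivAt (fun s : ℝ => u (x.2 + s • d.2)) (dirDeriv d.2 u x.2) 0 := by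
    have : HasFDerivAt u (fderiv ℝ u x.2) (x.2 + (0 : ℝ) • d.2) := by
      rw [hx2]
      exact (hu.differentiable (by simp) x.2).hasFDerivAt
    exact this.comp_hasDerivAt (0 : ℝ) h2
  have k5 := hasDerivAt_assemble (k1.smul k4) k2 k3
  have k6 : HasDerivAt (fun s : ℝ => point n w (x + s • d).1 (u (x + s • d).2)) _ 0 := k5
  rw [Function.comp_apply, hx1, hx2, add_comm (y₁ w x.1 • _)] at k6
  rwa [mul_comm d.1, mul_comm d.1, mul_comm d.1]

/-- The induced metric is a warped product: `u` is a unit vector orthogonal to its own derivatives,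
so the profile and orbit directions do not mix. -/
theorem inner_dirDeriv_point (h : IsProfile w p) (hu : ContDiff ℝ ∞ u) (hu1 : ∀ ζ, ‖u ζ‖ = 1)
    (b c x : ℝ × Q) :
    ⟪dirDeriv b (fun x : ℝ × Q => point n w x.1 (u x.2)) x,
      dirDeriv c (fun x : ℝ × Q => point n w x.1 (u x.2)) x⟫ =
      b.1 * c.1 * ((1 + w x.1 ^ 2 + p x.1 ^ 2) / (1 + w x.1 ^ 2) ^ 2) +
      y₁ w x.1 ^ 2 * ⟪dirDeriv b.2 u x.2, dirDeriv c.2 u x.2⟫ := by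
  have h1 : ∀ η, ⟪u x.2, dirDeriv η u x.2⟫ = 0 := by
    intro η
    have h2 : (fun ζ => ⟪u ζ, u ζ⟫) = fun _ => (1 : ℝ) := by
      funext ζ
      rw [real_inner_self_eq_norm_sq, hu1, one_pow]
    have h3 := congrFun (dirDeriv_inner hu hu η) x.2
    rw [h2, real_inner_comm (u x.2) (dirDeriv η u x.2)] at h3
    have h4 : dirDeriv η (fun _ : Q => (1 : ℝ)) x.2 = 0 := by simp [dirDeriv]
    linarith
  have h2 : ⟪u x.2, u x.2⟫ = 1 := by rw [real_inner_self_eq_norm_sq, hu1, one_pow]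
  have h3 := z_sq w p x.1
  rw [div_pow, sq_sqrt₂] at h3
  rw [h.dirDeriv_point hu, h.dirDeriv_point hu, inner_assemble]
  simp only [inner_add_left, inner_add_right, real_inner_smul_left, real_inner_smul_right, h1, h2]
  rw [real_inner_comm (u x.2) (dirDeriv b.2 u x.2), h1, ← h3]
  ring

theorem dirDeriv_point_mem_tangentSpace (h : IsProfile w p) (hu : ContDiff ℝ ∞ u)
    (hu1 : ∀ ζ, ‖u ζ‖ = 1) (d x : ℝ × Q) :
    dirDeriv d (fun x : ℝ × Q => point n w x.1 (u x.2)) x ∈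
      tangentSpace (surface n w) (point n w x.1 (u x.2)) := by
  have h0 : ContDiff ℝ ∞ fun s : ℝ => x + s • d := contDiff_const.add (contDiff_id.smul contDiff_const)
  have h1 : ContDiff ℝ ∞ fun s : ℝ => point n w (x + s • d).1 (u (x + s • d).2) :=
    (h.contDiff_point hu).comp h0
  refine Submodule.subset_span ⟨_, h1, fun t => ⟨_, _, hu1 _, rfl⟩, by simp, ?_⟩
  exact (dirDeriv_eq (h.contDiff_point hu)
    (h1.differentiable (by simp) 0).hasDerivAt).symm

/-- Polarization: the differential of `φ` preserves lengths on the whole linear tangent space, hence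
inner products, so the composed map induces the same metric coefficients in the chart. -/
theorem inner_dirDeriv_isometry (h : IsProfile w p) (hu : ContDiff ℝ ∞ u)
    (hu1 : ∀ ζ, ‖u ζ‖ = 1) {φ : Ambient n → Ambient n} {V : Set (Ambient n)} (hV : IsOpen V)
    (hMV : surface n w ⊆ V) (hφ : ContDiffOn ℝ ∞ φ V)
    (hiso : ∀ q ∈ surface n w, ∀ v ∈ tangentSpace (surface n w) q, ‖fderiv ℝ φ q v‖ = ‖v‖) :
    ContDiff ℝ ∞ (fun x : ℝ × Q => φ (point n w x.1 (u x.2))) ∧ ∀ b c x : ℝ × Q,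
      ⟪dirDeriv b (fun x : ℝ × Q => φ (point n w x.1 (u x.2))) x,
        dirDeriv c (fun x : ℝ × Q => φ (point n w x.1 (u x.2))) x⟫ =
      ⟪dirDeriv b (fun x : ℝ × Q => point n w x.1 (u x.2)) x,
        dirDeriv c (fun x : ℝ × Q => point n w x.1 (u x.2)) x⟫ := by
  have hX : ∀ x : ℝ × Q, point n w x.1 (u x.2) ∈ surface n w := fun x => ⟨_, _, hu1 _, rfl⟩
  have hat : ∀ x : ℝ × Q, ContDiffAt ℝ ∞ φ (point n w x.1 (u x.2)) := fun x =>
    hφ.contDiffAt (hV.mem_nhds (hMV (hX x)))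
  refine ⟨contDiff_iff_contDiffAt.2 fun x => (hat x).comp x (h.contDiff_point hu).contDiffAt, ?_⟩
  intro b c x
  have hd : ∀ d, dirDeriv d (fun x : ℝ × Q => φ (point n w x.1 (u x.2))) x =
      fderiv ℝ φ (point n w x.1 (u x.2))
        (dirDeriv d (fun x : ℝ × Q => point n w x.1 (u x.2)) x) := by
    intro d
    have := (((hat x).differentiableAt (by simp)).hasFDerivAt.comp x
      ((h.contDiff_point hu).differentiable (by simp) x).hasFDerivAt).fderiv
    exact DFunLike.congr_fun this d
  have hmem := fun d => h.dirDeriv_point_mem_tangentSpace hu hu1 d x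
  rw [hd, hd, real_inner_eq_norm_add_mul_self_sub_norm_mul_self_sub_norm_mul_self_div_two,
    real_inner_eq_norm_add_mul_self_sub_norm_mul_self_sub_norm_mul_self_div_two
      (dirDeriv b (fun x : ℝ × Q => point n w x.1 (u x.2)) x), ← map_add,
    hiso _ (hX x) _ (hmem b), hiso _ (hX x) _ (hmem c),
    hiso _ (hX x) _ (Submodule.add_mem _ (hmem b) (hmem c))]

/-- The derivatives of the metric coefficients at the neck. -/
theorem metric_at_neck (h : IsProfile w p) (hp : p 0 = 0) {c : ℝ} (hc : 0 < c)
    (hpc : HasDerivAt p c 0) :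
    deriv (fun t => (1 + w t ^ 2 + p t ^ 2) / (1 + w t ^ 2) ^ 2) 0 = 0 ∧
    deriv (fun t => y₁ w t ^ 2) 0 = 0 ∧ 0 < deriv (deriv fun t => y₁ w t ^ 2) 0 := by
  have hw : HasDerivAt w 0 0 := by simpa [hp] using h.hasDeriv 0
  have hz0 : z₁ w p 0 = 0 := by rw [z₁, hp, zero_div]
  have hf : (deriv fun t => y₁ w t ^ 2) = fun t => 2 * y₁ w t * z₁ w p t := by
    funext t
    simpa using ((h.hasDerivAt_y₁ t).fun_pow 2).deriv
  refine ⟨?_, ?_, ?_⟩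
  · have h1 : HasDerivAt (fun t => 1 + w t ^ 2) 0 0 := by
      simpa using (hw.fun_pow 2).const_add 1
    have h2 : HasDerivAt (fun t => 1 + w t ^ 2 + p t ^ 2) 0 0 := by
      simpa [hp] using h1.fun_add (hpc.fun_pow 2)
    have h3 := h2.fun_div (h1.fun_pow 2) (pow_ne_zero 2 (by positivity : 1 + w 0 ^ 2 ≠ 0))
    simpa using h3.deriv
  · rw [hf]
    simp [hz0]
  · have hs : HasDerivAt (fun t => √(1 + w t ^ 2) ^ 3) (deriv (fun t => √(1 + w t ^ 2) ^ 3) 0) 0 :=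
      ((h.contDiff_sqrt₁.pow 3).differentiable (by simp) 0).hasDerivAt
    have hpos : 0 < √(1 + w 0 ^ 2) ^ 3 := pow_pos (sqrt_pos₁ _) 3
    have h1 : HasDerivAt (z₁ w p) (c / √(1 + w 0 ^ 2) ^ 3) 0 := by
      have h2 := hpc.fun_div hs hpos.ne'
      rw [hp, zero_mul, sub_zero, sq (√(1 + w 0 ^ 2) ^ 3), mul_div_mul_right _ _ hpos.ne'] at h2
      exact h2
    have h2 := ((h.hasDerivAt_y₁ 0).const_mul 2).fun_mul h1
    rw [hf, h2.deriv, hz0]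
    have := mul_pos (h.y₁_pos 0) (div_pos hc hpos)
    linarith

/-- At the neck the composition of a chart of the hypersurface with an isometry would have a
negative curvature term, whereas the equations of `M'` make it nonnegative. The chart is the profile
parameter times the central projection for the orbit sphere; `n ≥ 2` provides an orbit direction
`τ`. -/
theorem not_areIsometric_of_blocks (h : IsProfile w p) (hn : 2 ≤ n) (hp : p 0 = 0) {c : ℝ}
    (hc : 0 < c) (hpc : HasDerivAt p c 0) {M' : Set (Ambient n)}
    {S T : Finset (Fin (n + 2))} (hST : Disjoint S T) {r : ℝ} (hr : 0 < r)
    (hS : ∀ x ∈ M', ∑ i ∈ S, x i ^ 2 = r ^ 2)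
    (hT : (∃ s : ℝ, 0 < s ∧ ∀ x ∈ M', ∑ i ∈ T, x i ^ 2 = s ^ 2) ∨
      ∃ (i : Fin (n + 2)) (k : ℝ), T = {i} ∧ ∀ x ∈ M', x i = k) :
    ¬ AreIsometric (surface n w) M' := by
  rintro ⟨φ, V, hV, hMV, hφ, hbij, hiso⟩
  obtain ⟨i₀⟩ : Nonempty (Fin n) := ⟨⟨0, by omega⟩⟩
  set e : EuclideanSpace ℝ (Fin n) := EuclideanSpace.single i₀ 1 with he
  have he1 : ‖e‖ = 1 := by simp [he]
  have hu := contDiff_centralProj e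
  have hu1 := norm_centralProj he1
  have hdim : Module.finrank ℝ (ℝ ∙ e)ᗮ + 1 = n := by
    have h1 := Submodule.finrank_add_finrank_orthogonal (ℝ ∙ e)
    rw [finrank_span_singleton (by rw [← norm_pos_iff, he1]; norm_num),
      finrank_euclideanSpace_fin] at h1
    omega
  obtain ⟨τ, hτ⟩ : ∃ τ : (ℝ ∙ e)ᗮ, τ ≠ 0 := by
    have : Nontrivial (ℝ ∙ e)ᗮ := Module.finrank_pos_iff.1 (by omega : 0 < Module.finrank ℝ (ℝ ∙ e)ᗮ)
    exact exists_ne 0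
  obtain ⟨hF, hG⟩ := h.inner_dirDeriv_isometry hu hu1 hV hMV hφ hiso
  obtain ⟨he₁, hf₁, hf₂⟩ := h.metric_at_neck hp hc hpc
  have hecd : ContDiff ℝ ∞ fun t => (1 + w t ^ 2 + p t ^ 2) / (1 + w t ^ 2) ^ 2 :=
    ((contDiff_const.add (h.smooth_w.pow 2)).add (h.smooth_p.pow 2)).div
      ((contDiff_const.add (h.smooth_w.pow 2)).pow 2) fun _ => by positivity
  obtain ⟨hrank, haa, hab, hneg⟩ := warped_product_waist hF hu hecd (h.contDiff_y₁.pow 2)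
    (fun b c x => (hG b c x).trans (h.inner_dirDeriv_point hu hu1 b c x)) (by positivity) he₁
    (pow_pos (h.y₁_pos 0) 2) hf₁ hf₂
    (fun η hη => by rw [dirDeriv_centralProj_zero] at hη; exact_mod_cast hη) hτ
  have hmem : ∀ x : ℝ × (ℝ ∙ e)ᗮ, φ (point n w x.1 (centralProj e x.2)) ∈ M' := fun x =>
    hbij.mapsTo ⟨_, _, hu1 _, rfl⟩
  refine hneg.not_ge (curvature_nonneg_of_blocks hF hST hr (fun x => hS _ (hmem x)) ?_
    (hrank.trans hdim) haa hab)
  rcases hT with ⟨s, hs, hT⟩ | ⟨i, k, hi, hT⟩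
  · exact Or.inl ⟨s, hs, fun x => hT _ (hmem x)⟩
  · exact Or.inr ⟨i, k, hi, fun x => hT _ (hmem x)⟩

theorem isNontrivial (h : IsProfile w p) (hn : 2 ≤ n) (hp : p 0 = 0) {c : ℝ}
    (hc : 0 < c) (hpc : HasDerivAt p c 0) : IsNontrivial (surface n w) := by
  refine ⟨fun k hk hk' => ?_, fun l a b _ _ ha hb _ => ?_⟩
  -- For a round sphere the blocks are all coordinates but the last, with radius `√(1 - k²)`, and
  -- the constant last coordinate.
  · have hk2 : 0 < 1 - k ^ 2 := by nlinarith
    refine h.not_areIsometric_of_blocks hn hp hc hpc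
      (S := Finset.univ.erase (Fin.last (n + 1))) (T := {Fin.last (n + 1)}) (by simp)
      (Real.sqrt_pos.2 hk2) ?_ (Or.inr ⟨_, k, rfl, fun x hx => hx.2⟩)
    rintro x ⟨hx, hxk⟩
    have h1 : ‖x‖ ^ 2 = ∑ i, x i ^ 2 := EuclideanSpace.real_norm_sq_eq x
    rw [← Finset.sum_erase_add _ _ (Finset.mem_univ (Fin.last (n + 1))), hxk,
      mem_sphere_zero_iff_norm.1 hx] at h1
    rw [Real.sq_sqrt hk2.le]
    linarith
  · refine h.not_areIsometric_of_blocks hn hp hc hpc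
      (S := Finset.univ.filter fun i => i.val ≤ l) (T := Finset.univ.filter fun i => l < i.val)
      ?_ ha (fun x hx => hx.1) (Or.inl ⟨b, hb, fun x hx => hx.2⟩)
    rw [Finset.disjoint_filter]
    intro i _ h1 h2
    omega

end IsProfile

end SphereHypersurface

theorem theorem5p2 (n m : ℕ) (hm : 1 ≤ m) (hmn : m ≤ n - 1) :
    ∃ ε : ℝ, 0 < ε ∧ ∀ H : ℝ, 0 < H → H < ε →
      ∃ (M : Set (SphereHypersurface.Ambient n))
        (N : SphereHypersurface.Ambient n → SphereHypersurface.Ambient n),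
        SphereHypersurface.IsEmbeddedHypersurface n M ∧
        IsCompact M ∧ IsConnected M ∧
        SphereHypersurface.IsRotational M ∧
        SphereHypersurface.IsUnitNormal M N ∧
        SphereHypersurface.HasConstantMeanCurvature m M N H ∧
        SphereHypersurface.IsNontrivial M := by
  obtain ⟨ε, hε, hex⟩ := SphereHypersurface.exists_periodic_profile hm (by omega : m < n)
  refine ⟨ε, hε, fun H hH hHε => ?_⟩
  obtain ⟨w, p, hw, hp, hs, hp0, hc, hper⟩ := hex H hH hHε
  have h : SphereHypersurface.IsProfile w p :=
    ⟨hw, hp, fun t => (hs t).1, fun t => (hs t).2.2, hper⟩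
  exact ⟨SphereHypersurface.IsProfile.surface n w, SphereHypersurface.IsProfile.normal n w p,
    h.isEmbeddedHypersurface, h.isCompact_surface, h.isConnected_surface (by omega),
    h.isRotational, h.isUnitNormal, h.hasConstantMeanCurvature hm (by omega) hs,
    h.isNontrivial (by omega) hp0 hc (by simpa [hp0] using (hs 0).2.1)⟩
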